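/- Let $\mathbb T^n=\mathbb R^n/2\pi\mathbb Z^n$, let $P\subset\mathbb R^n$ be a two-dimensional linear subspace, and let $F$ be the foliation of $\mathbb T^n$ by the projections of the planes parallel to $P$ (a linear foliation). After a permutation of the coordinates the lifted leaves are the level planes of $l=(l_3,\dots,l_n)$, $l_j(x)=a_1^jx_1+a_2^jx_2-x_j$. The foliation $F$ is called Diophantine if there are constants $C>0$, $s>1$ such that for all $m\in\mathbb Z^n\setminus\{0\}$ $$\Big|m_1+\sum_{j=3}^n a_1^jm_j\Big|+\Big|m_2+\sum_{j=3}^n a_2^jm_j\Big|>\frac{C}{|m|^s},\qquad |m|=\sum_{j=1}^n|m_j| .$$ A Riemannian metric is called Euclidean if it is flat, i.e. locally isometric to the standard Euclidean $\mathbb R^n$. For a Riemannian metric $g$ on $\mathbb T^n$ let $\sigma$ be a continuous family of complex structures on the leaves of $F$ for which the restriction of $g$ to each leaf is conformal. Theorem. (1) Let $F$ be Diophantine and let $g$ be a real analytic (respectively $C^\infty$) Riemannian metric on $\mathbb T^n$, with $\sigma$ as above. Then (i) there is a real analytic (respectively $C^\infty$) Euclidean metric on $\mathbb T^n$ for which all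 leaves of $F$ are totally geodesic and whose restriction to each leaf is $\sigma$-conformal; (ii) there are a discrete additive subgroup $G\subset\mathbb R^n$ of rank $n$ and a real analytic (respectively $C^\infty$) diffeomorphism $\mathbb T^n\to\mathbb R^n/G$ that transforms $F$ into a linear foliation and $\sigma$ into the complex structure induced on its leaves by the standard Euclidean metric (with one of the two orientations of the leaves). (2) For every linear foliation $F$ and every analytic (respectively $C^\infty$) metric $g$ with $\sigma$ as above, the statements (i) and (ii) are equivalent. (3) If a linear foliation $F$ on $\mathbb T^n$ is not Diophantine, then there is a $C^\infty$ metric $g$ on $\mathbb T^n$, with $\sigma$ as above, such that there is no Euclidean metric of class $C^2$ on $\mathbb T^n$ for which all leaves of $F$ are totally geodesic and whose restriction to each leaf is $\sigma$-conformal. -/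

import Mathlib

open scoped ContDiff Topology RealInnerProductSpace

/-- The lattice `2πℤⁿ` in `ℝⁿ`. -/
def periodLattice (n : ℕ) : AddSubgroup (EuclideanSpace ℝ (Fin n)) where
  carrier := {x | ∀ i, ∃ m : ℤ, x i = 2 * Real.pi * m}
  zero_mem' := fun _ => ⟨0, by simp⟩
  add_mem' := by
    intro x y hx hy i
    obtain ⟨a, ha⟩ := hx i
    obtain ⟨b, hb⟩ := hy i
    exact ⟨a + b, by simp only [PiLp.add_apply, ha, hb]; push_cast; ring⟩
  neg_mem' := by
    intro x hx i
    obtain ⟨a, ha⟩ := hx i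
    exact ⟨-a, by simp only [PiLp.neg_apply, ha]; push_cast; ring⟩

/-- The quotient `ℝⁿ / G` by an additive subgroup. For discrete `G` the projection from `ℝⁿ` is a
covering map, so tensor fields on `ℝⁿ / G` are written in the coordinates of `ℝⁿ`: every tangent
space is `ℝⁿ`, and a field on `ℝⁿ / G` is `C^k` when its composition with the projection is. -/
abbrev QuotientTorus {n : ℕ} (G : AddSubgroup (EuclideanSpace ℝ (Fin n))) : Type :=
  EuclideanSpace ℝ (Fin n) ⧸ G

/-- The torus `𝕋ⁿ = ℝⁿ / 2πℤⁿ`. -/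
abbrev StdTorus (n : ℕ) : Type := QuotientTorus (periodLattice n)

/-- The leaf through `p` of the linear foliation of `ℝⁿ / G` by the projections of the planes
parallel to `P`. -/
def linearLeaf {n : ℕ} (G : AddSubgroup (EuclideanSpace ℝ (Fin n)))
    (P : Submodule ℝ (EuclideanSpace ℝ (Fin n))) (p : QuotientTorus G) : Set (QuotientTorus G) :=
  {q | ∃ v ∈ P, q = p + (v : QuotientTorus G)}

/-- The linear foliation of `𝕋ⁿ` with direction plane `P` is Diophantine. Here `i₁`, `i₂` are
two coordinates that can be used as coordinates on `P`, so that the lifted leaves are the level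
planes of `a₁ j * x i₁ + a₂ j * x i₂ - x j`, `j ≠ i₁, i₂`. -/
def IsDiophantine {n : ℕ} (P : Submodule ℝ (EuclideanSpace ℝ (Fin n))) : Prop :=
  ∃ (i₁ i₂ : Fin n) (a₁ a₂ : Fin n → ℝ), i₁ ≠ i₂ ∧
    (∀ x : EuclideanSpace ℝ (Fin n),
      x ∈ P ↔ ∀ j, j ≠ i₁ → j ≠ i₂ → a₁ j * x i₁ + a₂ j * x i₂ - x j = 0) ∧
    ∃ C s : ℝ, 0 < C ∧ 1 < s ∧ ∀ m : Fin n → ℤ, m ≠ 0 →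
      C / (∑ j, |(m j : ℝ)|) ^ s <
        |(m i₁ : ℝ) + ∑ j ∈ ({i₁, i₂}ᶜ : Finset (Fin n)), a₁ j * m j| +
        |(m i₂ : ℝ) + ∑ j ∈ ({i₁, i₂}ᶜ : Finset (Fin n)), a₂ j * m j|

/-- A field of bilinear forms on the tangent spaces of `𝕋ⁿ`. -/
abbrev BilinField (n : ℕ) : Type :=
  StdTorus n → EuclideanSpace ℝ (Fin n) →L[ℝ] EuclideanSpace ℝ (Fin n) →L[ℝ] ℝ

/-- `g` is a Riemannian metric of class `C^k` on `𝕋ⁿ` (`k = ω` means real analytic). -/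
structure IsRiemannianMetric {n : ℕ} (k : WithTop ℕ∞) (g : BilinField n) : Prop where
  contDiff : ContDiff ℝ k (fun x : EuclideanSpace ℝ (Fin n) => g (x : StdTorus n))
  symm : ∀ p u v, g p u v = g p v u
  pos : ∀ p u, u ≠ 0 → 0 < g p u u

/-- The metric `h` on `𝕋ⁿ` is Euclidean: near each point there are coordinates `φ` in which it
becomes the standard Euclidean metric. (The equation makes the derivative of `φ` invertible. For
`h` of class `C^k`, `k ≥ 2`, coordinates of class `C²` with this property are of
class `C^(k+1)`, and they exist exactly when the curvature of `h` vanishes.) -/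
def IsEuclideanMetric {n : ℕ} (h : BilinField n) : Prop :=
  ∀ x : EuclideanSpace ℝ (Fin n), ∃ (U : Set (EuclideanSpace ℝ (Fin n)))
    (φ : EuclideanSpace ℝ (Fin n) → EuclideanSpace ℝ (Fin n)),
    IsOpen U ∧ x ∈ U ∧ ContDiffOn ℝ 2 φ U ∧
    ∀ y ∈ U, ∀ u v, h (y : StdTorus n) u v = ⟪fderiv ℝ φ y u, fderiv ℝ φ y v⟫

/-- `h(∇_u v, w)` at the point `x`, for the Levi-Civita connection `∇` of `h` and for the constant
vector fields `u`, `v`, `w`, as given by the Koszul formula. -/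
noncomputable def koszul {n : ℕ} (h : BilinField n) (x u v w : EuclideanSpace ℝ (Fin n)) : ℝ :=
  (fderiv ℝ (fun y : EuclideanSpace ℝ (Fin n) => h (y : StdTorus n) v w) x u
    + fderiv ℝ (fun y : EuclideanSpace ℝ (Fin n) => h (y : StdTorus n) u w) x v
    - fderiv ℝ (fun y : EuclideanSpace ℝ (Fin n) => h (y : StdTorus n) u v) x w) / 2

/-- All leaves of the foliation of `𝕋ⁿ` with direction `P` are totally geodesic for `h`, that is,
their second fundamental form vanishes: for constant vector fields `u`, `v` tangent to the leaves
the covariant derivative `z = ∇_u v` is tangent to the leaves too. -/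
def LeavesTotallyGeodesic {n : ℕ} (P : Submodule ℝ (EuclideanSpace ℝ (Fin n)))
    (h : BilinField n) : Prop :=
  ∀ x : EuclideanSpace ℝ (Fin n), ∀ u ∈ P, ∀ v ∈ P, ∃ z ∈ P,
    ∀ w, h (x : StdTorus n) z w = koszul h x u v w

/-- A (continuous) family `J` of complex structures on the (two-dimensional) leaves of the
foliation of `𝕋ⁿ` with direction `P`, given by the multiplication by `i` on the tangent planes. -/
structure IsLeafComplexStructure {n : ℕ} (P : Submodule ℝ (EuclideanSpace ℝ (Fin n)))
    (J : StdTorus n → P →ₗ[ℝ] P) : Prop where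
  sq : ∀ p u, J p (J p u) = -u
  continuous : ∀ u : P, Continuous fun p => ((J p u : P) : EuclideanSpace ℝ (Fin n))

/-- The restriction of `g` to each leaf is conformal with respect to the complex structures `J`:
the multiplication by `i` is a rotation by a right angle for `g`. -/
def IsLeafConformal {n : ℕ} (P : Submodule ℝ (EuclideanSpace ℝ (Fin n)))
    (J : StdTorus n → P →ₗ[ℝ] P) (g : BilinField n) : Prop :=
  ∀ p, ∀ u v : P, g p (J p u) (J p v) = g p u v

/-- There is a Euclidean metric of class `C^k` on `𝕋ⁿ` for which all leaves are totally geodesic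
and whose restriction to each leaf is conformal for `J`. -/
def HasAdaptedEuclideanMetric {n : ℕ} (k : WithTop ℕ∞)
    (P : Submodule ℝ (EuclideanSpace ℝ (Fin n))) (J : StdTorus n → P →ₗ[ℝ] P) : Prop :=
  ∃ h : BilinField n, IsRiemannianMetric k h ∧ IsEuclideanMetric h ∧
    LeavesTotallyGeodesic P h ∧ IsLeafConformal P J h

/-- A `C^k` diffeomorphism `ℝⁿ / G → ℝⁿ / H` for discrete subgroups `G`, `H`: a bijection which,
like its inverse, has a `C^k` lift to the universal covering `ℝⁿ`. -/
structure TorusDiffeo {n : ℕ} (k : WithTop ℕ∞)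
    (G H : AddSubgroup (EuclideanSpace ℝ (Fin n))) where
  toEquiv : QuotientTorus G ≃ QuotientTorus H
  lift : EuclideanSpace ℝ (Fin n) → EuclideanSpace ℝ (Fin n)
  invLift : EuclideanSpace ℝ (Fin n) → EuclideanSpace ℝ (Fin n)
  contDiff_lift : ContDiff ℝ k lift
  contDiff_invLift : ContDiff ℝ k invLift
  coe_lift : ∀ x, ((lift x : EuclideanSpace ℝ (Fin n)) : QuotientTorus H) =
    toEquiv (x : QuotientTorus G)
  coe_invLift : ∀ y, ((invLift y : EuclideanSpace ℝ (Fin n)) : QuotientTorus G) =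
    toEquiv.symm (y : QuotientTorus H)

/-- There are a discrete subgroup `G` of rank `n` in `ℝⁿ` and a `C^k` diffeomorphism
`𝕋ⁿ → ℝⁿ / G` that transforms the foliation with direction `P` into the linear foliation with some
direction plane `Q`, and the complex structures `J` on the leaves into the standard one, that is,
the rotation `J₀` of `Q` by a right angle for the standard inner product (for one of the two
orientations of `Q`). -/
def HasLinearModel {n : ℕ} (k : WithTop ℕ∞)
    (P : Submodule ℝ (EuclideanSpace ℝ (Fin n))) (J : StdTorus n → P →ₗ[ℝ] P) : Prop :=
  ∃ (G : AddSubgroup (EuclideanSpace ℝ (Fin n))) (φ : TorusDiffeo k (periodLattice n) G)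
    (Q : Submodule ℝ (EuclideanSpace ℝ (Fin n))) (J₀ : Q →ₗ[ℝ] Q),
    DiscreteTopology G ∧ Module.finrank ℤ G = n ∧ Module.finrank ℝ Q = 2 ∧
    (∀ p, φ.toEquiv '' linearLeaf (periodLattice n) P p = linearLeaf G Q (φ.toEquiv p)) ∧
    (∀ w, J₀ (J₀ w) = -w) ∧ (∀ w w' : Q, ⟪J₀ w, J₀ w'⟫ = ⟪w, w'⟫) ∧
    ∀ (x : EuclideanSpace ℝ (Fin n)) (u : P), ∃ w : Q,
      (w : EuclideanSpace ℝ (Fin n)) = fderiv ℝ φ.lift x u ∧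
      (J₀ w : EuclideanSpace ℝ (Fin n)) = fderiv ℝ φ.lift x (J (x : StdTorus n) u)

open MeasureTheory in
/-- The normalized Haar measure on the circle. -/
noncomputable local instance circleMeasureSpace : MeasureSpace UnitAddCircle :=
  ⟨AddCircle.haarAddCircle⟩

open MeasureTheory in
local instance circleHaar : Measure.IsAddHaarMeasure (volume : Measure UnitAddCircle) :=
  inferInstanceAs (Measure.IsAddHaarMeasure AddCircle.haarAddCircle)

open MeasureTheory in
local instance circleProbability : IsProbabilityMeasure (volume : Measure UnitAddCircle) :=
  inferInstanceAs (IsProbabilityMeasure AddCircle.haarAddCircle)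

/-- Euclidean space of dimension `n`. -/
abbrev Euc (n : ℕ) : Type := EuclideanSpace ℝ (Fin n)

/-- The torus on which Mathlib has Fourier series. -/
abbrev Tor (n : ℕ) : Type := UnitAddTorus (Fin n)

/-- Square summable families indexed by `ℤⁿ`. -/
abbrev SqSum (n : ℕ) : Type := lp (fun _ : Fin n → ℤ => ℂ) 2

/-- `f` is invariant under translations by `2πℤⁿ`. -/
def LatticePeriodic {n : ℕ} {F : Type*} (f : Euc n → F) : Prop :=
  ∀ x, ∀ γ ∈ periodLattice n, f (x + γ) = f x

section torus

variable {n : ℕ}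

/-- The projection of `ℝⁿ` onto the torus, with period `2π` in every coordinate. -/
noncomputable def toTorus (n : ℕ) : Euc n →+ Tor n where
  toFun x i := ((x i / (2 * Real.pi) : ℝ) : UnitAddCircle)
  map_zero' := by ext i; simp
  map_add' x y := by ext i; simp [add_div]

theorem toTorus_apply (x : Euc n) (i : Fin n) :
    toTorus n x i = ((x i / (2 * Real.pi) : ℝ) : UnitAddCircle) := rfl

theorem continuous_toTorus : Continuous (toTorus n) := by
  refine continuous_pi fun i => ?_
  change Continuous fun x : Euc n => ((x i / (2 * Real.pi) : ℝ) : UnitAddCircle)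
  exact (AddCircle.continuous_mk' 1).comp (by fun_prop)

theorem toTorus_surjective : Function.Surjective (toTorus n) := by
  intro t
  choose y hy using fun i => QuotientAddGroup.mk_surjective (t i)
  refine ⟨WithLp.toLp 2 fun i => y i * (2 * Real.pi), ?_⟩
  ext i
  rw [toTorus_apply, ← hy i]
  have : (2 * Real.pi) ≠ 0 := by positivity
  simp [this]

theorem toTorus_eq_zero_iff (x : Euc n) : toTorus n x = 0 ↔ x ∈ periodLattice n := by
  have h2 : (2 * Real.pi) ≠ 0 := by positivity
  constructor
  · intro h i
    have := congrFun h i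
    rw [toTorus_apply, Pi.zero_apply, AddCircle.coe_eq_zero_iff] at this
    obtain ⟨m, hm⟩ := this
    refine ⟨m, ?_⟩
    simp only [zsmul_eq_mul, mul_one] at hm
    rw [hm]; field_simp
  · intro h
    ext i
    obtain ⟨m, hm⟩ := h i
    rw [toTorus_apply, Pi.zero_apply, AddCircle.coe_eq_zero_iff]
    refine ⟨m, ?_⟩
    rw [hm]; simp only [zsmul_eq_mul, mul_one]; field_simp

theorem toTorus_eq_iff (x y : Euc n) : toTorus n x = toTorus n y ↔ x - y ∈ periodLattice n := by
  rw [← toTorus_eq_zero_iff, map_sub, sub_eq_zero]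

theorem isOpenQuotientMap_toTorus : IsOpenQuotientMap (toTorus n) := by
  refine ⟨toTorus_surjective, continuous_toTorus, ?_⟩
  have h2 : (2 * Real.pi) ≠ 0 := by positivity
  have h1 : IsOpenMap (Pi.map fun (_ : Fin n) (y : ℝ) => (y : UnitAddCircle)) :=
    IsOpenMap.piMap (fun _ => QuotientAddGroup.isOpenMap_coe)
      (Filter.Eventually.of_forall fun _ => QuotientAddGroup.mk_surjective)
  have h3 : IsOpenMap fun x : Euc n => fun i => x i / (2 * Real.pi) := by
    have e1 := (PiLp.homeomorph 2 fun _ : Fin n => ℝ).isOpenMap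
    have e2 := (Homeomorph.piCongrRight fun _ : Fin n =>
      Homeomorph.mulRight₀ (2 * Real.pi)⁻¹ (inv_ne_zero h2)).isOpenMap
    convert e2.comp e1 using 1
    funext x i
    simp only [div_eq_mul_inv]
    rfl
  exact h1.comp h3

/-- A continuous periodic function as a function on the torus. -/
noncomputable def descend {F : Type*} [TopologicalSpace F] (f : Euc n → F) (hf : Continuous f)
    (hp : LatticePeriodic f) : C(Tor n, F) :=
  have hfac : ∀ x, f (Function.surjInv toTorus_surjective (toTorus n x)) = f x := fun x => by
    have h := Function.surjInv_eq (toTorus_surjective (n := n)) (toTorus n x)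
    rw [toTorus_eq_iff] at h
    simpa using hp x _ h
  ⟨fun t => f (Function.surjInv toTorus_surjective t),
    isOpenQuotientMap_toTorus.isQuotientMap.continuous_iff.2 (by
      convert hf using 1
      funext x
      exact hfac x)⟩

theorem descend_apply {F : Type*} [TopologicalSpace F] (f : Euc n → F) (hf : Continuous f)
    (hp : LatticePeriodic f) (x : Euc n) : descend f hf hp (toTorus n x) = f x := by
  have h := Function.surjInv_eq (toTorus_surjective (n := n)) (toTorus n x)
  rw [toTorus_eq_iff] at h
  change f (Function.surjInv toTorus_surjective (toTorus n x)) = f x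
  simpa using hp x _ h

theorem latticePeriodic_comp_toTorus {F : Type*} (u : Tor n → F) :
    LatticePeriodic fun x => u (toTorus n x) := by
  intro x γ hγ
  simp only [map_add, (toTorus_eq_zero_iff γ).2 hγ, add_zero]

/-- The linear form `x ↦ ∑ mᵢ xᵢ`. -/
noncomputable def freq (m : Fin n → ℤ) : Euc n →L[ℝ] ℝ :=
  ∑ i, (m i : ℝ) • EuclideanSpace.proj i

theorem freq_apply (m : Fin n → ℤ) (x : Euc n) : freq m x = ∑ i, (m i : ℝ) * x i := by
  simp [freq]

/-- The character `e^{i m·x}`. -/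
noncomputable def chr (m : Fin n → ℤ) (x : Euc n) : ℂ := Complex.exp (Complex.I * freq m x)

theorem norm_chr (m : Fin n → ℤ) (x : Euc n) : ‖chr m x‖ = 1 := by
  rw [chr, mul_comm]; exact Complex.norm_exp_ofReal_mul_I _

theorem chr_add (m : Fin n → ℤ) (x y : Euc n) : chr m (x + y) = chr m x * chr m y := by
  simp [chr, mul_add, Complex.exp_add]

theorem chr_ne_zero (m : Fin n → ℤ) (x : Euc n) : chr m x ≠ 0 := Complex.exp_ne_zero _

theorem mFourier_toTorus (m : Fin n → ℤ) (x : Euc n) :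
    UnitAddTorus.mFourier m (toTorus n x) = chr m x := by
  simp only [UnitAddTorus.mFourier, ContinuousMap.coe_mk, toTorus_apply, fourier_coe_apply, chr,
    freq_apply]
  rw [← Complex.exp_sum]
  congr 1
  push_cast
  rw [Finset.mul_sum]
  refine Finset.sum_congr rfl fun i _ => ?_
  have : (Real.pi : ℂ) ≠ 0 := by exact_mod_cast Real.pi_ne_zero
  field_simp

end torus

section fourier

open MeasureTheory

variable {n : ℕ}

/-- The Fourier coefficients of a continuous function on the torus. -/
noncomputable def fc (n : ℕ) : C(Tor n, ℂ) →L[ℂ] SqSum n :=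
  (UnitAddTorus.mFourierBasis (d := Fin n)).repr.toContinuousLinearEquiv.toContinuousLinearMap ∘L
    ContinuousMap.toLp 2 volume ℂ

theorem fc_apply (u : C(Tor n, ℂ)) (m : Fin n → ℤ) :
    fc n u m = ∫ t, UnitAddTorus.mFourier (-m) t * u t := by
  change UnitAddTorus.mFourierBasis.repr (ContinuousMap.toLp 2 volume ℂ u) m = _
  rw [UnitAddTorus.mFourierBasis_repr, UnitAddTorus.mFourierCoeff_toLp]
  rfl

theorem fc_injective : Function.Injective (fc n) :=
  (UnitAddTorus.mFourierBasis (d := Fin n)).repr.injective.comp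
    (ContinuousMap.toLp_injective volume)

theorem fc_denseRange : DenseRange (fc n) :=
  (UnitAddTorus.mFourierBasis (d := Fin n)).repr.surjective.denseRange.comp
    (ContinuousMap.toLp_denseRange ℂ volume ℂ (by simp))
    (UnitAddTorus.mFourierBasis (d := Fin n)).repr.continuous

theorem fc_translate (u : C(Tor n, ℂ)) (h : Euc n) (m : Fin n → ℤ) :
    fc n (u.comp (ContinuousMap.addRight (toTorus n h))) m = chr m h * fc n u m := by
  rw [fc_apply, fc_apply, ← integral_const_mul, ← integral_add_right_eq_self
    (fun t => chr m h * (UnitAddTorus.mFourier (-m) t * u t)) (toTorus n h)]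
  refine integral_congr_ae (Filter.Eventually.of_forall fun t => ?_)
  obtain ⟨x, rfl⟩ := toTorus_surjective t
  have h1 : UnitAddTorus.mFourier (-m) (toTorus n x + toTorus n h) = chr (-m) x * chr (-m) h := by
    rw [← map_add, mFourier_toTorus, chr_add]
  have h2 : chr m h * chr (-m) h = 1 := by
    have : freq (-m) h = - freq m h := by simp [freq_apply]
    rw [chr, chr, ← Complex.exp_add, this]; simp
  simp only [ContinuousMap.comp_apply, ContinuousMap.coe_addRight]
  rw [h1, mFourier_toTorus]
  linear_combination (-(chr (-m) x * u (toTorus n x + toTorus n h))) * h2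

theorem hasSum_fc (u : C(Tor n, ℂ)) (hu : Summable fun m => fc n u m) (x : Euc n) :
    HasSum (fun m => fc n u m * chr m x) (u (toTorus n x)) := by
  have h : (fun m => fc n u m) = UnitAddTorus.mFourierCoeff u := by
    funext m; rw [fc_apply]; rfl
  rw [h] at hu
  have := UnitAddTorus.hasSum_mFourier_series_apply_of_summable hu (toTorus n x)
  simp only [mFourier_toTorus, smul_eq_mul] at this
  convert this using 3 with m
  exact congrFun h m

theorem fc_mFourier (m k : Fin n → ℤ) :
    fc n (UnitAddTorus.mFourier m) k = if k = m then 1 else 0 := by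
  change UnitAddTorus.mFourierBasis.repr (UnitAddTorus.mFourierLp 2 m) k = _
  rw [← UnitAddTorus.coe_mFourierBasis, HilbertBasis.repr_self]
  by_cases h : k = m
  · subst h; simp
  · simp [h]

theorem hasSum_of_summable (a : (Fin n → ℤ) → ℂ) (ha : Summable a) :
    ∃ u : C(Tor n, ℂ), (∀ m, fc n u m = a m) ∧
      HasSum (fun m => a m • UnitAddTorus.mFourier m) u := by
  have hs : Summable fun m => a m • UnitAddTorus.mFourier (d := Fin n) m := by
    refine Summable.of_norm ?_
    simpa [norm_smul, UnitAddTorus.mFourier_norm] using ha.norm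
  refine ⟨∑' m, a m • UnitAddTorus.mFourier m, fun k => ?_, hs.hasSum⟩
  have h1 := ((lp.evalCLM ℂ (fun _ : Fin n → ℤ => ℂ) 2 k).comp (fc n)).hasSum hs.hasSum
  have h2 : ∀ m, ((lp.evalCLM ℂ (fun _ : Fin n → ℤ => ℂ) 2 k).comp (fc n))
      (a m • UnitAddTorus.mFourier m) = if m = k then a k else 0 := fun m => by
    change fc n (a m • UnitAddTorus.mFourier m) k = _
    rw [map_smul, lp.coeFn_smul, Pi.smul_apply, fc_mFourier]
    by_cases h : m = k
    · subst h; simp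
    · simp [h, Ne.symm h]
  have h3 := hasSum_ite_eq k (a k)
  exact h1.unique (by simpa only [Function.comp_def, h2] using h3)

theorem norm_toLp_top_le (u : C(Tor n, ℂ)) :
    ‖ContinuousMap.toLp (E := ℂ) ⊤ (volume : Measure (Tor n)) ℂ u‖ ≤ ‖u‖ := by
  refine (ContinuousLinearMap.le_of_opNorm_le _ (ContinuousMap.toLp_norm_le _) u).trans ?_
  simp

theorem ofReal_smul_sqSum (c : ℝ) (a : SqSum n) : (c : ℂ) • a = c • a := by
  ext m
  exact Complex.coe_smul c (a m)

/-- Multiplication by a continuous function, on the side of the Fourier coefficients. -/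
noncomputable def mulOp (n : ℕ) : C(Tor n, ℂ) →L[ℝ] SqSum n →L[ℝ] SqSum n :=
  LinearMap.mkContinuous₂ (LinearMap.mk₂ ℝ
    (fun u a => (UnitAddTorus.mFourierBasis (d := Fin n)).repr
      ((ContinuousLinearMap.mul ℂ ℂ).holderL volume ⊤ 2 2 (ContinuousMap.toLp ⊤ volume ℂ u)
        ((UnitAddTorus.mFourierBasis (d := Fin n)).repr.symm a)))
    (fun u v a => by simp only [map_add, add_apply])
    (fun c u a => by
      rw [← Complex.coe_smul c u, ← ofReal_smul_sqSum]
      simp only [map_smul, smul_apply])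
    (fun u a b => by simp only [map_add])
    (fun c u a => by
      rw [← ofReal_smul_sqSum, ← ofReal_smul_sqSum]
      simp only [map_smul])) 1
    (fun u a => by
      simp only [LinearMap.mk₂_apply, LinearIsometryEquiv.norm_map]
      refine ((ContinuousLinearMap.mul ℂ ℂ).norm_holder_apply_apply_le _ _).trans ?_
      rw [LinearIsometryEquiv.norm_map]
      gcongr
      · exact ContinuousLinearMap.opNorm_mul_le ℂ ℂ
      · exact norm_toLp_top_le u)

theorem norm_mulOp_le (u : C(Tor n, ℂ)) (a : SqSum n) : ‖mulOp n u a‖ ≤ ‖u‖ * ‖a‖ := by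
  have := (mulOp n).le_opNorm₂ u a
  refine this.trans ?_
  have h1 : ‖mulOp n‖ ≤ 1 := LinearMap.mkContinuous₂_norm_le _ zero_le_one _
  have : 0 ≤ ‖u‖ * ‖a‖ := by positivity
  nlinarith

theorem mulOp_fc (u v : C(Tor n, ℂ)) : mulOp n u (fc n v) = fc n (u * v) := by
  change UnitAddTorus.mFourierBasis.repr
      ((ContinuousLinearMap.mul ℂ ℂ).holder 2 (ContinuousMap.toLp ⊤ volume ℂ u)
        (UnitAddTorus.mFourierBasis.repr.symm
          (UnitAddTorus.mFourierBasis.repr (ContinuousMap.toLp 2 volume ℂ v)))) =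
    UnitAddTorus.mFourierBasis.repr (ContinuousMap.toLp 2 volume ℂ (u * v))
  rw [LinearIsometryEquiv.symm_apply_apply]
  congr 1
  refine Lp.ext ?_
  filter_upwards [(ContinuousLinearMap.mul ℂ ℂ).coeFn_holder (r := 2)
    (ContinuousMap.toLp ⊤ volume ℂ u) (ContinuousMap.toLp 2 volume ℂ v),
    ContinuousMap.coeFn_toLp (p := ⊤) (𝕜 := ℂ) volume u,
    ContinuousMap.coeFn_toLp (p := 2) (𝕜 := ℂ) volume v,
    ContinuousMap.coeFn_toLp (p := 2) (𝕜 := ℂ) volume (u * v)] with t h1 h2 h3 h4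
  rw [h1, h2, h3, h4]
  simp

end fourier

section multipliers

variable {n : ℕ}

theorem exists_diagOp (T : (Fin n → ℤ) → ℂ →ₗ[ℝ] ℂ) (C : ℝ) (hC : 0 ≤ C)
    (hT : ∀ m z, ‖T m z‖ ≤ C * ‖z‖) :
    ∃ D : SqSum n →L[ℝ] SqSum n, (∀ a m, D a m = T m (a m)) ∧ ‖D‖ ≤ C := by
  have hle : ∀ (a : SqSum n) m, ‖T m (a m)‖ ≤ ‖(C • a) m‖ := fun a m => by
    rw [lp.coeFn_smul, Pi.smul_apply, norm_smul, Real.norm_of_nonneg hC]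
    exact hT m (a m)
  have hmem : ∀ a : SqSum n, Memℓp (fun m => T m (a m)) 2 := fun a =>
    (lp.memℓp (C • a)).mono' (hle a)
  have hnorm : ∀ a : SqSum n, ‖(⟨fun m => T m (a m), hmem a⟩ : SqSum n)‖ ≤ C * ‖a‖ := fun a => by
    refine (lp.norm_mono (by simp) (hle a)).trans_eq ?_
    rw [norm_smul, Real.norm_of_nonneg hC]
  let L : SqSum n →ₗ[ℝ] SqSum n :=
    { toFun := fun a => ⟨fun m => T m (a m), hmem a⟩
      map_add' := fun a b => by
        ext m
        change T m (a m + b m) = T m (a m) + T m (b m)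
        rw [map_add]
      map_smul' := fun c a => by
        ext m
        change T m (c • a m) = c • T m (a m)
        rw [map_smul] }
  exact ⟨L.mkContinuous C hnorm, fun a m => rfl, L.mkContinuous_norm_le hC _⟩

/-- The weight `∏ (1 + mᵢ²)`. -/
noncomputable def weight (m : Fin n → ℤ) : ℝ := ∏ i, (1 + (m i : ℝ) ^ 2)

theorem one_le_weight (m : Fin n → ℤ) : 1 ≤ weight m := by
  unfold weight
  exact Finset.one_le_prod fun i _ => by nlinarith [sq_nonneg (m i : ℝ)]

theorem weight_pos (m : Fin n → ℤ) : 0 < weight m := zero_lt_one.trans_le (one_le_weight m)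

theorem abs_le_weight (m : Fin n → ℤ) (i : Fin n) : |(m i : ℝ)| ≤ weight m := by
  have h1 : (1 + (m i : ℝ) ^ 2) ≤ weight m := by
    unfold weight
    rw [← Finset.mul_prod_erase _ _ (Finset.mem_univ i)]
    refine le_mul_of_one_le_right (by positivity) ?_
    exact Finset.one_le_prod fun i _ => by nlinarith [sq_nonneg (m i : ℝ)]
  have h2 : |(m i : ℝ)| ≤ 1 + (m i : ℝ) ^ 2 := by
    rw [← sq_abs]; nlinarith [sq_nonneg (|(m i : ℝ)| - 1), abs_nonneg (m i : ℝ)]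
  exact h2.trans h1

theorem summable_inv_weight : Summable fun m : Fin n → ℤ => (weight m)⁻¹ := by
  have h1 : Summable fun k : ℤ => (1 + (k : ℝ) ^ 2)⁻¹ := by
    have h2 : Summable fun k : ℤ => 1 / (k : ℝ) ^ 2 := Real.summable_one_div_int_pow.2 one_lt_two
    refine Summable.of_norm_bounded_eventually h2 ?_
    refine (Set.finite_singleton (0 : ℤ)).subset fun k hk => ?_
    by_contra h0
    apply hk
    have h0' : (k : ℝ) ≠ 0 := by exact_mod_cast h0
    have : 0 < (k : ℝ) ^ 2 := by positivity
    change ‖(1 + (k : ℝ) ^ 2)⁻¹‖ ≤ 1 / (k : ℝ) ^ 2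
    rw [Real.norm_of_nonneg (by positivity), ← one_div]
    gcongr
    linarith
  refine summable_of_sum_le (c := (∑' k : ℤ, (1 + (k : ℝ) ^ 2)⁻¹) ^ n)
    (fun m => (inv_pos.2 (weight_pos m)).le) fun s => ?_
  calc ∑ m ∈ s, (weight m)⁻¹
      ≤ ∑ m ∈ Fintype.piFinset fun i => s.image fun m => m i, (weight m)⁻¹ := by
        refine Finset.sum_le_sum_of_subset_of_nonneg (fun m hm => ?_)
          fun m _ _ => (inv_pos.2 (weight_pos m)).le
        exact Fintype.mem_piFinset.2 fun i => Finset.mem_image_of_mem (fun m => m i) hm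
    _ = ∏ i, ∑ k ∈ s.image (fun m => m i), (fun k : ℤ => (1 + (k : ℝ) ^ 2)⁻¹) k := by
        rw [Finset.prod_univ_sum]
        simp only [weight, Finset.prod_inv_distrib]
    _ ≤ ∏ i : Fin n, ∑' k : ℤ, (1 + (k : ℝ) ^ 2)⁻¹ := by
        refine Finset.prod_le_prod (fun i _ => Finset.sum_nonneg fun k _ => by positivity)
          fun i _ => h1.sum_le_tsum _ fun k _ => by positivity
    _ = _ := by simp

end multipliers

section regular

variable {n : ℕ} {k : WithTop ℕ∞}

/-- The family `a` has a translation orbit of class `C^k` in `ℓ²`. -/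
def Reg (k : WithTop ℕ∞) (a : (Fin n → ℤ) → ℂ) : Prop :=
  ∃ u : Euc n → SqSum n, ContDiff ℝ k u ∧ ∀ h m, u h m = chr m h * a m

theorem chr_zero_right (m : Fin n → ℤ) : chr m (0 : Euc n) = 1 := by simp [chr]

theorem chr_zero_left (x : Euc n) : chr (0 : Fin n → ℤ) x = 1 := by simp [chr, freq_apply]

theorem hasFDerivAt_chr (m : Fin n → ℤ) (x : Euc n) :
    HasFDerivAt (chr m) ((Complex.I * chr m x) • (Complex.ofRealCLM ∘L freq m)) x := by
  have h1 : HasFDerivAt (fun x : Euc n => Complex.I * (freq m x : ℂ))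
      (Complex.I • (Complex.ofRealCLM ∘L freq m)) x :=
    ((Complex.ofRealCLM ∘L freq m).hasFDerivAt).const_mul Complex.I
  have h2 := h1.cexp
  rw [smul_smul] at h2
  rw [mul_comm]
  exact h2

/-- Evaluation of a family at an index, as a real linear map. -/
noncomputable def evalReal (m : Fin n → ℤ) : SqSum n →L[ℝ] ℂ :=
  lp.evalCLM ℝ (fun _ : Fin n → ℤ => ℂ) 2 m

theorem evalReal_apply (m : Fin n → ℤ) (a : SqSum n) : evalReal m a = a m := rfl

theorem Reg.mul_bounded {a : (Fin n → ℤ) → ℂ} (ha : Reg k a) {κ : (Fin n → ℤ) → ℂ} {C : ℝ}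
    (hκ : ∀ m, ‖κ m‖ ≤ C) : Reg k fun m => κ m * a m := by
  obtain ⟨u, hu, hua⟩ := ha
  obtain ⟨D, hD, -⟩ := exists_diagOp (fun m => LinearMap.mulLeft ℝ (κ m)) C
    ((norm_nonneg _).trans (hκ 0)) (fun m z => by
      simp only [LinearMap.mulLeft_apply, norm_mul]; gcongr; exact hκ m)
  refine ⟨fun h => D (u h), D.contDiff.comp hu, fun h m => ?_⟩
  rw [hD, hua, LinearMap.mulLeft_apply]; ring

theorem Reg.add {a b : (Fin n → ℤ) → ℂ} (ha : Reg k a) (hb : Reg k b) :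
    Reg k fun m => a m + b m := by
  obtain ⟨u, hu, hua⟩ := ha
  obtain ⟨v, hv, hvb⟩ := hb
  refine ⟨fun h => u h + v h, hu.add hv, fun h m => ?_⟩
  rw [lp.coeFn_add, Pi.add_apply, hua, hvb]; ring

theorem fderiv_orbit_apply {u : Euc n → SqSum n} (hu : Differentiable ℝ u)
    {a : (Fin n → ℤ) → ℂ} (hua : ∀ h m, u h m = chr m h * a m) (h e : Euc n) (m : Fin n → ℤ) :
    fderiv ℝ u h e m = chr m h * (Complex.I * freq m e * a m) := by
  have h1 := ((evalReal m).hasFDerivAt (x := u h)).comp h (hu h).hasFDerivAt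
  have h2 : HasFDerivAt (fun h => chr m h * a m) _ h := (hasFDerivAt_chr m h).mul_const (a m)
  have h3 : (evalReal m ∘ u) = fun h => chr m h * a m := by
    funext h; exact hua h m
  rw [h3] at h1
  have h4 := congrArg (fun L => L e) (h1.unique h2)
  simp only [ContinuousLinearMap.comp_apply, smul_apply, smul_eq_mul, evalReal_apply] at h4
  rw [h4]
  simp; ring

theorem Reg.mul_freq {a : (Fin n → ℤ) → ℂ} (hk : k + 1 ≤ k) (ha : Reg k a) (e : Euc n) :
    Reg k fun m => Complex.I * freq m e * a m := by
  obtain ⟨u, hu, hua⟩ := ha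
  have h1 : (1 : WithTop ℕ∞) ≤ k := le_trans le_add_self hk
  refine ⟨fun h => fderiv ℝ u h e, (hu.fderiv_right hk).clm_apply contDiff_const, fun h m => ?_⟩
  exact fderiv_orbit_apply (hu.differentiable (by intro h0; simp [h0] at h1)) hua h e m

theorem Reg.congr {a b : (Fin n → ℤ) → ℂ} (ha : Reg k a) (h : ∀ m, a m = b m) : Reg k b := by
  have : a = b := funext h
  rwa [← this]

theorem Reg.mul_weight {a : (Fin n → ℤ) → ℂ} (hk : k + 1 ≤ k) (ha : Reg k a) :
    Reg k fun m => (weight m : ℂ) * a m := by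
  have key : ∀ s : Finset (Fin n), Reg k fun m => (∏ i ∈ s, (1 + (m i : ℂ) ^ 2)) * a m := by
    intro s
    induction s using Finset.induction_on with
    | empty => simpa using ha
    | insert i s hi ih =>
      have h1 := ((ih.mul_freq hk (EuclideanSpace.single i 1)).mul_freq hk
        (EuclideanSpace.single i 1)).mul_bounded (κ := fun _ => -1) (C := 1) (by simp)
      refine (ih.add h1).congr fun m => ?_
      rw [Finset.prod_insert hi]
      have : freq m (EuclideanSpace.single i (1 : ℝ)) = m i := by
        rw [freq_apply]; simp
      rw [this]
      push_cast
      linear_combination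
        (-(∏ i ∈ s, (1 + (m i : ℂ) ^ 2)) * a m * (m i : ℂ) ^ 2) * Complex.I_sq
  refine (key Finset.univ).congr fun m => ?_
  simp [weight]

/-- Polynomial growth. -/
def PolyBounded (κ : (Fin n → ℤ) → ℂ) : Prop := ∃ (C : ℝ) (N : ℕ), ∀ m, ‖κ m‖ ≤ C * weight m ^ N

theorem Reg.mul_polyBounded {a : (Fin n → ℤ) → ℂ} (hk : k + 1 ≤ k) (ha : Reg k a)
    {κ : (Fin n → ℤ) → ℂ} (hκ : PolyBounded κ) : Reg k fun m => κ m * a m := by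
  obtain ⟨C, N, hC⟩ := hκ
  have key : ∀ N : ℕ, Reg k fun m => (weight m : ℂ) ^ N * a m := by
    intro N
    induction N with
    | zero => simpa using ha
    | succ N ih => exact (ih.mul_weight hk).congr fun m => by rw [pow_succ]; ring
  refine ((key N).mul_bounded (κ := fun m => κ m / (weight m : ℂ) ^ N) (C := C)
    fun m => ?_).congr fun m => ?_
  · have := weight_pos m
    rw [norm_div, norm_pow, Complex.norm_real, Real.norm_of_nonneg this.le, div_le_iff₀ (by positivity)]
    exact hC m
  · have : (weight m : ℂ) ≠ 0 := by exact_mod_cast (weight_pos m).ne'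
    field_simp

theorem norm_le_of_sqSum (a : SqSum n) (m : Fin n → ℤ) : ‖a m‖ ≤ ‖a‖ :=
  lp.norm_apply_le_norm (by simp) a m

theorem Reg.exists_decay {a : (Fin n → ℤ) → ℂ} (hk : k + 1 ≤ k) (ha : Reg k a) :
    ∃ C, ∀ m, ‖a m‖ ≤ C * (weight m)⁻¹ := by
  obtain ⟨u, -, hu⟩ := ha.mul_weight hk
  refine ⟨‖u 0‖, fun m => ?_⟩
  have h1 := norm_le_of_sqSum (u 0) m
  rw [hu, chr_zero_right, one_mul, norm_mul, Complex.norm_real,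
    Real.norm_of_nonneg (weight_pos m).le] at h1
  rw [← div_eq_mul_inv, le_div_iff₀ (weight_pos m)]
  linarith

theorem Reg.summable {a : (Fin n → ℤ) → ℂ} (hk : k + 1 ≤ k) (ha : Reg k a) : Summable a := by
  obtain ⟨C, hC⟩ := ha.exists_decay hk
  exact Summable.of_norm_bounded (summable_inv_weight.mul_left C) hC

/-- The sum of the Fourier series with coefficients `a`. -/
noncomputable def synth (a : (Fin n → ℤ) → ℂ) (x : Euc n) : ℂ := ∑' m, a m * chr m x

theorem hasSum_synth {a : (Fin n → ℤ) → ℂ} (ha : Summable a) (x : Euc n) :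
    HasSum (fun m => a m * chr m x) (synth a x) := by
  refine (Summable.of_norm ?_).hasSum
  simpa [norm_chr] using ha.norm

/-- Summation against the inverse of the weight. -/
noncomputable def weightedSum (n : ℕ) : SqSum n →L[ℝ] ℂ :=
  have hs : ∀ a : SqSum n, Summable fun m => ((weight m)⁻¹ : ℂ) * a m := fun a => by
    refine Summable.of_norm_bounded (summable_inv_weight.mul_right ‖a‖) fun m => ?_
    rw [norm_mul, norm_inv, Complex.norm_real, Real.norm_of_nonneg (weight_pos m).le]
    have := weight_pos m
    gcongr
    exact norm_le_of_sqSum a m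
  LinearMap.mkContinuous
    { toFun := fun a => ∑' m, ((weight m)⁻¹ : ℂ) * a m
      map_add' := fun a b => by
        rw [← (hs a).tsum_add (hs b)]
        refine tsum_congr fun m => ?_
        rw [lp.coeFn_add, Pi.add_apply]; ring
      map_smul' := fun c a => by
        rw [RingHom.id_apply, ← (hs a).tsum_const_smul]
        refine tsum_congr fun m => ?_
        change _ * (c • a m) = _
        rw [mul_smul_comm] }
    (∑' m : Fin n → ℤ, (weight m)⁻¹) (fun a => by
      rw [← summable_inv_weight.tsum_mul_right]
      refine tsum_of_norm_bounded (summable_inv_weight.mul_right ‖a‖).hasSum fun m => ?_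
      rw [norm_mul, norm_inv, Complex.norm_real, Real.norm_of_nonneg (weight_pos m).le]
      have := weight_pos m
      gcongr
      exact norm_le_of_sqSum a m)

theorem weightedSum_apply (a : SqSum n) :
    weightedSum n a = ∑' m, ((weight m)⁻¹ : ℂ) * a m := rfl

theorem Reg.exists_weightedSum {a : (Fin n → ℤ) → ℂ} (hk : k + 1 ≤ k) (ha : Reg k a) :
    ∃ u : Euc n → SqSum n, ContDiff ℝ k u ∧ (∀ h m, u h m = chr m h * (weight m * a m)) ∧
      synth a = fun h => weightedSum n (u h) := by
  obtain ⟨u, hu, hua⟩ := ha.mul_weight hk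
  refine ⟨u, hu, hua, ?_⟩
  funext h
  rw [weightedSum_apply, synth]
  refine tsum_congr fun m => ?_
  have : (weight m : ℂ) ≠ 0 := by exact_mod_cast (weight_pos m).ne'
  rw [hua]
  field_simp

theorem Reg.contDiff_synth {a : (Fin n → ℤ) → ℂ} (hk : k + 1 ≤ k) (ha : Reg k a) :
    ContDiff ℝ k (synth a) := by
  obtain ⟨u, hu, -, h⟩ := ha.exists_weightedSum hk
  rw [h]
  exact (weightedSum n).contDiff.comp hu

theorem Reg.fderiv_synth {a : (Fin n → ℤ) → ℂ} (hk : k + 1 ≤ k) (ha : Reg k a) (x e : Euc n) :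
    fderiv ℝ (synth a) x e = synth (fun m => Complex.I * freq m e * a m) x := by
  obtain ⟨u, hu, hua, h⟩ := ha.exists_weightedSum hk
  have h1 : (1 : WithTop ℕ∞) ≤ k := le_trans le_add_self hk
  have hd : Differentiable ℝ u := hu.differentiable (by intro h0; simp [h0] at h1)
  have h2 := ((weightedSum n).hasFDerivAt (x := u x)).comp x (hd x).hasFDerivAt
  rw [h]
  have h3 : fderiv ℝ (fun h => weightedSum n (u h)) x = _ := h2.fderiv
  rw [h3, ContinuousLinearMap.comp_apply, weightedSum_apply, synth]
  refine tsum_congr fun m => ?_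
  rw [fderiv_orbit_apply hd hua]
  have : (weight m : ℂ) ≠ 0 := by exact_mod_cast (weight_pos m).ne'
  field_simp

theorem exists_torus_synth {a : (Fin n → ℤ) → ℂ} (ha : Summable a) :
    ∃ u : C(Tor n, ℂ), (∀ m, fc n u m = a m) ∧ ∀ x, u (toTorus n x) = synth a x := by
  obtain ⟨u, hu, -⟩ := hasSum_of_summable a ha
  have hu' : (fun m => fc n u m) = a := funext hu
  refine ⟨u, hu, fun x => ?_⟩
  have h1 := hasSum_fc u (by rw [hu']; exact ha) x
  simp only [hu] at h1
  exact h1.unique (hasSum_synth ha x)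

theorem eq_synth_fc (u : C(Tor n, ℂ)) (hu : Summable fun m => fc n u m) (x : Euc n) :
    u (toTorus n x) = synth (fun m => fc n u m) x :=
  (hasSum_fc u hu x).unique (hasSum_synth hu x)

theorem latticePeriodic_synth {a : (Fin n → ℤ) → ℂ} (ha : Summable a) :
    LatticePeriodic (synth a) := by
  obtain ⟨u, -, hu⟩ := exists_torus_synth ha
  have : synth a = fun x => u (toTorus n x) := funext fun x => (hu x).symm
  rw [this]
  exact latticePeriodic_comp_toTorus u

end regular

section orbit

variable {n : ℕ} {F : Type} [NormedAddCommGroup F]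

/-- The translations of a continuous function on the torus. -/
noncomputable def orbit (u : C(Tor n, F)) (h : Euc n) : C(Tor n, F) :=
  u.comp (ContinuousMap.addRight (toTorus n h))

theorem orbit_apply (u : C(Tor n, F)) (h x : Euc n) :
    orbit u h (toTorus n x) = u (toTorus n (x + h)) := by
  simp [orbit]

theorem continuous_orbit (u : C(Tor n, F)) : Continuous (orbit u) := by
  have h1 : Continuous fun p : Euc n × Tor n => u (p.2 + toTorus n p.1) :=
    u.continuous.comp (continuous_snd.add (continuous_toTorus.comp continuous_fst))
  exact (ContinuousMap.curry ⟨_, h1⟩).continuous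

theorem orbit_add (u : C(Tor n, F)) (h k : Euc n) : orbit u (h + k) = orbit (orbit u h) k := by
  ext t
  simp only [orbit, map_add, ContinuousMap.comp_apply, ContinuousMap.coe_addRight]
  congr 1; abel

variable [NormedSpace ℝ F]

/-- A function with values in linear maps as a linear map with values in functions. -/
noncomputable def flipCLM (n : ℕ) (F : Type) [NormedAddCommGroup F] [NormedSpace ℝ F] :
    C(Tor n, Euc n →L[ℝ] F) →L[ℝ] Euc n →L[ℝ] C(Tor n, F) :=
  LinearMap.mkContinuous₂ (LinearMap.mk₂ ℝ
    (fun (G : C(Tor n, Euc n →L[ℝ] F)) (e : Euc n) => (⟨fun t => G t e, by fun_prop⟩ : C(Tor n, F)))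
    (fun _ _ _ => rfl) (fun _ _ _ => rfl)
    (fun G e e' => by ext t; simp) (fun c G e => by ext t; simp)) 1
    (fun G e => by
      rw [ContinuousMap.norm_le _ (by positivity)]
      intro t
      refine ((G t).le_opNorm e).trans ?_
      rw [one_mul]
      gcongr
      exact G.norm_coe_le_norm t)

theorem flipCLM_apply (G : C(Tor n, Euc n →L[ℝ] F)) (e : Euc n) (t : Tor n) :
    flipCLM n F G e t = G t e := rfl

theorem LatticePeriodic.fderiv {f : Euc n → F} (hf : LatticePeriodic f) :
    LatticePeriodic (fderiv ℝ f) := by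
  intro x γ hγ
  rw [← fderiv_comp_add_right]
  congr 1
  funext y
  exact hf y γ hγ

theorem hasFDerivAt_orbit (u : C(Tor n, F)) (hu : Differentiable ℝ fun x => u (toTorus n x))
    (v : C(Tor n, Euc n →L[ℝ] F))
    (hv : ∀ x, v (toTorus n x) = fderiv ℝ (fun x => u (toTorus n x)) x) (h : Euc n) :
    HasFDerivAt (orbit u) (flipCLM n F (orbit v h)) h := by
  rw [hasFDerivAt_iff_isLittleO_nhds_zero, Asymptotics.isLittleO_iff]
  intro ε hε
  have h1 : Filter.Tendsto (orbit v) (𝓝 0) (𝓝 (orbit v 0)) := (continuous_orbit v).tendsto 0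
  obtain ⟨δ, hδ, hball⟩ := Metric.eventually_nhds_iff.1 (Metric.tendsto_nhds.1 h1 ε hε)
  have h0 : orbit v 0 = v := by ext t; simp [orbit]
  filter_upwards [Metric.ball_mem_nhds (0 : Euc n) hδ] with k hk
  rw [ContinuousMap.norm_le _ (by positivity)]
  intro t
  obtain ⟨x, rfl⟩ := toTorus_surjective t
  simp only [ContinuousMap.sub_apply, orbit_apply, flipCLM_apply, hv]
  have h2 := (convex_ball (x + h) δ).norm_image_sub_le_of_norm_hasFDerivWithin_le'
    (f := fun x => u (toTorus n x)) (φ := fderiv ℝ (fun x => u (toTorus n x)) (x + h))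
    (C := ε) (x := x + h) (y := x + (h + k))
    (fun y hy => (hu y).hasFDerivAt.hasFDerivWithinAt) (fun y hy => ?_)
    (Metric.mem_ball_self hδ) (by simpa [← add_assoc] using hk)
  · simpa [← add_assoc] using h2
  · have h3 := hball (y := y - (x + h)) (by simpa [dist_eq_norm] using hy)
    rw [h0, dist_eq_norm] at h3
    have h4 := (ContinuousMap.norm_coe_le_norm _ (toTorus n (x + h))).trans h3.le
    rw [ContinuousMap.sub_apply, orbit_apply, hv, hv] at h4
    simpa using h4

theorem contDiff_orbit_nat (m : ℕ) : ∀ {F : Type} [NormedAddCommGroup F] [NormedSpace ℝ F]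
    (u : C(Tor n, F)), ContDiff ℝ m (fun x => u (toTorus n x)) → ContDiff ℝ m (orbit u) := by
  induction m with
  | zero => intro F _ _ u _; exact contDiff_zero.2 (continuous_orbit u)
  | succ m ih =>
    intro F _ _ u hu
    have hd : Differentiable ℝ fun x => u (toTorus n x) := hu.differentiable (by simp)
    have hc : ContDiff ℝ m (fderiv ℝ fun x => u (toTorus n x)) := hu.fderiv_right (by simp)
    have hper : LatticePeriodic (fderiv ℝ fun x => u (toTorus n x)) :=
      (latticePeriodic_comp_toTorus u).fderiv
    have hv := descend_apply _ hc.continuous hper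
    have key := hasFDerivAt_orbit u hd _ hv
    have hf : fderiv ℝ (orbit u) = fun h => flipCLM n F (orbit (descend _ hc.continuous hper) h) :=
      funext fun h => (key h).fderiv
    have hm : ((m + 1 : ℕ) : WithTop ℕ∞) = (m : WithTop ℕ∞) + 1 := by push_cast; rfl
    rw [hm, contDiff_succ_iff_fderiv]
    refine ⟨fun h => (key h).differentiableAt, by simp, ?_⟩
    rw [hf]
    have hL := ContinuousLinearMap.contDiff (𝕜 := ℝ) (n := m) (E := C(Tor n, Euc n →L[ℝ] F))
      (F := Euc n →L[ℝ] C(Tor n, F)) (flipCLM n F)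
    refine hL.comp (ih _ ?_)
    simpa only [hv] using hc

theorem exists_local_analytic_bound [CompleteSpace F] {f : Euc n → F} {x₀ : Euc n}
    (hf : AnalyticAt ℝ f x₀) :
    ∃ r S : ℝ, 0 < r ∧ 0 ≤ S ∧ ∀ x ∈ Metric.ball x₀ r,
      (∀ k, ‖iteratedFDeriv ℝ k f x‖ ≤ k.factorial * (S / r ^ k)) ∧
      ∀ y, ‖y‖ < r → HasSum (fun k : ℕ => (k.factorial : ℝ)⁻¹ •
        iteratedFDeriv ℝ k f x fun _ => y) (f (x + y)) := by
  obtain ⟨p, R, hp⟩ := hf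
  obtain ⟨r, hr0, hr⟩ : ∃ r : NNReal, 0 < r ∧ (r + r : ENNReal) < R := by
    obtain ⟨q, hq0, hq⟩ := ENNReal.lt_iff_exists_nnreal_btwn.1 hp.r_pos
    refine ⟨q / 2, by simpa using hq0, ?_⟩
    rw [← ENNReal.coe_add, add_halves]
    exact hq
  have hrad : (r + r : ENNReal) < p.radius := hr.trans_le hp.r_le
  have hrad1 : (r : ENNReal) < p.radius := (le_add_right le_rfl).trans_lt hrad
  have hs := p.changeOriginSeries_summable_aux₁ hrad
  set S := ∑' s : Σ k l : ℕ, { s : Finset (Fin (k + l)) // s.card = l },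
      ‖p (s.1 + s.2.1)‖₊ * r ^ s.2.1 * r ^ s.1 with hS
  have hbound : ∀ y : Euc n, ‖y‖₊ ≤ r → ∀ k, ‖p.changeOrigin y k‖₊ * r ^ k ≤ S := by
    intro y hy k
    have hyr : (‖y‖₊ : ENNReal) < p.radius := (ENNReal.coe_le_coe.2 hy).trans_lt hrad1
    have h1 := p.nnnorm_changeOrigin_le k hyr
    have h2 := p.changeOriginSeries_summable_aux₂ hyr k
    have h3 := (NNReal.summable_sigma.1 hs).1 k
    have h4 : (∑' s : Σ l : ℕ, { s : Finset (Fin (k + l)) // s.card = l },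
        ‖p (k + s.1)‖₊ * ‖y‖₊ ^ s.1) * r ^ k ≤
        ∑' s : Σ l : ℕ, { s : Finset (Fin (k + l)) // s.card = l },
          ‖p (k + s.1)‖₊ * r ^ s.1 * r ^ k := by
      rw [← NNReal.tsum_mul_right]
      refine Summable.tsum_le_tsum (fun s => by gcongr) (h2.mul_right _) h3
    have h5 : ∑' s : Σ l : ℕ, { s : Finset (Fin (k + l)) // s.card = l },
          ‖p (k + s.1)‖₊ * r ^ s.1 * r ^ k ≤ S := by
      rw [hS, hs.tsum_sigma' fun k => (NNReal.summable_sigma.1 hs).1 k]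
      exact (NNReal.summable_sigma.1 hs).2.le_tsum k fun _ _ => zero_le
    calc _ ≤ _ := mul_le_mul_left h1 (r ^ k)
      _ ≤ _ := h4.trans h5
  refine ⟨r, S, hr0, S.2, fun x hx => ?_⟩
  have hy : ‖x - x₀‖₊ < r := by
    rw [Metric.mem_ball, dist_eq_norm] at hx; exact_mod_cast hx
  have hyR : (‖x - x₀‖₊ : ENNReal) + r < R :=
    (add_le_add_left (ENNReal.coe_le_coe.2 hy.le) _).trans_lt hr
  have hps := hp.changeOrigin ((le_add_right le_rfl).trans_lt hyR)
  rw [add_sub_cancel] at hps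
  constructor
  · intro k
    refine ContinuousMultilinearMap.opNorm_le_bound (by positivity) fun v => ?_
    rw [hps.iteratedFDeriv_eq_sum_of_completeSpace]
    refine (norm_sum_le _ _).trans ?_
    have h1 : ∀ σ : Equiv.Perm (Fin k), ‖p.changeOrigin (x - x₀) k fun i => v (σ i)‖ ≤
        (S / r ^ k) * ∏ i, ‖v i‖ := fun σ => by
      refine (ContinuousMultilinearMap.le_opNorm _ _).trans ?_
      rw [Equiv.prod_comp σ fun i => ‖v i‖]
      gcongr
      have := hbound _ hy.le k
      have h3 : (0 : ℝ) < r := hr0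
      rw [le_div_iff₀ (by positivity)]
      exact_mod_cast this
    refine (Finset.sum_le_sum fun σ _ => h1 σ).trans_eq ?_
    rw [Finset.sum_const, Finset.card_univ, Fintype.card_perm, Fintype.card_fin, nsmul_eq_mul]
    ring
  · intro y hyr
    refine hps.hasSum_iteratedFDeriv (y := y) ?_
    rw [mem_eball_zero_iff, lt_tsub_iff_left]
    refine lt_of_le_of_lt ?_ hyR
    gcongr
    have : ‖y‖₊ ≤ r := by exact_mod_cast hyr.le
    exact_mod_cast this

theorem LatticePeriodic.iteratedFDeriv {f : Euc n → F} (hf : LatticePeriodic f) (k : ℕ) :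
    LatticePeriodic (iteratedFDeriv ℝ k f) := by
  intro x γ hγ
  have h : (fun y => f (y + γ)) = f := funext fun y => hf y γ hγ
  have := iteratedFDeriv_comp_add_right (𝕜 := ℝ) (f := f) k γ x
  rw [h] at this
  exact this.symm

theorem exists_uniform_analytic_bound [CompleteSpace F] {f : Euc n → F}
    (hf : AnalyticOnNhd ℝ f Set.univ) (hper : LatticePeriodic f) :
    ∃ r S : ℝ, 0 < r ∧ 0 ≤ S ∧ ∀ x,
      (∀ k, ‖iteratedFDeriv ℝ k f x‖ ≤ k.factorial * (S / r ^ k)) ∧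
      ∀ y, ‖y‖ < r → HasSum (fun k : ℕ => (k.factorial : ℝ)⁻¹ •
        iteratedFDeriv ℝ k f x fun _ => y) (f (x + y)) := by
  have key : ∃ r S : ℝ, 0 < r ∧ 0 ≤ S ∧ ∀ x, toTorus n x ∈ Set.univ →
      (∀ k, ‖iteratedFDeriv ℝ k f x‖ ≤ k.factorial * (S / r ^ k)) ∧
      ∀ y, ‖y‖ < r → HasSum (fun k : ℕ => (k.factorial : ℝ)⁻¹ •
        iteratedFDeriv ℝ k f x fun _ => y) (f (x + y)) := by
    refine IsCompact.induction_on (isCompact_univ (X := Tor n))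
      (p := fun s => ∃ r S : ℝ, 0 < r ∧ 0 ≤ S ∧ ∀ x, toTorus n x ∈ s →
        (∀ k, ‖iteratedFDeriv ℝ k f x‖ ≤ k.factorial * (S / r ^ k)) ∧
        ∀ y, ‖y‖ < r → HasSum (fun k : ℕ => (k.factorial : ℝ)⁻¹ •
          iteratedFDeriv ℝ k f x fun _ => y) (f (x + y))) ?_ ?_ ?_ ?_
    · exact ⟨1, 0, one_pos, le_rfl, fun x hx => absurd hx (Set.notMem_empty _)⟩
    · rintro s t hst ⟨r, S, hr, hS, h⟩
      exact ⟨r, S, hr, hS, fun x hx => h x (hst hx)⟩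
    · rintro s t ⟨r, S, hr, hS, h⟩ ⟨r', S', hr', hS', h'⟩
      have hmin : 0 < min r r' := lt_min hr hr'
      refine ⟨min r r', max S S', hmin, le_max_of_le_left hS, fun x hx => ?_⟩
      rcases hx with hx | hx
      · refine ⟨fun k => ((h x hx).1 k).trans ?_, fun y hy => (h x hx).2 y
          (hy.trans_le (min_le_left _ _))⟩
        gcongr
        · exact le_max_left _ _
        · exact min_le_left _ _
      · refine ⟨fun k => ((h' x hx).1 k).trans ?_, fun y hy => (h' x hx).2 y
          (hy.trans_le (min_le_right _ _))⟩
        gcongr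
        · exact le_max_right _ _
        · exact min_le_right _ _
    · intro t _
      obtain ⟨x₀, rfl⟩ := toTorus_surjective t
      obtain ⟨r, S, hr, hS, h⟩ := exists_local_analytic_bound (hf x₀ (Set.mem_univ _))
      refine ⟨toTorus n '' Metric.ball x₀ r, mem_nhdsWithin_of_mem_nhds
        (isOpenQuotientMap_toTorus.isOpenMap.image_mem_nhds (Metric.ball_mem_nhds x₀ hr)),
        r, S, hr, hS, ?_⟩
      rintro x ⟨x', hx', hxx⟩
      rw [eq_comm, toTorus_eq_iff] at hxx
      have e1 : ∀ k, iteratedFDeriv ℝ k f x = iteratedFDeriv ℝ k f x' := fun k => by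
        simpa using hper.iteratedFDeriv k x' _ hxx
      have e2 : ∀ y, f (x + y) = f (x' + y) := fun y => by
        rw [← hper (x' + y) _ hxx]; congr 1; abel
      simp only [e1, e2]
      exact h x' hx'
  obtain ⟨r, S, hr, hS, h⟩ := key
  exact ⟨r, S, hr, hS, fun x => h x (Set.mem_univ _)⟩

theorem analyticAt_orbit_zero [CompleteSpace F] (u : C(Tor n, F))
    (hu : AnalyticOnNhd ℝ (fun x => u (toTorus n x)) Set.univ) : AnalyticAt ℝ (orbit u) 0 := by
  obtain ⟨r, S, hr, hS, h⟩ := exists_uniform_analytic_bound hu (latticePeriodic_comp_toTorus u)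
  set f : Euc n → F := fun x => u (toTorus n x) with hf
  have hcont : ∀ k, Continuous (iteratedFDeriv ℝ k f) := fun k =>
    (hu.contDiff (n := ω)).continuous_iteratedFDeriv (by simp)
  let c : ∀ k, C(Tor n, Euc n [×k]→L[ℝ] F) := fun k =>
    descend _ (hcont k) ((latticePeriodic_comp_toTorus u).iteratedFDeriv k)
  have hc : ∀ k x, c k (toTorus n x) = iteratedFDeriv ℝ k f x := fun k x => descend_apply _ _ _ x
  have hcb : ∀ k t, (k.factorial : ℝ)⁻¹ * ‖c k t‖ ≤ S / r ^ k := fun k t => by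
    obtain ⟨x, rfl⟩ := toTorus_surjective t
    rw [hc, inv_mul_le_iff₀ (by positivity)]
    exact (h x).1 k
  let Q : FormalMultilinearSeries ℝ (Euc n) C(Tor n, F) := fun k =>
    MultilinearMap.mkContinuous
      { toFun := fun v => ⟨fun t => (k.factorial : ℝ)⁻¹ • c k t v, by fun_prop⟩
        map_update_add' := fun v i x y => by ext t; simp
        map_update_smul' := fun v i a x => by
          ext t
          simp only [ContinuousMap.coe_mk, ContinuousMultilinearMap.map_update_smul,
            ContinuousMap.coe_smul, Pi.smul_apply]
          rw [smul_comm] } (S / r ^ k)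
      (fun v => by
        rw [ContinuousMap.norm_le _ (by positivity)]
        intro t
        simp only [MultilinearMap.coe_mk, ContinuousMap.coe_mk, norm_smul, norm_inv,
          RCLike.norm_natCast]
        calc (k.factorial : ℝ)⁻¹ * ‖c k t v‖ ≤ (k.factorial : ℝ)⁻¹ * (‖c k t‖ * ∏ i, ‖v i‖) := by
              gcongr; exact (c k t).le_opNorm v
          _ = ((k.factorial : ℝ)⁻¹ * ‖c k t‖) * ∏ i, ‖v i‖ := by ring
          _ ≤ _ := by gcongr; exact hcb k t)
  have hQ : ∀ k, ‖Q k‖ ≤ S / r ^ k := fun k => MultilinearMap.mkContinuous_norm_le _ (by positivity) _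
  have hQa : ∀ k v x, Q k v (toTorus n x) = (k.factorial : ℝ)⁻¹ • iteratedFDeriv ℝ k f x v :=
    fun k v x => by rw [← hc]; rfl
  refine ⟨Q, ENNReal.ofReal r, ?_, by simpa using hr, ?_⟩
  · refine Q.le_radius_of_bound S (r := r.toNNReal) fun k => ?_
    rw [Real.coe_toNNReal _ hr.le, ← le_div_iff₀ (by positivity)]
    exact hQ k
  · intro y hy
    rw [mem_eball_zero_iff, ← ofReal_norm, ENNReal.ofReal_lt_ofReal_iff hr] at hy
    rw [zero_add]
    have hs : Summable fun k => Q k fun _ => y := by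
      have hg : Summable fun k : ℕ => S * (‖y‖ / r) ^ k :=
        (summable_geometric_of_lt_one (by positivity) ((div_lt_one hr).2 hy)).mul_left S
      refine Summable.of_norm_bounded hg fun k => ?_
      refine ((Q k).le_of_opNorm_le (hQ k) _).trans_eq ?_
      rw [Fin.prod_const, div_pow]; ring
    suffices heq : orbit u y = ∑' k, Q k fun _ => y by rw [heq]; exact hs.hasSum
    ext t
    obtain ⟨x, rfl⟩ := toTorus_surjective t
    have h1 := (hs.hasSum.mapL (ContinuousMap.evalCLM ℝ (toTorus n x)))
    have h2 := (h x).2 y hy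
    rw [orbit_apply]
    refine h2.unique ?_
    simpa [Function.comp_def, hQa] using h1

theorem contDiff_orbit [CompleteSpace F] {k : WithTop ℕ∞} (hk : k = ∞ ∨ k = ω) (u : C(Tor n, F))
    (hu : ContDiff ℝ k fun x => u (toTorus n x)) : ContDiff ℝ k (orbit u) := by
  rcases hk with rfl | rfl
  · rw [contDiff_infty] at hu ⊢
    exact fun m => contDiff_orbit_nat m u (hu m)
  · refine AnalyticOnNhd.contDiff fun h _ => ?_
    have h1 : AnalyticAt ℝ (orbit (orbit u h)) 0 := by
      refine analyticAt_orbit_zero _ ?_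
      simp only [orbit_apply]
      have h2 : ContDiff ℝ ω fun x : Euc n => u (toTorus n (x + h)) :=
        hu.comp (contDiff_id.add contDiff_const)
      exact contDiff_omega_iff_analyticOnNhd.1 h2
    have h3 : orbit u = fun y => orbit (orbit u h) (y - h) := by
      funext y; rw [← orbit_add]; congr 1; abel
    rw [h3]
    refine AnalyticAt.fun_comp (g := orbit (orbit u h)) (f := fun y => y - h) (by simpa using h1) ?_
    exact analyticAt_id.sub analyticAt_const

end orbit

theorem exists_contDiff_fixedPoint {E H : Type*} [NormedAddCommGroup E] [NormedSpace ℝ E]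
    [NormedAddCommGroup H] [NormedSpace ℝ H] [CompleteSpace H] {k : WithTop ℕ∞}
    {A : E → H →L[ℝ] H} (hA : ContDiff ℝ k A) (hA1 : ∀ h, ‖A h‖ < 1) {b : E → H}
    (hb : ContDiff ℝ k b) :
    ∃ w : E → H, ContDiff ℝ k w ∧ (∀ h, w h = A h (w h) + b h) ∧
      ∀ h x, x = A h x + b h → x = w h := by
  have hunit : ∀ h, IsUnit (1 - A h) := fun h => isUnit_one_sub_of_norm_lt_one (hA1 h)
  have hinv : ContDiff ℝ k fun h => Ring.inverse (1 - A h) := by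
    rw [contDiff_iff_contDiffAt]
    intro h
    obtain ⟨U, hU⟩ := hunit h
    have h1 := contDiffAt_ringInverse ℝ (n := k) U
    rw [hU] at h1
    exact h1.comp h (contDiff_const.sub hA).contDiffAt
  refine ⟨fun h => Ring.inverse (1 - A h) (b h), hinv.clm_apply hb, fun h => ?_, fun h x hx => ?_⟩
  · have h1 : (1 - A h) (Ring.inverse (1 - A h) (b h)) = b h := by
      change ((1 - A h) * Ring.inverse (1 - A h)) (b h) = b h
      rw [Ring.mul_inverse_cancel _ (hunit h)]; rfl
    exact sub_eq_iff_eq_add'.1 h1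
  · have h1 : Ring.inverse (1 - A h) ((1 - A h) x) = x := by
      change (Ring.inverse (1 - A h) * (1 - A h)) x = x
      rw [Ring.inverse_mul_cancel _ (hunit h)]; rfl
    have h2 : (1 - A h) x = b h := sub_eq_iff_eq_add'.2 hx
    change x = Ring.inverse (1 - A h) (b h)
    rw [← h2, h1]

section coefficients

variable {n : ℕ} {k : WithTop ℕ∞}

theorem fc_orbit (u : C(Tor n, ℂ)) (h : Euc n) (m : Fin n → ℤ) :
    fc n (orbit u h) m = chr m h * fc n u m := fc_translate u h m

theorem reg_fc (hk : k = ∞ ∨ k = ω) (u : C(Tor n, ℂ))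
    (hu : ContDiff ℝ k fun x => u (toTorus n x)) : Reg k fun m => fc n u m :=
  ⟨fun h => fc n (orbit u h), ((fc n).restrictScalars ℝ).contDiff.comp (contDiff_orbit hk u hu),
    fun h m => fc_orbit u h m⟩

theorem fc_of_eq_fderiv (u v : C(Tor n, ℂ)) (hu : ContDiff ℝ 1 fun x => u (toTorus n x))
    (e : Euc n) (hv : ∀ x, v (toTorus n x) = fderiv ℝ (fun x => u (toTorus n x)) x e)
    (m : Fin n → ℤ) : fc n v m = Complex.I * freq m e * fc n u m := by
  have hc := hu.continuous_fderiv (by simp)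
  have hper : LatticePeriodic (fderiv ℝ fun x => u (toTorus n x)) :=
    (latticePeriodic_comp_toTorus u).fderiv
  have hV := descend_apply _ hc hper
  set V := descend _ hc hper
  have key := hasFDerivAt_orbit u (hu.differentiable (by simp)) V hV
  have hd : ∀ h, HasFDerivAt (fun h => fc n (orbit u h))
      (((fc n).restrictScalars ℝ) ∘L (flipCLM n ℂ (orbit V h))) h := fun h =>
    (((fc n).restrictScalars ℝ).hasFDerivAt).comp h (key h)
  have h1 := fderiv_orbit_apply (fun h => (hd h).differentiableAt) (fc_orbit u) 0 e m
  rw [(hd 0).fderiv, chr_zero_right, one_mul] at h1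
  rw [← h1]
  refine congrArg (fun u => fc n u m) (?_ : v = flipCLM n ℂ (orbit V 0) e)
  ext t
  obtain ⟨x, rfl⟩ := toTorus_surjective t
  rw [hv, flipCLM_apply, orbit_apply, add_zero, hV]

theorem exists_shiftOp (h : Euc n) :
    ∃ D : SqSum n →L[ℝ] SqSum n, ∀ a m, D a m = chr m h * a m := by
  obtain ⟨D, hD, -⟩ := exists_diagOp (n := n) (fun m => LinearMap.mulLeft ℝ (chr m h)) 1 zero_le_one
    (fun m z => by simp [norm_chr])
  exact ⟨D, fun a m => hD a m⟩

theorem opNorm_mulOp_le (u : C(Tor n, ℂ)) : ‖mulOp n u‖ ≤ ‖u‖ :=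
  ContinuousLinearMap.opNorm_le_bound _ (norm_nonneg u) (norm_mulOp_le u)

theorem mulOp_shift (μ : C(Tor n, ℂ)) (h : Euc n) (D : SqSum n →L[ℝ] SqSum n)
    (hD : ∀ a m, D a m = chr m h * a m) (a : SqSum n) :
    mulOp n (orbit μ h) (D a) = D (mulOp n μ a) := by
  have hDfc : ∀ v : C(Tor n, ℂ), D (fc n v) = fc n (orbit v h) := fun v => by
    ext m; rw [hD, fc_orbit]
  have h1 : (fun a => mulOp n (orbit μ h) (D a)) = fun a => D (mulOp n μ a) := by
    refine fc_denseRange.equalizer (by fun_prop) (by fun_prop) ?_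
    funext v
    simp only [Function.comp_apply, hDfc, mulOp_fc]
    rfl
  exact congrFun h1 a

/-- A Beltrami type equation in `ℓ²`: the solution is as regular as the coefficients. -/
theorem exists_reg_solution (hk : k = ∞ ∨ k = ω) (μ ν : C(Tor n, ℂ))
    (hμ : ContDiff ℝ k fun x => μ (toTorus n x)) (hν : ContDiff ℝ k fun x => ν (toTorus n x))
    (hμ1 : ‖μ‖ < 1) (S : SqSum n →L[ℝ] SqSum n) (hS : ‖S‖ ≤ 1)
    (hSh : ∀ (h : Euc n) (a b : SqSum n), (∀ m, b m = chr m h * a m) →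
      ∀ m, S b m = chr m h * S a m) :
    ∃ w : SqSum n, (Reg k fun m => w m) ∧ w = mulOp n μ (S w) + fc n ν := by
  let A : Euc n → SqSum n →L[ℝ] SqSum n := fun h => (mulOp n (orbit μ h)).comp S
  have hA : ∀ h, ‖A h‖ < 1 := fun h => by
    have h1 : ‖orbit μ h‖ ≤ ‖μ‖ := by
      rw [ContinuousMap.norm_le _ (norm_nonneg _)]
      intro t
      exact μ.norm_coe_le_norm _
    have h2 : ‖mulOp n (orbit μ h)‖ ≤ ‖μ‖ := (opNorm_mulOp_le _).trans h1
    calc ‖A h‖ ≤ ‖mulOp n (orbit μ h)‖ * ‖S‖ := ContinuousLinearMap.opNorm_comp_le _ _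
      _ ≤ ‖μ‖ * 1 := by gcongr
      _ < 1 := by rwa [mul_one]
  have hAc : ContDiff ℝ k A := by
    have h1 : ContDiff ℝ k fun h => mulOp n (orbit μ h) :=
      (mulOp n).contDiff.comp (contDiff_orbit hk μ hμ)
    exact h1.clm_comp contDiff_const
  obtain ⟨w, hw, hsolve, huniq⟩ := exists_contDiff_fixedPoint hAc hA
    (((fc n).restrictScalars ℝ).contDiff.comp (contDiff_orbit hk ν hν))
  have h0 : orbit ν 0 = ν := by ext t; simp [orbit]
  have h0' : orbit μ 0 = μ := by ext t; simp [orbit]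
  have hw0 : w 0 = mulOp n μ (S (w 0)) + fc n ν := by
    have h1 : w 0 = mulOp n (orbit μ 0) (S (w 0)) + fc n (orbit ν 0) := hsolve 0
    rwa [h0, h0'] at h1
  refine ⟨w 0, ⟨w, hw, fun h m => ?_⟩, hw0⟩
  obtain ⟨D, hD⟩ := exists_shiftOp h
  have hSD : S (D (w 0)) = D (S (w 0)) := by
    ext m; rw [hSh h (w 0) (D (w 0)) (hD (w 0)), hD]
  have hDν : D (fc n ν) = fc n (orbit ν h) := by ext m; rw [hD, fc_orbit]
  have h2 : D (w 0) = w h := by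
    refine huniq h _ ?_
    change D (w 0) = mulOp n (orbit μ h) (S (D (w 0))) + fc n (orbit ν h)
    rw [hSD, mulOp_shift μ h D hD, ← hDν, ← map_add, ← hw0]
  rw [← h2, hD]

end coefficients

section wirtinger

variable {n : ℕ} {k : WithTop ℕ∞}

/-- The derivative `∂/∂z` in the directions `e₁`, `e₂`. -/
noncomputable def dz (e₁ e₂ : Euc n) (f : Euc n → ℂ) (x : Euc n) : ℂ :=
  (fderiv ℝ f x e₁ - Complex.I * fderiv ℝ f x e₂) / 2

/-- The derivative `∂/∂z̄` in the directions `e₁`, `e₂`. -/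
noncomputable def dzbar (e₁ e₂ : Euc n) (f : Euc n → ℂ) (x : Euc n) : ℂ :=
  (fderiv ℝ f x e₁ + Complex.I * fderiv ℝ f x e₂) / 2

/-- The symbol of `∂/∂z`. -/
noncomputable def sym (e₁ e₂ : Euc n) (m : Fin n → ℤ) : ℂ :=
  Complex.I * (freq m e₁ - Complex.I * freq m e₂) / 2

/-- The symbol of `∂/∂z̄`. -/
noncomputable def symbar (e₁ e₂ : Euc n) (m : Fin n → ℤ) : ℂ :=
  Complex.I * (freq m e₁ + Complex.I * freq m e₂) / 2

theorem conj_symbar (e₁ e₂ : Euc n) (m : Fin n → ℤ) :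
    starRingEnd ℂ (symbar e₁ e₂ m) = - sym e₁ e₂ m := by
  simp only [symbar, sym, map_div₀, map_mul, map_add, Complex.conj_I, Complex.conj_ofReal,
    Complex.conj_ofNat]
  ring

theorem norm_sym (e₁ e₂ : Euc n) (m : Fin n → ℤ) : ‖sym e₁ e₂ m‖ = ‖symbar e₁ e₂ m‖ := by
  rw [← norm_neg, ← conj_symbar, RCLike.norm_conj]

theorem sym_zero (e₁ e₂ : Euc n) : sym e₁ e₂ 0 = 0 := by simp [sym, freq_apply]

theorem symbar_zero (e₁ e₂ : Euc n) : symbar e₁ e₂ 0 = 0 := by simp [symbar, freq_apply]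

theorem symbar_neg (e₁ e₂ : Euc n) (m : Fin n → ℤ) : symbar e₁ e₂ (-m) = - symbar e₁ e₂ m := by
  simp [symbar, freq_apply]; ring

theorem dz_mul {e₁ e₂ : Euc n} {f g : Euc n → ℂ} (hf : Differentiable ℝ f)
    (hg : Differentiable ℝ g) (x : Euc n) :
    dz e₁ e₂ (fun x => f x * g x) x = dz e₁ e₂ f x * g x + f x * dz e₁ e₂ g x := by
  simp only [dz, fderiv_fun_mul (hf x) (hg x), add_apply, smul_apply, smul_eq_mul]
  ring

theorem dzbar_mul {e₁ e₂ : Euc n} {f g : Euc n → ℂ} (hf : Differentiable ℝ f)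
    (hg : Differentiable ℝ g) (x : Euc n) :
    dzbar e₁ e₂ (fun x => f x * g x) x = dzbar e₁ e₂ f x * g x + f x * dzbar e₁ e₂ g x := by
  simp only [dzbar, fderiv_fun_mul (hf x) (hg x), add_apply, smul_apply, smul_eq_mul]
  ring

theorem dz_exp {e₁ e₂ : Euc n} {f : Euc n → ℂ} (hf : Differentiable ℝ f) (x : Euc n) :
    dz e₁ e₂ (fun x => Complex.exp (f x)) x = Complex.exp (f x) * dz e₁ e₂ f x := by
  simp only [dz, (hf x).hasFDerivAt.cexp.fderiv, smul_apply, smul_eq_mul]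
  ring

theorem dzbar_exp {e₁ e₂ : Euc n} {f : Euc n → ℂ} (hf : Differentiable ℝ f) (x : Euc n) :
    dzbar e₁ e₂ (fun x => Complex.exp (f x)) x = Complex.exp (f x) * dzbar e₁ e₂ f x := by
  simp only [dzbar, (hf x).hasFDerivAt.cexp.fderiv, smul_apply, smul_eq_mul]
  ring

theorem dz_chr (e₁ e₂ : Euc n) (m : Fin n → ℤ) (x : Euc n) :
    dz e₁ e₂ (chr m) x = sym e₁ e₂ m * chr m x := by
  simp only [dz, (hasFDerivAt_chr m x).fderiv, smul_apply, smul_eq_mul, sym,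
    ContinuousLinearMap.comp_apply, Complex.ofRealCLM_apply]
  ring

theorem dzbar_chr (e₁ e₂ : Euc n) (m : Fin n → ℤ) (x : Euc n) :
    dzbar e₁ e₂ (chr m) x = symbar e₁ e₂ m * chr m x := by
  simp only [dzbar, (hasFDerivAt_chr m x).fderiv, smul_apply, smul_eq_mul, symbar,
    ContinuousLinearMap.comp_apply, Complex.ofRealCLM_apply]
  ring

theorem differentiable_chr (m : Fin n → ℤ) : Differentiable ℝ (chr m : Euc n → ℂ) :=
  fun x => (hasFDerivAt_chr m x).differentiableAt

theorem contDiff_chr (m : Fin n → ℤ) : ContDiff ℝ k (chr m : Euc n → ℂ) := by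
  unfold chr
  exact (contDiff_const.mul ((Complex.ofRealCLM ∘L freq m).contDiff)).cexp

theorem latticePeriodic_chr (m : Fin n → ℤ) : LatticePeriodic (chr m : Euc n → ℂ) := by
  have : (chr m : Euc n → ℂ) = fun x => UnitAddTorus.mFourier m (toTorus n x) :=
    funext fun x => (mFourier_toTorus m x).symm
  rw [this]
  exact latticePeriodic_comp_toTorus _

theorem synth_add {a b : (Fin n → ℤ) → ℂ} (ha : Summable a) (hb : Summable b) (x : Euc n) :
    synth (fun m => a m + b m) x = synth a x + synth b x := by
  refine (((hasSum_synth ha x).add (hasSum_synth hb x)).congr_fun ?_).tsum_eq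
  intro m; ring

theorem synth_const_mul (c : ℂ) (a : (Fin n → ℤ) → ℂ) (x : Euc n) :
    synth (fun m => c * a m) x = c * synth a x := by
  rw [synth, synth, ← tsum_mul_left]
  exact tsum_congr fun m => by ring

theorem synth_single (m₀ : Fin n → ℤ) (c : ℂ) (x : Euc n) :
    synth (fun m => if m = m₀ then c else 0) x = c * chr m₀ x := by
  have : ∀ m, (if m = m₀ then c else 0) * chr m x = if m = m₀ then c * chr m₀ x else 0 := by
    intro m
    split_ifs with h
    · rw [h]
    · simp
  rw [synth, tsum_congr this, tsum_ite_eq]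

theorem summable_single (m₀ : Fin n → ℤ) (c : ℂ) :
    Summable fun m => if m = m₀ then c else 0 :=
  (hasSum_ite_eq m₀ c).summable

theorem Reg.dz_synth {a : (Fin n → ℤ) → ℂ} (hk : k + 1 ≤ k) (ha : Reg k a) (e₁ e₂ x : Euc n) :
    dz e₁ e₂ (synth a) x = synth (fun m => sym e₁ e₂ m * a m) x := by
  rw [dz, ha.fderiv_synth hk, ha.fderiv_synth hk, ← synth_const_mul, sub_eq_add_neg, ← neg_one_mul,
    ← synth_const_mul, ← synth_add ((ha.mul_freq hk _).summable hk)
      ((((ha.mul_freq hk _).summable hk).mul_left _).mul_left _), div_eq_inv_mul,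
    ← synth_const_mul]
  congr 1
  funext m
  simp only [sym]
  ring

theorem Reg.dzbar_synth {a : (Fin n → ℤ) → ℂ} (hk : k + 1 ≤ k) (ha : Reg k a)
    (e₁ e₂ x : Euc n) :
    dzbar e₁ e₂ (synth a) x = synth (fun m => symbar e₁ e₂ m * a m) x := by
  rw [dzbar, ha.fderiv_synth hk, ha.fderiv_synth hk, ← synth_const_mul,
    ← synth_add ((ha.mul_freq hk _).summable hk)
      (((ha.mul_freq hk _).summable hk).mul_left _), div_eq_inv_mul,
    ← synth_const_mul]
  congr 1
  funext m
  simp only [symbar]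
  ring

theorem continuous_dz {f : Euc n → ℂ} (hf : ContDiff ℝ 1 f) (e₁ e₂ : Euc n) :
    Continuous (dz e₁ e₂ f) := by
  have := hf.continuous_fderiv (by simp)
  unfold dz
  fun_prop

theorem continuous_dzbar {f : Euc n → ℂ} (hf : ContDiff ℝ 1 f) (e₁ e₂ : Euc n) :
    Continuous (dzbar e₁ e₂ f) := by
  have := hf.continuous_fderiv (by simp)
  unfold dzbar
  fun_prop

theorem LatticePeriodic.dz {f : Euc n → ℂ} (hf : LatticePeriodic f) (e₁ e₂ : Euc n) :
    LatticePeriodic (dz e₁ e₂ f) := fun x γ hγ => by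
  simp only [_root_.dz, hf.fderiv x γ hγ]

theorem LatticePeriodic.dzbar {f : Euc n → ℂ} (hf : LatticePeriodic f) (e₁ e₂ : Euc n) :
    LatticePeriodic (dzbar e₁ e₂ f) := fun x γ hγ => by
  simp only [_root_.dzbar, hf.fderiv x γ hγ]

theorem LatticePeriodic.mul {f g : Euc n → ℂ} (hf : LatticePeriodic f) (hg : LatticePeriodic g) :
    LatticePeriodic fun x => f x * g x := fun x γ hγ => by
  simp only [hf x γ hγ, hg x γ hγ]

theorem exists_descend_fderiv (u : C(Tor n, ℂ)) (hu : ContDiff ℝ 1 fun x => u (toTorus n x))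
    (e : Euc n) :
    ∃ v : C(Tor n, ℂ), ∀ x, v (toTorus n x) = fderiv ℝ (fun x => u (toTorus n x)) x e := by
  have hc := hu.continuous_fderiv (by simp)
  exact ⟨descend (fun x => fderiv ℝ (fun x => u (toTorus n x)) x e) (by fun_prop) fun x γ hγ => by
    simp only [(latticePeriodic_comp_toTorus u).fderiv x γ hγ], fun x => descend_apply _ _ _ x⟩

theorem fc_of_eq_dz (u v : C(Tor n, ℂ)) (hu : ContDiff ℝ 1 fun x => u (toTorus n x))
    (e₁ e₂ : Euc n) (hv : ∀ x, v (toTorus n x) = dz e₁ e₂ (fun x => u (toTorus n x)) x)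
    (m : Fin n → ℤ) : fc n v m = sym e₁ e₂ m * fc n u m := by
  obtain ⟨v₁, h₁⟩ := exists_descend_fderiv u hu e₁
  obtain ⟨v₂, h₂⟩ := exists_descend_fderiv u hu e₂
  have h : v = (2⁻¹ : ℂ) • (v₁ - Complex.I • v₂) := by
    ext t
    obtain ⟨x, rfl⟩ := toTorus_surjective t
    simp only [ContinuousMap.smul_apply, ContinuousMap.sub_apply, smul_eq_mul, hv, h₁, h₂, dz]
    ring
  rw [h, map_smul, map_sub, map_smul, lp.coeFn_smul, lp.coeFn_sub, lp.coeFn_smul]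
  simp only [Pi.smul_apply, Pi.sub_apply, smul_eq_mul, fc_of_eq_fderiv u v₁ hu e₁ h₁,
    fc_of_eq_fderiv u v₂ hu e₂ h₂, sym]
  ring

theorem fc_of_eq_dzbar (u v : C(Tor n, ℂ)) (hu : ContDiff ℝ 1 fun x => u (toTorus n x))
    (e₁ e₂ : Euc n) (hv : ∀ x, v (toTorus n x) = dzbar e₁ e₂ (fun x => u (toTorus n x)) x)
    (m : Fin n → ℤ) : fc n v m = symbar e₁ e₂ m * fc n u m := by
  obtain ⟨v₁, h₁⟩ := exists_descend_fderiv u hu e₁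
  obtain ⟨v₂, h₂⟩ := exists_descend_fderiv u hu e₂
  have h : v = (2⁻¹ : ℂ) • (v₁ + Complex.I • v₂) := by
    ext t
    obtain ⟨x, rfl⟩ := toTorus_surjective t
    simp only [ContinuousMap.smul_apply, ContinuousMap.add_apply, smul_eq_mul, hv, h₁, h₂, dzbar]
    ring
  rw [h, map_smul, map_add, map_smul, lp.coeFn_smul, lp.coeFn_add, lp.coeFn_smul]
  simp only [Pi.smul_apply, Pi.add_apply, smul_eq_mul, fc_of_eq_fderiv u v₁ hu e₁ h₁,
    fc_of_eq_fderiv u v₂ hu e₂ h₂, symbar]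
  ring

end wirtinger

section beltrami

variable {n : ℕ} {k : WithTop ℕ∞}

theorem add_one_le_of_eq (hk : k = ∞ ∨ k = ω) : k + 1 ≤ k := by
  rcases hk with rfl | rfl <;> simp

theorem exists_log_solution (hk : k = ∞ ∨ k = ω) (e₁ e₂ : Euc n)
    (hne : ∀ m, m ≠ 0 → symbar e₁ e₂ m ≠ 0) (hpoly : PolyBounded fun m => (symbar e₁ e₂ m)⁻¹)
    (μ : C(Tor n, ℂ)) (hμ : ContDiff ℝ k fun x => μ (toTorus n x)) (hμ1 : ‖μ‖ < 1) :
    ∃ (v : Euc n → ℂ) (c : ℂ), ContDiff ℝ k v ∧ LatticePeriodic v ∧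
      ∀ x, dzbar e₁ e₂ v x + c = μ (toTorus n x) * (dz e₁ e₂ v x - starRingEnd ℂ c) +
        dz e₁ e₂ (fun x => μ (toTorus n x)) x := by
  have hk1 := add_one_le_of_eq hk
  have h1k : (1 : WithTop ℕ∞) ≤ k := le_trans le_add_self hk1
  obtain ⟨S, hS, hSn⟩ := exists_diagOp (n := n) (fun m => if m = 0 then
    -(Complex.conjLIE.toLinearEquiv.toLinearMap : ℂ →ₗ[ℝ] ℂ)
    else LinearMap.mulLeft ℝ (sym e₁ e₂ m / symbar e₁ e₂ m)) 1 zero_le_one (fun m z => by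
      split_ifs with h
      · simp
      · simp only [LinearMap.mulLeft_apply, norm_mul, norm_div, norm_sym]
        rw [div_self (norm_ne_zero_iff.2 (hne m h))])
  have hS0 : ∀ a, S a 0 = - starRingEnd ℂ (a 0) := fun a => by rw [hS, if_pos rfl]; simp
  have hSm : ∀ a m, m ≠ 0 → S a m = sym e₁ e₂ m / symbar e₁ e₂ m * a m := fun a m hm => by
    rw [hS, if_neg hm]; simp
  have hμC : ContDiff ℝ 1 fun x => μ (toTorus n x) := hμ.of_le h1k
  have hνk : ContDiff ℝ k (dz e₁ e₂ fun x => μ (toTorus n x)) := by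
    have := hμ.fderiv_right hk1
    unfold dz
    fun_prop
  set ν := descend _ (continuous_dz hμC e₁ e₂) ((latticePeriodic_comp_toTorus μ).dz e₁ e₂) with hν
  have hνa : ∀ x, ν (toTorus n x) = dz e₁ e₂ (fun x => μ (toTorus n x)) x :=
    descend_apply _ _ _
  obtain ⟨w, hw, hwe⟩ := exists_reg_solution hk μ ν hμ (by simpa only [hνa] using hνk) hμ1 S hSn
    (fun h a b hab m => by
      by_cases hm : m = 0
      · subst hm; rw [hS0, hS0, hab, chr_zero_left]; simp
      · rw [hSm b m hm, hSm a m hm, hab]; ring)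
  have hV := hw.mul_polyBounded hk1 hpoly
  set V : (Fin n → ℤ) → ℂ := fun m => (symbar e₁ e₂ m)⁻¹ * w m with hVdef
  have hVs : ∀ x, dz e₁ e₂ (synth V) x = synth (fun m => sym e₁ e₂ m * V m) x := fun x =>
    hV.dz_synth hk1 e₁ e₂ x
  have hVb : ∀ x, dzbar e₁ e₂ (synth V) x = synth (fun m => symbar e₁ e₂ m * V m) x := fun x =>
    hV.dzbar_synth hk1 e₁ e₂ x
  have hws : Summable fun m => w m := hw.summable hk1
  have hVbs : Summable fun m => symbar e₁ e₂ m * V m := by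
    refine Summable.of_norm_bounded hws.norm fun m => ?_
    by_cases hm : m = 0
    · simp [hm, symbar_zero]
    · simp only [hVdef]
      rw [mul_inv_cancel_left₀ (hne m hm)]
  have hVss : Summable fun m => sym e₁ e₂ m * V m := by
    refine Summable.of_norm_bounded hVbs.norm fun m => ?_
    simp only [norm_mul, norm_sym, le_refl]
  have hwV : (fun m => w m) = fun m => symbar e₁ e₂ m * V m + if m = 0 then w 0 else 0 := by
    funext m
    by_cases hm : m = 0
    · simp [hm, symbar_zero]
    · simp only [hVdef, hm, if_false]
      rw [mul_inv_cancel_left₀ (hne m hm), add_zero]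
  have hSV : (fun m => S w m) = fun m => sym e₁ e₂ m * V m +
      if m = 0 then -starRingEnd ℂ (w 0) else 0 := by
    funext m
    by_cases hm : m = 0
    · simp [hm, sym_zero, hS0]
    · simp only [hVdef, hm, if_false]
      rw [hSm w m hm, add_zero]; ring
  have hSs : Summable fun m => S w m := by
    rw [hSV]; exact hVss.add (summable_single _ _)
  obtain ⟨p, hp, hpx⟩ := exists_torus_synth hws
  obtain ⟨q, hq, hqx⟩ := exists_torus_synth hSs
  have hpq : p = μ * q + ν := by
    apply fc_injective
    have e1 : fc n p = w := by ext m; exact hp m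
    have e2 : fc n q = S w := by ext m; exact hq m
    rw [map_add, ← mulOp_fc, e1, e2]
    exact hwe
  refine ⟨synth V, w 0, hV.contDiff_synth hk1, latticePeriodic_synth (hV.summable hk1), fun x => ?_⟩
  have e1 : p (toTorus n x) = dzbar e₁ e₂ (synth V) x + w 0 := by
    rw [hpx, hwV, synth_add hVbs (summable_single _ _), synth_single, hVb, chr_zero_left, mul_one]
  have e2 : q (toTorus n x) = dz e₁ e₂ (synth V) x - starRingEnd ℂ (w 0) := by
    rw [hqx, hSV, synth_add hVss (summable_single _ _), synth_single, hVs, chr_zero_left, mul_one,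
      sub_eq_add_neg]
  rw [← e1, ← e2, ← hνa, hpq]
  rfl

theorem hasSum_fc_uniform (u : C(Tor n, ℂ)) (hu : Summable fun m => fc n u m) :
    HasSum (fun m => fc n u m • UnitAddTorus.mFourier m) u := by
  obtain ⟨v, hv, hs⟩ := hasSum_of_summable _ hu
  have : v = u := fc_injective (by ext m; exact hv m)
  rwa [this] at hs

theorem dz_finset_sum (e₁ e₂ : Euc n) (s : Finset (Fin n → ℤ)) (a : (Fin n → ℤ) → ℂ) (x : Euc n) :
    dz e₁ e₂ (fun x => ∑ m ∈ s, a m * chr m x) x = ∑ m ∈ s, sym e₁ e₂ m * a m * chr m x ∧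
    dzbar e₁ e₂ (fun x => ∑ m ∈ s, a m * chr m x) x = ∑ m ∈ s, symbar e₁ e₂ m * a m * chr m x := by
  have h : HasFDerivAt (fun x => ∑ m ∈ s, a m * chr m x)
      (∑ m ∈ s, a m • ((Complex.I * chr m x) • (Complex.ofRealCLM ∘L freq m))) x :=
    HasFDerivAt.fun_sum fun m _ => (hasFDerivAt_chr m x).const_mul (a m)
  simp only [dz, dzbar, h.fderiv, sum_apply, smul_apply, smul_eq_mul,
    ContinuousLinearMap.comp_apply, Complex.ofRealCLM_apply, Finset.mul_sum,
    ← Finset.sum_sub_distrib, ← Finset.sum_add_distrib, Finset.sum_div]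
  constructor
  · refine Finset.sum_congr rfl fun m _ => ?_
    simp only [sym]; ring
  · refine Finset.sum_congr rfl fun m _ => ?_
    simp only [symbar]; ring

/-- A trigonometric polynomial cannot approximately solve a uniformly elliptic first order system
without zero order resonance: look at the maximum of its absolute value. -/
theorem false_of_approximate_primitive (e₁ e₂ : Euc n) (s : Finset (Fin n → ℤ))
    (a : (Fin n → ℤ) → ℂ) (c : ℂ) (f μ : Euc n → ℂ) (δ κ ε : ℝ) (hκ0 : 0 ≤ κ) (hκ : κ < 1)
    (hε : 2 * ε < δ * (1 - κ)) (hf : ∀ x, δ ≤ ‖f x‖) (hμ : ∀ x, ‖μ x‖ ≤ κ)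
    (h₁ : ∀ x, ‖dz e₁ e₂ (fun x => ∑ m ∈ s, a m * chr m x) x -
      starRingEnd ℂ c * (∑ m ∈ s, a m * chr m x) - f x‖ ≤ ε)
    (h₂ : ∀ x, ‖dzbar e₁ e₂ (fun x => ∑ m ∈ s, a m * chr m x) x +
      c * (∑ m ∈ s, a m * chr m x) - μ x * f x‖ ≤ ε) : False := by
  set U : Euc n → ℂ := fun x => ∑ m ∈ s, a m * chr m x with hU
  have hε0 : 0 ≤ ε := (norm_nonneg _).trans (h₁ 0)
  have hδ : 0 < δ := by
    by_contra h
    push Not at h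
    nlinarith
  have hUd : Differentiable ℝ U := fun x => by
    refine DifferentiableAt.fun_sum fun m _ => ?_
    exact (differentiable_chr m x).const_mul (a m)
  have hUp : LatticePeriodic U := fun x γ hγ => by
    simp only [hU]
    exact Finset.sum_congr rfl fun m _ => by rw [latticePeriodic_chr m x γ hγ]
  obtain ⟨x, hx⟩ : ∃ x, ∀ y, ‖U y‖ ≤ ‖U x‖ := by
    obtain ⟨t, -, ht⟩ := (isCompact_univ (X := Tor n)).exists_isMaxOn Set.univ_nonempty
      (f := fun t => ‖descend U hUd.continuous hUp t‖) (by fun_prop)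
    obtain ⟨x, rfl⟩ := toTorus_surjective t
    refine ⟨x, fun y => ?_⟩
    have := ht (Set.mem_univ (toTorus n y))
    simpa only [Set.mem_ofPred, descend_apply] using this
  have h1 : ‖dz e₁ e₂ U x - starRingEnd ℂ c * U x - f x‖ ≤ ε := h₁ x
  have h2 : ‖dzbar e₁ e₂ U x + c * U x - μ x * f x‖ ≤ ε := h₂ x
  by_cases h0 : U x = 0
  · have hU0 : U = fun _ => 0 := by
      funext y
      have := hx y
      rw [h0, norm_zero] at this
      exact norm_le_zero_iff.1 this
    have hd : dz e₁ e₂ U x = 0 := by rw [hU0]; simp [dz]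
    rw [hd, h0, mul_zero, sub_zero, zero_sub, norm_neg] at h1
    have := hf x
    nlinarith
  · have hmax : IsLocalMax (fun y => ‖U y‖ ^ 2) x := by
      refine Filter.Eventually.of_forall fun y => ?_
      have := hx y
      change ‖U y‖ ^ 2 ≤ ‖U x‖ ^ 2
      gcongr
    have hcrit := hmax.fderiv_eq_zero
    have hre : ∀ e, (fderiv ℝ U x e * starRingEnd ℂ (U x)).re = 0 := fun e => by
      have h3 := (hUd x).hasFDerivAt.norm_sq
      rw [h3.fderiv] at hcrit
      have h4 := congrArg (fun L => L e) hcrit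
      simp only [smul_apply, ContinuousLinearMap.comp_apply, innerSL_apply_apply, zero_apply,
        smul_eq_zero, OfNat.ofNat_ne_zero, false_or, Complex.inner] at h4
      exact h4
    have key : (dz e₁ e₂ U x - starRingEnd ℂ c * U x) * starRingEnd ℂ (U x) +
        U x * starRingEnd ℂ (dzbar e₁ e₂ U x + c * U x) = 0 := by
      have e1 : dz e₁ e₂ U x * starRingEnd ℂ (U x) + U x * starRingEnd ℂ (dzbar e₁ e₂ U x) =
          (fderiv ℝ U x e₁ * starRingEnd ℂ (U x)).re -
            Complex.I * (fderiv ℝ U x e₂ * starRingEnd ℂ (U x)).re := by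
        rw [Complex.re_eq_add_conj, Complex.re_eq_add_conj]
        simp only [dz, dzbar, map_div₀, map_mul, map_add, Complex.conj_I, Complex.conj_conj,
          Complex.conj_ofNat]
        ring
      rw [hre, hre, Complex.ofReal_zero] at e1
      simp only [map_add, map_mul]
      linear_combination e1
    have hnorm : ‖dz e₁ e₂ U x - starRingEnd ℂ c * U x‖ = ‖dzbar e₁ e₂ U x + c * U x‖ := by
      have h3 := congrArg norm (eq_neg_of_add_eq_zero_left key)
      rw [norm_neg, norm_mul, norm_mul, RCLike.norm_conj, RCLike.norm_conj, mul_comm] at h3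
      exact mul_left_cancel₀ (norm_ne_zero_iff.2 h0) h3
    have h5 : ‖f x‖ ≤ ‖dz e₁ e₂ U x - starRingEnd ℂ c * U x‖ + ε := by
      have := norm_sub_norm_le (f x) (dz e₁ e₂ U x - starRingEnd ℂ c * U x)
      rw [norm_sub_rev (f x)] at this
      linarith
    have h6 : ‖dzbar e₁ e₂ U x + c * U x‖ ≤ κ * ‖f x‖ + ε := by
      have := norm_sub_norm_le (dzbar e₁ e₂ U x + c * U x) (μ x * f x)
      have h7 : ‖μ x * f x‖ ≤ κ * ‖f x‖ := by
        rw [norm_mul]; gcongr; exact hμ x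
      linarith
    have := hf x
    nlinarith

theorem exists_resonance (e₁ e₂ : Euc n) (μ u : C(Tor n, ℂ)) (c : ℂ) (hμ1 : ‖μ‖ < 1)
    (hu0 : ∀ t, u t ≠ 0) (hus : Summable fun m => fc n u m)
    (hps : Summable fun m => fc n (μ * u) m)
    (h : ∀ m, (symbar e₁ e₂ m + c) * fc n u m =
      (sym e₁ e₂ m - starRingEnd ℂ c) * fc n (μ * u) m) :
    ∃ m, symbar e₁ e₂ m + c = 0 := by
  by_contra hne
  push Not at hne
  have hne' : ∀ m, sym e₁ e₂ m - starRingEnd ℂ c ≠ 0 := fun m h0 => hne m (by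
    have := congrArg (starRingEnd ℂ) h0
    rw [map_sub, Complex.conj_conj, map_zero, ← neg_neg (sym e₁ e₂ m), ← conj_symbar, map_neg,
      Complex.conj_conj] at this
    linear_combination -this)
  obtain ⟨t₀, -, ht₀⟩ := (isCompact_univ (X := Tor n)).exists_isMinOn Set.univ_nonempty
      (f := fun t => ‖u t‖) (by fun_prop)
  set δ := ‖u t₀‖ with hδ
  have hδ0 : 0 < δ := norm_pos_iff.2 (hu0 t₀)
  set ε := δ * (1 - ‖μ‖) / 4 with hε
  have hε0 : 0 < ε := by
    have : 0 < 1 - ‖μ‖ := by linarith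
    positivity
  have ev1 := Metric.tendsto_nhds.1 (hasSum_fc_uniform u hus) ε hε0
  have ev2 := Metric.tendsto_nhds.1 (hasSum_fc_uniform (μ * u) hps) ε hε0
  obtain ⟨s, hs1, hs2⟩ := (ev1.and ev2).exists
  have happ : ∀ (v : C(Tor n, ℂ)), dist (∑ m ∈ s, fc n v m • UnitAddTorus.mFourier m) v < ε →
      ∀ x, ‖∑ m ∈ s, fc n v m * chr m x - v (toTorus n x)‖ ≤ ε := fun v hv x => by
    rw [dist_eq_norm] at hv
    refine le_trans ?_ ((ContinuousMap.norm_coe_le_norm _ (toTorus n x)).trans hv.le)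
    simp [mFourier_toTorus]
  refine false_of_approximate_primitive e₁ e₂ s (fun m => fc n u m / (sym e₁ e₂ m - starRingEnd ℂ c))
    c (fun x => u (toTorus n x)) (fun x => μ (toTorus n x)) δ ‖μ‖ ε (norm_nonneg μ) hμ1
    (by rw [hε]; nlinarith) (fun x => ht₀ (Set.mem_univ _)) (fun x => μ.norm_coe_le_norm _)
    (fun x => ?_) fun x => ?_
  · rw [(dz_finset_sum e₁ e₂ s _ x).1, Finset.mul_sum, ← Finset.sum_sub_distrib]
    refine le_of_eq_of_le ?_ (happ u hs1 x)
    congr 2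
    refine Finset.sum_congr rfl fun m _ => ?_
    have := hne' m
    field_simp
  · rw [(dz_finset_sum e₁ e₂ s _ x).2, Finset.mul_sum, ← Finset.sum_add_distrib]
    refine le_of_eq_of_le ?_ (happ (μ * u) hs2 x)
    congr 2
    refine Finset.sum_congr rfl fun m _ => ?_
    have h1 := hne' m
    have h2 := h m
    have h3 : fc n (μ * u) m = (symbar e₁ e₂ m + c) * fc n u m / (sym e₁ e₂ m - starRingEnd ℂ c) := by
      rw [h2]; field_simp
    rw [h3]
    field_simp

theorem exists_uniformizing_function (hk : k = ∞ ∨ k = ω) (e₁ e₂ : Euc n)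
    (ζ : Euc n →L[ℝ] ℂ) (hζ₁ : ζ e₁ = 1) (hζ₂ : ζ e₂ = Complex.I)
    (hne : ∀ m, m ≠ 0 → symbar e₁ e₂ m ≠ 0) (hpoly : PolyBounded fun m => (symbar e₁ e₂ m)⁻¹)
    (μ : C(Tor n, ℂ)) (hμ : ContDiff ℝ k fun x => μ (toTorus n x)) (hμ1 : ‖μ‖ < 1) :
    ∃ W : Euc n → ℂ, ContDiff ℝ k W ∧ LatticePeriodic (fderiv ℝ W) ∧
      ∀ x, dz e₁ e₂ W x ≠ 0 ∧ dzbar e₁ e₂ W x = μ (toTorus n x) * dz e₁ e₂ W x := by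
  have hk1 := add_one_le_of_eq hk
  have h1k : (1 : WithTop ℕ∞) ≤ k := le_trans le_add_self hk1
  have h0k : k ≠ 0 := by intro h0; simp [h0] at h1k
  obtain ⟨v, c, hv, hvp, hve⟩ := exists_log_solution hk e₁ e₂ hne hpoly μ hμ hμ1
  have hvd := hv.differentiable h0k
  have hμd := hμ.differentiable h0k
  have hμp := latticePeriodic_comp_toTorus μ
  -- the exponential of the logarithmic solution
  have hf : ContDiff ℝ k fun x => Complex.exp (v x) := hv.cexp
  have hfp : LatticePeriodic fun x => Complex.exp (v x) := fun x γ hγ => by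
    simp only [hvp x γ hγ]
  have hfe : ∀ x, dzbar e₁ e₂ (fun x => Complex.exp (v x)) x + c * Complex.exp (v x) =
      dz e₁ e₂ (fun x => μ (toTorus n x) * Complex.exp (v x)) x -
        starRingEnd ℂ c * (μ (toTorus n x) * Complex.exp (v x)) := fun x => by
    rw [dz_mul hμd (hf.differentiable h0k), dz_exp hvd, dzbar_exp hvd]
    linear_combination Complex.exp (v x) * hve x
  obtain ⟨m₀, hm₀⟩ : ∃ m, symbar e₁ e₂ m + c = 0 := by
    set u := descend _ hf.continuous hfp with hu
    have hua : ∀ x, u (toTorus n x) = Complex.exp (v x) := descend_apply _ _ _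
    have huC : ContDiff ℝ k fun x => u (toTorus n x) := by simpa only [hua] using hf
    have hμu : ContDiff ℝ k fun x => (μ * u) (toTorus n x) := hμ.mul huC
    refine exists_resonance e₁ e₂ μ u c hμ1 (fun t => ?_) ((reg_fc hk u huC).summable hk1)
      ((reg_fc hk _ hμu).summable hk1) fun m => ?_
    · obtain ⟨x, rfl⟩ := toTorus_surjective t
      rw [hua]; exact Complex.exp_ne_zero _
    · set p := descend _ (continuous_dzbar (huC.of_le h1k) e₁ e₂)
        ((latticePeriodic_comp_toTorus u).dzbar e₁ e₂)
      have hpa : ∀ x, p (toTorus n x) = _ := descend_apply _ _ _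
      set q := descend _ (continuous_dz (hμu.of_le h1k) e₁ e₂)
        ((latticePeriodic_comp_toTorus (μ * u)).dz e₁ e₂)
      have hqa : ∀ x, q (toTorus n x) = _ := descend_apply _ _ _
      have hpq : p + c • u = q - starRingEnd ℂ c • (μ * u) := by
        ext t
        obtain ⟨x, rfl⟩ := toTorus_surjective t
        simp only [ContinuousMap.add_apply, ContinuousMap.sub_apply, ContinuousMap.smul_apply,
          hpa, hqa, ContinuousMap.mul_apply, hua, smul_eq_mul]
        exact hfe x
      have h1 := congrArg (fun u => fc n u m) hpq
      simp only [map_add, map_sub, map_smul, lp.coeFn_add, lp.coeFn_sub, lp.coeFn_smul,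
        Pi.add_apply, Pi.sub_apply, Pi.smul_apply, smul_eq_mul,
        fc_of_eq_dzbar u p (huC.of_le h1k) e₁ e₂ hpa m,
        fc_of_eq_dz _ q (hμu.of_le h1k) e₁ e₂ hqa m] at h1
      linear_combination h1
  -- remove the resonance
  set f : Euc n → ℂ := fun x => Complex.exp (v x) * chr (-m₀) x with hfdef
  have hfC : ContDiff ℝ k f := hf.mul (contDiff_chr _)
  have hfper : LatticePeriodic f := hfp.mul (latticePeriodic_chr _)
  have hf0 : ∀ x, f x ≠ 0 := fun x => mul_ne_zero (Complex.exp_ne_zero _) (chr_ne_zero _ _)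
  have hc1 : symbar e₁ e₂ (-m₀) = c := by rw [symbar_neg]; linear_combination -hm₀
  have hc2 : sym e₁ e₂ (-m₀) = - starRingEnd ℂ c := by
    rw [← hc1, conj_symbar, neg_neg]
  have hfeq : ∀ x, dzbar e₁ e₂ f x = dz e₁ e₂ (fun x => μ (toTorus n x) * f x) x := fun x => by
    have e1 : (fun x => μ (toTorus n x) * f x) =
        fun x => (μ (toTorus n x) * Complex.exp (v x)) * chr (-m₀) x := by
      funext x; simp only [hfdef]; ring
    rw [e1, dz_mul (f := fun x => μ (toTorus n x) * Complex.exp (v x))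
      (hμd.mul (hf.differentiable h0k)) (differentiable_chr _), hfdef,
      dzbar_mul (hf.differentiable h0k) (differentiable_chr _), dz_chr, dzbar_chr, hc1, hc2]
    linear_combination chr (-m₀) x * hfe x
  set u := descend _ hfC.continuous hfper with hu
  have hua : ∀ x, u (toTorus n x) = f x := descend_apply _ _ _
  have huC : ContDiff ℝ k fun x => u (toTorus n x) := by simpa only [hua] using hfC
  have hμu : ContDiff ℝ k fun x => (μ * u) (toTorus n x) := hμ.mul huC
  have hcoef : ∀ m, symbar e₁ e₂ m * fc n u m = sym e₁ e₂ m * fc n (μ * u) m := fun m => by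
    set p := descend _ (continuous_dzbar (huC.of_le h1k) e₁ e₂)
      ((latticePeriodic_comp_toTorus u).dzbar e₁ e₂)
    have hpa : ∀ x, p (toTorus n x) = _ := descend_apply _ _ _
    rw [← fc_of_eq_dzbar u p (huC.of_le h1k) e₁ e₂ hpa m]
    refine fc_of_eq_dz _ p (hμu.of_le h1k) e₁ e₂ (fun x => ?_) m
    rw [hpa]
    simp only [ContinuousMap.mul_apply, hua]
    exact hfeq x
  have hne' : ∀ m, m ≠ 0 → sym e₁ e₂ m ≠ 0 := fun m hm => by
    rw [← norm_ne_zero_iff, norm_sym, norm_ne_zero_iff]; exact hne m hm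
  have hpoly' : PolyBounded fun m => (sym e₁ e₂ m)⁻¹ := by
    obtain ⟨C, N, h⟩ := hpoly
    exact ⟨C, N, fun m => by rw [norm_inv, norm_sym, ← norm_inv]; exact h m⟩
  have ha := reg_fc hk u huC
  have hb := reg_fc hk _ hμu
  have hY := ha.mul_polyBounded hk1 hpoly'
  set Y : (Fin n → ℤ) → ℂ := fun m => (sym e₁ e₂ m)⁻¹ * fc n u m with hYdef
  have eq1 : (fun m => fc n u m) = fun m => sym e₁ e₂ m * Y m +
      if m = 0 then fc n u 0 else 0 := by
    funext m
    by_cases hm : m = 0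
    · simp [hm, sym_zero]
    · simp only [hYdef, hm, if_false]
      rw [mul_inv_cancel_left₀ (hne' m hm), add_zero]
  have eq2 : (fun m => fc n (μ * u) m) = fun m => symbar e₁ e₂ m * Y m +
      if m = 0 then fc n (μ * u) 0 else 0 := by
    funext m
    by_cases hm : m = 0
    · simp [hm, symbar_zero]
    · simp only [hYdef, hm, if_false]
      have h1 := hne' m hm
      have h2 := hcoef m
      field_simp
      linear_combination -h2
  have hs1 : Summable fun m => sym e₁ e₂ m * Y m := by
    have := ((ha.summable hk1).sub (summable_single 0 (fc n u 0)))
    refine this.congr fun m => ?_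
    have := congrFun eq1 m
    rw [this]; ring
  have hs2 : Summable fun m => symbar e₁ e₂ m * Y m := by
    have := ((hb.summable hk1).sub (summable_single 0 (fc n (μ * u) 0)))
    refine this.congr fun m => ?_
    have := congrFun eq2 m
    rw [this]; ring
  have hYk := hY.contDiff_synth hk1
  have hYd := hYk.differentiable h0k
  let A : Euc n →L[ℝ] ℂ := fc n u 0 • ζ + fc n (μ * u) 0 • (Complex.conjCLE.toContinuousLinearMap ∘L ζ)
  have hWd : ∀ x, fderiv ℝ (fun x => synth Y x + A x) x = fderiv ℝ (synth Y) x + A := fun x => by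
    rw [fderiv_fun_add (hYd x) A.differentiableAt, A.fderiv]
  have hA1 : A e₁ = fc n u 0 + fc n (μ * u) 0 := by simp [A, hζ₁]
  have hA2 : A e₂ = Complex.I * (fc n u 0 - fc n (μ * u) 0) := by simp [A, hζ₂]; ring
  have hW1 : ∀ x, dz e₁ e₂ (fun x => synth Y x + A x) x = f x := fun x => by
    have e1 : dz e₁ e₂ (fun x => synth Y x + A x) x = dz e₁ e₂ (synth Y) x + fc n u 0 := by
      simp only [dz, hWd, add_apply, hA1, hA2]
      linear_combination (-(fc n u 0 - fc n (μ * u) 0) / 2) * Complex.I_sq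
    rw [e1, hY.dz_synth hk1, ← hua, eq_synth_fc u (ha.summable hk1), eq1,
      synth_add hs1 (summable_single _ _), synth_single, chr_zero_left, mul_one]
  have hW2 : ∀ x, dzbar e₁ e₂ (fun x => synth Y x + A x) x = μ (toTorus n x) * f x := fun x => by
    have e1 : dzbar e₁ e₂ (fun x => synth Y x + A x) x =
        dzbar e₁ e₂ (synth Y) x + fc n (μ * u) 0 := by
      simp only [dzbar, hWd, add_apply, hA1, hA2]
      linear_combination ((fc n u 0 - fc n (μ * u) 0) / 2) * Complex.I_sq
    have e2 : μ (toTorus n x) * f x = (μ * u) (toTorus n x) := by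
      rw [ContinuousMap.mul_apply, hua]
    rw [e1, hY.dzbar_synth hk1, e2, eq_synth_fc _ (hb.summable hk1), eq2,
      synth_add hs2 (summable_single _ _), synth_single, chr_zero_left, mul_one]
  refine ⟨fun x => synth Y x + A x, hYk.add A.contDiff, fun x γ hγ => ?_, fun x => ?_⟩
  · rw [hWd, hWd, (latticePeriodic_synth (hY.summable hk1)).fderiv x γ hγ]
  · rw [hW1, hW2]
    exact ⟨hf0 x, rfl⟩

end beltrami

section pullback

variable {n : ℕ}

/-- A periodic function as a function on `𝕋ⁿ`. -/
noncomputable def onTorus {Y : Type*} (f : Euc n → Y) (p : StdTorus n) : Y := f (Quotient.out p)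

theorem stdTorus_eq_iff (x y : Euc n) :
    (x : StdTorus n) = (y : StdTorus n) ↔ y - x ∈ periodLattice n := by
  rw [QuotientAddGroup.eq, neg_add_eq_sub]

theorem onTorus_coe {Y : Type*} {f : Euc n → Y} (hf : LatticePeriodic f) (x : Euc n) :
    onTorus f (x : StdTorus n) = f x := by
  have h : ((Quotient.out (x : StdTorus n) : Euc n) : StdTorus n) = (x : StdTorus n) :=
    Quotient.out_eq _
  rw [stdTorus_eq_iff] at h
  have := hf (Quotient.out (x : StdTorus n)) _ h
  rw [add_sub_cancel] at this
  exact this.symm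

theorem latticePeriodic_comp_coe {Y : Type*} (g : StdTorus n → Y) :
    LatticePeriodic fun x : Euc n => g (x : StdTorus n) := fun x γ hγ => by
  have : ((x + γ : Euc n) : StdTorus n) = (x : StdTorus n) := by
    rw [eq_comm, stdTorus_eq_iff]; simpa using hγ
  exact congrArg g this

/-- The inner product as a continuous bilinear form. -/
noncomputable def innerBilin (n : ℕ) : Euc n →L[ℝ] Euc n →L[ℝ] ℝ :=
  (isBoundedBilinearMap_inner (𝕜 := ℝ) (E := Euc n)).toContinuousLinearMap

/-- The pullback of the inner product by a linear map. -/
noncomputable def pullbackInner (L : Euc n →L[ℝ] Euc n) : Euc n →L[ℝ] Euc n →L[ℝ] ℝ :=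
  ((ContinuousLinearMap.compL ℝ (Euc n) (Euc n) ℝ).flip L).comp ((innerBilin n).comp L)

theorem pullbackInner_apply (L : Euc n →L[ℝ] Euc n) (u v : Euc n) :
    pullbackInner L u v = ⟪L u, L v⟫ := rfl

theorem contDiff_pullbackInner {k : WithTop ℕ∞} :
    ContDiff ℝ k (pullbackInner : (Euc n →L[ℝ] Euc n) → Euc n →L[ℝ] Euc n →L[ℝ] ℝ) := by
  refine contDiff_clm_apply_iff.2 fun u => contDiff_clm_apply_iff.2 fun v => ?_
  simp only [pullbackInner_apply]
  exact (contDiff_id.clm_apply contDiff_const).inner ℝ (contDiff_id.clm_apply contDiff_const)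

theorem koszul_eq_inner {h : BilinField n} {φ : Euc n → Euc n} {U : Set (Euc n)} (hU : IsOpen U)
    (hφ : ContDiffOn ℝ 2 φ U)
    (hh : ∀ y ∈ U, ∀ u v, h (y : StdTorus n) u v = ⟪fderiv ℝ φ y u, fderiv ℝ φ y v⟫)
    {x : Euc n} (hx : x ∈ U) (u v w : Euc n) :
    koszul h x u v w = ⟪fderiv ℝ (fderiv ℝ φ) x u v, fderiv ℝ φ x w⟫ := by
  have hφx : ContDiffAt ℝ 2 φ x := hφ.contDiffAt (hU.mem_nhds hx)
  have hd : DifferentiableAt ℝ (fderiv ℝ φ) x :=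
    (hφx.fderiv_right (m := 1) (by norm_num)).differentiableAt (by simp)
  have key : ∀ a b c : Euc n, fderiv ℝ (fun y : Euc n => h (y : StdTorus n) a b) x c =
      ⟪fderiv ℝ (fderiv ℝ φ) x c a, fderiv ℝ φ x b⟫ +
      ⟪fderiv ℝ φ x a, fderiv ℝ (fderiv ℝ φ) x c b⟫ := fun a b c => by
    have he : (fun y : Euc n => h (y : StdTorus n) a b) =ᶠ[𝓝 x]
        fun y => ⟪fderiv ℝ φ y a, fderiv ℝ φ y b⟫ := by
      filter_upwards [hU.mem_nhds hx] with y hy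
      exact hh y hy a b
    have ha := hd.hasFDerivAt.clm_apply (hasFDerivAt_const a x)
    have hb := hd.hasFDerivAt.clm_apply (hasFDerivAt_const b x)
    rw [he.fderiv_eq, (ha.inner ℝ hb).fderiv]
    simp [fderivInnerCLM_apply, add_comm]
  have hsymm : ∀ a b, fderiv ℝ (fderiv ℝ φ) x a b = fderiv ℝ (fderiv ℝ φ) x b a := fun a b =>
    (hφx.isSymmSndFDerivAt (by simp)).eq a b
  rw [koszul, key, key, key, hsymm v u, hsymm w u, hsymm w v, hsymm v w,
    real_inner_comm (fderiv ℝ (fderiv ℝ φ) x u w) (fderiv ℝ φ x v), hsymm u w]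
  have e1 := real_inner_comm (fderiv ℝ (fderiv ℝ φ) x w u) (fderiv ℝ φ x v)
  have e2 := real_inner_comm (fderiv ℝ (fderiv ℝ φ) x w v) (fderiv ℝ φ x u)
  linarith

theorem mem_of_fderiv_mem {E F : Type*} [NormedAddCommGroup E] [NormedSpace ℝ E]
    [NormedAddCommGroup F] [InnerProductSpace ℝ F] [FiniteDimensional ℝ F] (Q : Submodule ℝ F)
    {f : E → F} {x : E} (hf : DifferentiableAt ℝ f x) (hQ : ∀ y, f y ∈ Q) (u : E) :
    fderiv ℝ f x u ∈ Q := by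
  have h1 : ∀ y, Qᗮ.starProjection (f y) = 0 := fun y => by
    rw [Submodule.starProjection_apply_eq_zero_iff, Submodule.orthogonal_orthogonal]
    exact hQ y
  have h2 := (Qᗮ.starProjection.hasFDerivAt).comp x hf.hasFDerivAt
  have h3 : (Qᗮ.starProjection ∘ f) = fun _ => 0 := funext h1
  rw [h3] at h2
  have h4 := congrArg (fun L => L u) (h2.unique (hasFDerivAt_const 0 x))
  have h5 : Qᗮ.starProjection (fderiv ℝ f x u) = 0 := h4
  rwa [Submodule.starProjection_apply_eq_zero_iff, Submodule.orthogonal_orthogonal] at h5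

theorem map_eq_of_injective {P Q : Submodule ℝ (Euc n)} (L : Euc n →L[ℝ] Euc n)
    (hL : Function.Injective L) (hPQ : ∀ u ∈ P, L u ∈ Q)
    (hdim : Module.finrank ℝ Q = Module.finrank ℝ P) : ∀ q ∈ Q, ∃ u ∈ P, L u = q := by
  have h1 : P.map (L : Euc n →ₗ[ℝ] Euc n) ≤ Q := by
    rintro _ ⟨u, hu, rfl⟩
    exact hPQ u hu
  have h2 : P.map (L : Euc n →ₗ[ℝ] Euc n) = Q := by
    refine Submodule.eq_of_le_of_finrank_eq h1 ?_
    rw [hdim]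
    exact (Submodule.equivMapOfInjective (L : Euc n →ₗ[ℝ] Euc n) hL P).finrank_eq.symm
  intro q hq
  rw [← h2] at hq
  obtain ⟨u, hu, h⟩ := hq
  exact ⟨u, hu, h⟩

/-- The pullback of the Euclidean metric by a map with periodic derivative that maps the leaves
conformally into parallel planes. -/
theorem hasAdaptedEuclideanMetric_of_map {k : WithTop ℕ∞} (hk : k = ∞ ∨ k = ω)
    {P Q : Submodule ℝ (Euc n)} (J : StdTorus n → P →ₗ[ℝ] P) (Φ : Euc n → Euc n)
    (hΦ : ContDiff ℝ k Φ) (hper : LatticePeriodic (fderiv ℝ Φ))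
    (hinj : ∀ x, Function.Injective (fderiv ℝ Φ x)) (hPQ : ∀ x, ∀ u ∈ P, fderiv ℝ Φ x u ∈ Q)
    (hdim : Module.finrank ℝ Q = Module.finrank ℝ P)
    (hconf : ∀ (x : Euc n) (u v : P), ⟪fderiv ℝ Φ x (J (x : StdTorus n) u),
      fderiv ℝ Φ x (J (x : StdTorus n) v)⟫ = ⟪fderiv ℝ Φ x u, fderiv ℝ Φ x v⟫) :
    HasAdaptedEuclideanMetric k P J := by
  have hk1 := add_one_le_of_eq hk
  have h2k : (2 : WithTop ℕ∞) ≤ k := by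
    rcases hk with rfl | rfl
    · exact WithTop.coe_le_coe.2 le_top
    · exact le_top
  have hpb : LatticePeriodic fun x => pullbackInner (fderiv ℝ Φ x) := fun x γ hγ => by
    simp only [hper x γ hγ]
  set h : BilinField n := onTorus fun x => pullbackInner (fderiv ℝ Φ x) with hdef
  have hh : ∀ x : Euc n, h (x : StdTorus n) = pullbackInner (fderiv ℝ Φ x) := onTorus_coe hpb
  have hh' : ∀ y ∈ Set.univ, ∀ u v, h ((y : Euc n) : StdTorus n) u v =
      ⟪fderiv ℝ Φ y u, fderiv ℝ Φ y v⟫ := fun y _ u v => by rw [hh, pullbackInner_apply]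
  have hΦ2 : ContDiff ℝ 2 Φ := hΦ.of_le h2k
  refine ⟨h, ⟨?_, fun p u v => ?_, fun p u hu => ?_⟩, fun x => ?_, ?_, fun p u v => ?_⟩
  · simp only [hh]
    exact contDiff_pullbackInner.comp (hΦ.fderiv_right hk1)
  · obtain ⟨x, rfl⟩ := QuotientAddGroup.mk_surjective p
    rw [hh, pullbackInner_apply, pullbackInner_apply, real_inner_comm]
  · obtain ⟨x, rfl⟩ := QuotientAddGroup.mk_surjective p
    rw [hh, pullbackInner_apply, real_inner_self_pos]
    exact fun h0 => hu (hinj x (by rw [h0, map_zero]))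
  · exact ⟨Set.univ, Φ, isOpen_univ, Set.mem_univ x, hΦ2.contDiffOn, hh'⟩
  · intro x u hu v hv
    have hd : DifferentiableAt ℝ (fderiv ℝ Φ) x :=
      (hΦ2.fderiv_right (m := 1) (by norm_num)).differentiable (by simp) x
    have hmem : fderiv ℝ (fderiv ℝ Φ) x u v ∈ Q := by
      have h1 := mem_of_fderiv_mem Q (f := fun y => fderiv ℝ Φ y v) (x := x)
        (hd.clm_apply (differentiableAt_const v)) (fun y => hPQ y v hv) u
      rw [fderiv_clm_apply hd (differentiableAt_const v)] at h1
      simpa using h1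
    obtain ⟨z, hz, hzz⟩ := map_eq_of_injective _ (hinj x) (hPQ x) hdim _ hmem
    refine ⟨z, hz, fun w => ?_⟩
    rw [koszul_eq_inner isOpen_univ hΦ2.contDiffOn hh' (Set.mem_univ x), hh, pullbackInner_apply,
      hzz]
  · obtain ⟨x, rfl⟩ := QuotientAddGroup.mk_surjective p
    rw [hh, pullbackInner_apply, pullbackInner_apply]
    exact hconf x u v

end pullback

section frames

variable {n : ℕ} {P : Submodule ℝ (Euc n)}

/-- A basis of a plane together with linear coordinates on the whole space extending the
dual basis. -/
structure PlaneFrame (P : Submodule ℝ (Euc n)) where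
  e₁ : P
  e₂ : P
  c₁ : Euc n →L[ℝ] ℝ
  c₂ : Euc n →L[ℝ] ℝ
  c₁_e₁ : c₁ e₁ = 1
  c₁_e₂ : c₁ e₂ = 0
  c₂_e₁ : c₂ e₁ = 0
  c₂_e₂ : c₂ e₂ = 1
  decomp : ∀ u : P, u = c₁ u • e₁ + c₂ u • e₂

/-- The frame with the two vectors interchanged. -/
def PlaneFrame.swap (f : PlaneFrame P) : PlaneFrame P where
  e₁ := f.e₂
  e₂ := f.e₁
  c₁ := f.c₂
  c₂ := f.c₁
  c₁_e₁ := f.c₂_e₂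
  c₁_e₂ := f.c₂_e₁
  c₂_e₁ := f.c₁_e₂
  c₂_e₂ := f.c₁_e₁
  decomp u := (f.decomp u).trans (add_comm _ _)

/-- The vector of the graph `x_j = a_j`, `j ≠ i₁, i₂`, with the coordinates `x_{i₁} = 1` and
`x_{i₂} = 0`. -/
noncomputable def graphVec (i₁ i₂ : Fin n) (a : Fin n → ℝ) : Euc n :=
  WithLp.toLp 2 fun j => if j = i₁ then 1 else if j = i₂ then 0 else a j

theorem freq_graphVec {i₁ i₂ : Fin n} (hi : i₁ ≠ i₂) (a : Fin n → ℝ) (m : Fin n → ℤ) :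
    freq m (graphVec i₁ i₂ a) =
      (m i₁ : ℝ) + ∑ j ∈ ({i₁, i₂}ᶜ : Finset (Fin n)), a j * m j := by
  rw [freq_apply, ← Finset.sum_add_sum_compl {i₁, i₂}, Finset.sum_pair hi]
  congr 1
  · simp [graphVec, hi.symm]
  · refine Finset.sum_congr rfl fun j hj => ?_
    simp only [Finset.mem_compl, Finset.mem_insert, Finset.mem_singleton, not_or] at hj
    simp [graphVec, hj.1, hj.2, mul_comm]

/-- The frame of a plane that is a graph over two of the coordinates. -/
noncomputable def graphFrame {i₁ i₂ : Fin n} {a₁ a₂ : Fin n → ℝ} (hi : i₁ ≠ i₂)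
    (hP : ∀ x : Euc n, x ∈ P ↔ ∀ j, j ≠ i₁ → j ≠ i₂ → a₁ j * x i₁ + a₂ j * x i₂ - x j = 0) :
    PlaneFrame P where
  e₁ := ⟨graphVec i₁ i₂ a₁, (hP _).2 fun j h1 h2 => by simp [graphVec, h1, h2, hi.symm]⟩
  e₂ := ⟨graphVec i₂ i₁ a₂, (hP _).2 fun j h1 h2 => by simp [graphVec, h1, h2, hi]⟩
  c₁ := EuclideanSpace.proj i₁
  c₂ := EuclideanSpace.proj i₂
  c₁_e₁ := by simp [graphVec]
  c₁_e₂ := by simp [graphVec, hi]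
  c₂_e₁ := by simp [graphVec, hi.symm]
  c₂_e₂ := by simp [graphVec]
  decomp u := by
    ext j
    have h := (hP u).1 u.2 j
    by_cases h1 : j = i₁
    · subst h1; simp [graphVec, hi]
    by_cases h2 : j = i₂
    · subst h2; simp [graphVec, hi.symm]
    have := h h1 h2
    simp [graphVec, h1, h2]
    linarith

theorem norm_symbar_ge (e₁ e₂ : Euc n) (m : Fin n → ℤ) :
    (|freq m e₁| + |freq m e₂|) / 4 ≤ ‖symbar e₁ e₂ m‖ := by
  have h1 : ‖symbar e₁ e₂ m‖ = ‖(freq m e₁ : ℂ) + Complex.I * freq m e₂‖ / 2 := by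
    simp [symbar]
  have h2 := Complex.abs_re_le_norm ((freq m e₁ : ℂ) + Complex.I * freq m e₂)
  have h3 := Complex.abs_im_le_norm ((freq m e₁ : ℂ) + Complex.I * freq m e₂)
  simp at h2 h3
  rw [h1]
  linarith

theorem one_le_sum_abs {m : Fin n → ℤ} (hm : m ≠ 0) : 1 ≤ ∑ j, |(m j : ℝ)| := by
  obtain ⟨j, hj⟩ := Function.ne_iff.1 hm
  have h1 : (1 : ℝ) ≤ |(m j : ℝ)| := by
    have : (1 : ℤ) ≤ |m j| := Int.one_le_abs hj
    exact_mod_cast this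
  exact h1.trans (Finset.single_le_sum (f := fun j => |(m j : ℝ)|) (fun _ _ => abs_nonneg _)
    (Finset.mem_univ j))

theorem sum_abs_le_weight (m : Fin n → ℤ) : ∑ j, |(m j : ℝ)| ≤ n * weight m := by
  have := Finset.sum_le_sum fun (j : Fin n) (_ : j ∈ Finset.univ) => abs_le_weight m j
  simpa using this

theorem diophantine_symbar {e₁ e₂ : Euc n} {C s : ℝ} (hC : 0 < C)
    (h : ∀ m : Fin n → ℤ, m ≠ 0 →
      C / (∑ j, |(m j : ℝ)|) ^ s < |freq m e₁| + |freq m e₂|) :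
    (∀ m, m ≠ 0 → symbar e₁ e₂ m ≠ 0) ∧ PolyBounded fun m => (symbar e₁ e₂ m)⁻¹ := by
  have key : ∀ m : Fin n → ℤ, m ≠ 0 → C / (4 * (n * weight m) ^ ⌈s⌉₊) < ‖symbar e₁ e₂ m‖ := by
    intro m hm
    refine lt_of_le_of_lt ?_ ((div_lt_div_of_pos_right (h m hm) (by norm_num : (0:ℝ) < 4)).trans_le
      (norm_symbar_ge e₁ e₂ m))
    have h1 := one_le_sum_abs hm
    rw [div_div, mul_comm (4 : ℝ)]
    have h2 : (∑ j, |(m j : ℝ)|) ^ s ≤ (n * weight m) ^ ⌈s⌉₊ := by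
      calc (∑ j, |(m j : ℝ)|) ^ s ≤ (∑ j, |(m j : ℝ)|) ^ (⌈s⌉₊ : ℝ) :=
            Real.rpow_le_rpow_of_exponent_le h1 (Nat.le_ceil s)
        _ = (∑ j, |(m j : ℝ)|) ^ ⌈s⌉₊ := Real.rpow_natCast _ _
        _ ≤ _ := by gcongr; exact sum_abs_le_weight m
    have h3 : 0 < (∑ j, |(m j : ℝ)|) ^ s := Real.rpow_pos_of_pos (by linarith) s
    gcongr
  have hpos : ∀ m : Fin n → ℤ, m ≠ 0 → 0 < (n : ℝ) * weight m := fun m hm =>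
    lt_of_lt_of_le (by linarith [one_le_sum_abs hm]) (sum_abs_le_weight m)
  have hpos' : ∀ m : Fin n → ℤ, m ≠ 0 → 0 < C / (4 * (n * weight m) ^ ⌈s⌉₊) := fun m hm => by
    have := hpos m hm
    positivity
  refine ⟨fun m hm h0 => ?_, 4 * (n : ℝ) ^ ⌈s⌉₊ / C, ⌈s⌉₊, fun m => ?_⟩
  · have := (hpos' m hm).trans (key m hm)
    rw [h0, norm_zero] at this
    exact lt_irrefl _ this
  · have hw := weight_pos m
    by_cases hm : m = 0
    · subst hm
      simp only [symbar_zero, inv_zero, norm_zero]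
      have := weight_pos (0 : Fin n → ℤ)
      positivity
    · rw [norm_inv]
      have := inv_anti₀ (hpos' m hm) (key m hm).le
      refine this.trans_eq ?_
      rw [inv_div, mul_pow]
      ring

end frames

section leafStructure

variable {n : ℕ} {P : Submodule ℝ (Euc n)} {J : StdTorus n → P →ₗ[ℝ] P}

theorem IsLeafComplexStructure.coeff (hJ : IsLeafComplexStructure P J) (f : PlaneFrame P)
    (p : StdTorus n) :
    f.c₂ (J p f.e₁) ≠ 0 ∧ f.c₂ (J p f.e₁) * f.c₁ (J p f.e₂) = -(1 + f.c₁ (J p f.e₁) ^ 2) := by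
  have h1 := hJ.sq p f.e₁
  have h2 : J p (J p f.e₁) = f.c₁ (J p f.e₁) • J p f.e₁ + f.c₂ (J p f.e₁) • J p f.e₂ := by
    conv_lhs => rw [f.decomp (J p f.e₁)]
    simp
  rw [h1] at h2
  have h3 := congrArg (fun u : P => f.c₁ u) h2
  simp [f.c₁_e₁] at h3
  have h4 : f.c₂ (J p f.e₁) * f.c₁ (J p f.e₂) = -(1 + f.c₁ (J p f.e₁) ^ 2) := by linarith
  refine ⟨fun h0 => ?_, h4⟩
  rw [h0] at h4
  nlinarith [sq_nonneg (f.c₁ (J p f.e₁))]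

theorem continuous_coe_quotient : Continuous fun x : Euc n => (x : StdTorus n) :=
  continuous_quot_mk

theorem IsLeafComplexStructure.continuous_coord (hJ : IsLeafComplexStructure P J)
    (c : Euc n →L[ℝ] ℝ) (u : P) : Continuous fun x : Euc n => c (J (x : StdTorus n) u) :=
  c.continuous.comp ((hJ.continuous u).comp continuous_coe_quotient)

/-- A continuous function without zeros on a real vector space has a constant sign. -/
theorem pos_or_neg_of_ne_zero {E : Type*} [NormedAddCommGroup E] [NormedSpace ℝ E] {b : E → ℝ}
    (hb : Continuous b) (h : ∀ x, b x ≠ 0) : (∀ x, 0 < b x) ∨ ∀ x, b x < 0 := by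
  by_contra hcon
  push Not at hcon
  obtain ⟨⟨x, hx⟩, y, hy⟩ := hcon
  obtain ⟨z, hz⟩ := mem_range_of_exists_le_of_exists_ge hb ⟨x, hx⟩ ⟨y, hy⟩
  exact h z hz

theorem IsLeafComplexStructure.exists_positive_frame (hJ : IsLeafComplexStructure P J)
    (f : PlaneFrame P) :
    (∀ p, 0 < f.c₂ (J p f.e₁)) ∨ ∀ p, 0 < f.swap.c₂ (J p f.swap.e₁) := by
  rcases pos_or_neg_of_ne_zero (hJ.continuous_coord f.c₂ f.e₁)
    (fun x => (hJ.coeff f x).1) with h | h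
  · left
    intro p
    obtain ⟨x, rfl⟩ := QuotientAddGroup.mk_surjective p
    exact h x
  · right
    intro p
    obtain ⟨x, rfl⟩ := QuotientAddGroup.mk_surjective p
    have h1 := (hJ.coeff f x).2
    have h2 := h x
    change 0 < f.c₁ (J (x : StdTorus n) f.e₂)
    by_contra h3
    push Not at h3
    nlinarith [sq_nonneg (f.c₁ (J (x : StdTorus n) f.e₁)), mul_nonneg_of_nonpos_of_nonpos h2.le h3]

theorem IsLeafConformal.contDiff_coeff {k : WithTop ℕ∞} {g : BilinField n}
    (hg : IsRiemannianMetric k g) (hJ : IsLeafComplexStructure P J) (hgJ : IsLeafConformal P J g)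
    (f : PlaneFrame P) (hpos : ∀ p, 0 < f.c₂ (J p f.e₁)) :
    ContDiff ℝ k (fun x : Euc n => f.c₁ (J (x : StdTorus n) f.e₁)) ∧
    ContDiff ℝ k (fun x : Euc n => f.c₂ (J (x : StdTorus n) f.e₁)) := by
  set α : Euc n → ℝ := fun x => f.c₁ (J (x : StdTorus n) f.e₁)
  set β : Euc n → ℝ := fun x => f.c₂ (J (x : StdTorus n) f.e₁)
  set a : Euc n → ℝ := fun x => g (x : StdTorus n) f.e₁ f.e₁ with ha
  set b : Euc n → ℝ := fun x => g (x : StdTorus n) f.e₁ f.e₂ with hb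
  set c : Euc n → ℝ := fun x => g (x : StdTorus n) f.e₂ f.e₂ with hc
  have hsm : ∀ u v : Euc n, ContDiff ℝ k fun x : Euc n => g (x : StdTorus n) u v := fun u v =>
    (hg.contDiff.clm_apply contDiff_const).clm_apply contDiff_const
  have ha' : ContDiff ℝ k a := hsm _ _
  have hb' : ContDiff ℝ k b := hsm _ _
  have hc' : ContDiff ℝ k c := hsm _ _
  have he₁ : (f.e₁ : Euc n) ≠ 0 := fun h => by
    have := f.c₁_e₁
    rw [h, map_zero] at this
    exact zero_ne_one this
  have hapos : ∀ x, 0 < a x := fun x => hg.pos _ _ he₁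
  have hJe : ∀ x : Euc n, ((J (x : StdTorus n) f.e₁ : P) : Euc n) =
      α x • (f.e₁ : Euc n) + β x • (f.e₂ : Euc n) := fun x => by
    conv_lhs => rw [f.decomp (J (x : StdTorus n) f.e₁)]
    rfl
  have e1 : ∀ x, α x * a x + β x * b x = 0 := fun x => by
    have h1 := hgJ x (J (x : StdTorus n) f.e₁) f.e₁
    rw [hJ.sq, hg.symm _ _ (f.e₁ : Euc n)] at h1
    rw [Submodule.coe_neg, map_neg, neg_apply] at h1
    have h2 : g (x : StdTorus n) f.e₁ (J (x : StdTorus n) f.e₁) = 0 := by linarith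
    rw [hJe x] at h2
    simpa [ha, hb] using h2
  have e2 : ∀ x, α x ^ 2 * a x + 2 * α x * β x * b x + β x ^ 2 * c x = a x := fun x => by
    have h1 := hgJ x f.e₁ f.e₁
    rw [hJe x] at h1
    have h3 := hg.symm (x : StdTorus n) f.e₂ f.e₁
    simp [h3] at h1
    simp only [ha, hb, hc]
    linarith
  have e3 : ∀ x, β x ^ 2 * (a x * c x - b x ^ 2) = a x ^ 2 := fun x => by
    linear_combination a x * e2 x - (α x * a x + β x * b x) * e1 x
  have hd : ∀ x, 0 < a x * c x - b x ^ 2 := fun x => by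
    have := e3 x
    have h1 : 0 < a x ^ 2 := by have := hapos x; positivity
    have h2 : 0 < β x ^ 2 := by have : 0 < β x := hpos _; positivity
    by_contra h
    push Not at h
    nlinarith
  have hβ : β = fun x => a x / Real.sqrt (a x * c x - b x ^ 2) := funext fun x => by
    have h1 : β x * Real.sqrt (a x * c x - b x ^ 2) = a x := by
      have h2 : 0 ≤ β x := (hpos _).le
      have h3 := Real.sq_sqrt (hd x).le
      have h4 : (β x * Real.sqrt (a x * c x - b x ^ 2)) ^ 2 = a x ^ 2 := by
        rw [mul_pow, h3, e3]
      exact (pow_left_inj₀ (by positivity) (hapos x).le two_ne_zero).1 h4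
    rw [eq_div_iff (Real.sqrt_pos.2 (hd x)).ne', h1]
  have hβ' : ContDiff ℝ k β := by
    rw [hβ]
    exact ha'.div (((ha'.mul hc').sub (hb'.pow 2)).sqrt fun x => (hd x).ne')
      fun x => (Real.sqrt_pos.2 (hd x)).ne'
  have hα : α = fun x => -(β x * b x) / a x := funext fun x => by
    rw [eq_div_iff (hapos x).ne']
    linarith [e1 x]
  refine ⟨?_, hβ'⟩
  rw [hα]
  exact ((hβ'.mul hb').neg).div ha' fun x => (hapos x).ne'

end leafStructure

section diophantine

variable {n : ℕ} {P : Submodule ℝ (Euc n)} {J : StdTorus n → P →ₗ[ℝ] P}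

/-- A holomorphic leafwise coordinate with periodic derivative gives an adapted metric. -/
theorem hasAdaptedEuclideanMetric_of_coordinate {k : WithTop ℕ∞} (hk : k = ∞ ∨ k = ω)
    (hP : Module.finrank ℝ P = 2) (W : Euc n → ℂ) (hW : ContDiff ℝ k W)
    (hper : LatticePeriodic (fderiv ℝ W))
    (hinj : ∀ x, ∀ u ∈ P, fderiv ℝ W x u = 0 → u = 0)
    (hWJ : ∀ (x : Euc n) (u : P),
      fderiv ℝ W x (J (x : StdTorus n) u) = Complex.I * fderiv ℝ W x u) :
    HasAdaptedEuclideanMetric k P J := by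
  have hdim : Module.finrank ℝ P = Module.finrank ℝ ℂ := by rw [hP, Complex.finrank_real_complex]
  let ι₀ : ℂ ≃ₗᵢ[ℝ] P := (stdOrthonormalBasis ℝ ℂ).equiv (stdOrthonormalBasis ℝ P)
    (finCongr hdim.symm)
  let ι : ℂ →L[ℝ] Euc n := P.subtypeL.comp (ι₀.toContinuousLinearEquiv : ℂ →L[ℝ] P)
  have hι : ∀ z, ι z = (ι₀ z : Euc n) := fun z => rfl
  have hιP : ∀ z, ι z ∈ P := fun z => (ι₀ z).2
  let Φ : Euc n → Euc n := fun x => ι (W x) + Pᗮ.starProjection x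
  have h0k : k ≠ 0 := by rcases hk with rfl | rfl <;> simp
  have hWd := hW.differentiable h0k
  have hD : ∀ x, fderiv ℝ Φ x = ι.comp (fderiv ℝ W x) + Pᗮ.starProjection := fun x =>
    ((ι.hasFDerivAt.comp x (hWd x).hasFDerivAt).add Pᗮ.starProjection.hasFDerivAt).fderiv
  have hPproj : ∀ u ∈ P, Pᗮ.starProjection u = 0 := fun u hu => by
    rw [Submodule.starProjection_apply_eq_zero_iff, Submodule.orthogonal_orthogonal]
    exact hu
  have hDP : ∀ x, ∀ u ∈ P, fderiv ℝ Φ x u = ι (fderiv ℝ W x u) := fun x u hu => by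
    rw [hD, add_apply, hPproj u hu, add_zero]
    rfl
  refine hasAdaptedEuclideanMetric_of_map hk J Φ ?_ ?_ (fun x => ?_) (Q := P) (fun x u hu => ?_)
    rfl (fun x u v => ?_)
  · exact (ι.contDiff.comp hW).add Pᗮ.starProjection.contDiff
  · intro x γ hγ
    rw [hD, hD, hper x γ hγ]
  · rw [injective_iff_map_eq_zero]
    intro u hu
    have h1 : Pᗮ.starProjection u = 0 := by
      have h2 : Pᗮ.starProjection (fderiv ℝ Φ x u) = 0 := by rw [hu, map_zero]
      rw [hD, add_apply, map_add, Submodule.starProjection_eq_self_iff.2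
        (Submodule.starProjection_apply_mem _ u)] at h2
      rwa [ContinuousLinearMap.comp_apply, hPproj _ (hιP _), zero_add] at h2
    have hu' : u ∈ P := by
      rwa [Submodule.starProjection_apply_eq_zero_iff, Submodule.orthogonal_orthogonal] at h1
    rw [hDP x u hu', hι] at hu
    have h3 : ι₀ (fderiv ℝ W x u) = 0 := Subtype.ext hu
    exact hinj x u hu' (by simpa using h3)
  · rw [hDP x u hu]
    exact hιP _
  · rw [hDP x _ (J _ u).2, hDP x _ (J _ v).2, hDP x _ u.2, hDP x _ v.2, hWJ, hWJ]
    simp only [hι]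
    rw [← Submodule.coe_inner, ← Submodule.coe_inner, ι₀.inner_map_map, ι₀.inner_map_map]
    simp only [Complex.inner, map_mul, Complex.conj_I]
    congr 1
    linear_combination (-(starRingEnd ℂ) (fderiv ℝ W x u) * fderiv ℝ W x v) * Complex.I_mul_I

theorem beltrami_coefficient {α β : ℝ} (hβ : 0 < β) {μ : ℂ}
    (hμ : μ = (Complex.I - α - Complex.I * β) / (α - Complex.I * β - Complex.I)) :
    (α - Complex.I * β - Complex.I : ℂ) ≠ 0 ∧
    ‖μ‖ < 1 ∧ α * (1 + μ) + Complex.I * β * (1 - μ) = Complex.I * (1 + μ) := by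
  have h0 : (α - Complex.I * β - Complex.I : ℂ) ≠ 0 := fun h => by
    have := congrArg Complex.im h
    simp at this
    linarith
  refine ⟨h0, ?_, ?_⟩
  · rw [hμ, norm_div, div_lt_one (norm_pos_iff.2 h0), ← sq_lt_sq₀ (norm_nonneg _) (norm_nonneg _),
      Complex.sq_norm, Complex.sq_norm, Complex.normSq_apply, Complex.normSq_apply]
    simp
    nlinarith
  · rw [hμ]
    field_simp
    ring

theorem hasAdaptedEuclideanMetric_of_frame {k : WithTop ℕ∞} (hk : k = ∞ ∨ k = ω)
    (hP : Module.finrank ℝ P = 2) {g : BilinField n}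
    (hg : IsRiemannianMetric k g) (hJ : IsLeafComplexStructure P J) (hgJ : IsLeafConformal P J g)
    (f : PlaneFrame P) (hpos : ∀ p, 0 < f.c₂ (J p f.e₁))
    (hne : ∀ m, m ≠ 0 → symbar (f.e₁ : Euc n) f.e₂ m ≠ 0)
    (hpoly : PolyBounded fun m => (symbar (f.e₁ : Euc n) f.e₂ m)⁻¹) :
    HasAdaptedEuclideanMetric k P J := by
  obtain ⟨hα, hβ⟩ := hgJ.contDiff_coeff hg hJ f hpos
  set α : Euc n → ℝ := fun x => f.c₁ (J (x : StdTorus n) f.e₁) with hαd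
  set β : Euc n → ℝ := fun x => f.c₂ (J (x : StdTorus n) f.e₁) with hβd
  have hβpos : ∀ x, 0 < β x := fun x => hpos _
  set ν : Euc n → ℂ := fun x =>
    (Complex.I - α x - Complex.I * β x) / (α x - Complex.I * β x - Complex.I) with hν
  have hb := fun x => beltrami_coefficient (hβpos x) (μ := ν x) rfl
  have hνc : ContDiff ℝ k ν := by
    have hα' : ContDiff ℝ k fun x => (α x : ℂ) := Complex.ofRealCLM.contDiff.comp hα
    have hβ' : ContDiff ℝ k fun x => (β x : ℂ) := Complex.ofRealCLM.contDiff.comp hβ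
    have h1 := (((contDiff_const (c := Complex.I)).sub hα').sub
      ((contDiff_const (c := Complex.I)).mul hβ')).mul
      (((hα'.sub ((contDiff_const (c := Complex.I)).mul hβ')).sub
        (contDiff_const (c := Complex.I))).inv fun x => (hb x).1)
    simp only [hν, div_eq_mul_inv]
    exact h1
  have hνp : LatticePeriodic ν := latticePeriodic_comp_coe fun p : StdTorus n =>
    ((Complex.I - f.c₁ (J p f.e₁) - Complex.I * f.c₂ (J p f.e₁)) /
      (f.c₁ (J p f.e₁) - Complex.I * f.c₂ (J p f.e₁) - Complex.I) : ℂ)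
  have hμ : ∀ x, descend ν hνc.continuous hνp (toTorus n x) = ν x :=
    descend_apply ν hνc.continuous hνp
  have hμ1 : ‖descend ν hνc.continuous hνp‖ < 1 := by
    rw [ContinuousMap.norm_lt_iff _ zero_lt_one]
    intro t
    obtain ⟨x, rfl⟩ := toTorus_surjective t
    rw [hμ]
    exact (hb x).2.1
  obtain ⟨W, hW, hWp, hWe⟩ := exists_uniformizing_function hk (f.e₁ : Euc n) f.e₂
    (Complex.ofRealCLM.comp f.c₁ + Complex.I • Complex.ofRealCLM.comp f.c₂)
    (by simp [f.c₁_e₁, f.c₂_e₁]) (by simp [f.c₁_e₂, f.c₂_e₂]) hne hpoly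
    (descend ν hνc.continuous hνp) (by simp only [hμ]; exact hνc) hμ1
  simp only [hμ] at hWe
  have hW1 : ∀ x, fderiv ℝ W x f.e₁ = dz (f.e₁ : Euc n) f.e₂ W x * (1 + ν x) := fun x => by
    have h2 := (hWe x).2
    rw [mul_one_add, mul_comm _ (ν x), ← h2]
    simp only [dz, dzbar]
    ring
  have hW2 : ∀ x, fderiv ℝ W x f.e₂ = Complex.I * dz (f.e₁ : Euc n) f.e₂ W x * (1 - ν x) :=
    fun x => by
    have h2 := (hWe x).2
    rw [mul_assoc, mul_one_sub, mul_comm _ (ν x), ← h2]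
    simp only [dz, dzbar]
    linear_combination (fderiv ℝ W x f.e₂) * Complex.I_sq
  have hdec : ∀ (x : Euc n) (u : P), fderiv ℝ W x u =
      f.c₁ u * fderiv ℝ W x f.e₁ + f.c₂ u * fderiv ℝ W x f.e₂ := fun x u => by
    conv_lhs => rw [f.decomp u]
    simp
  refine hasAdaptedEuclideanMetric_of_coordinate hk hP W hW hWp (fun x u hu h0 => ?_)
    (fun x u => ?_)
  · have h1 := hdec x ⟨u, hu⟩
    simp only at h1
    rw [h0, hW1, hW2] at h1
    have h2 : ((f.c₁ u : ℂ) + Complex.I * f.c₂ u) + ν x * (f.c₁ u - Complex.I * f.c₂ u) = 0 := by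
      have h3 : dz (f.e₁ : Euc n) f.e₂ W x * (((f.c₁ u : ℂ) + Complex.I * f.c₂ u) +
          ν x * (f.c₁ u - Complex.I * f.c₂ u)) = 0 := by linear_combination -h1
      exact (mul_eq_zero.1 h3).resolve_left (hWe x).1
    have h4 : ‖(f.c₁ u : ℂ) - Complex.I * f.c₂ u‖ = ‖(f.c₁ u : ℂ) + Complex.I * f.c₂ u‖ := by
      rw [← RCLike.norm_conj]
      simp
    have h5 : ‖(f.c₁ u : ℂ) + Complex.I * f.c₂ u‖ =
        ‖ν x‖ * ‖(f.c₁ u : ℂ) + Complex.I * f.c₂ u‖ := by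
      conv_lhs => rw [eq_neg_of_add_eq_zero_left h2]
      rw [norm_neg, norm_mul, h4]
    have h6 : ‖(f.c₁ u : ℂ) + Complex.I * f.c₂ u‖ = 0 := by
      have := (hb x).2.1
      have := norm_nonneg ((f.c₁ u : ℂ) + Complex.I * f.c₂ u)
      nlinarith
    rw [norm_eq_zero] at h6
    have h7 := congrArg Complex.re h6
    have h8 := congrArg Complex.im h6
    simp at h7 h8
    have h9 := f.decomp ⟨u, hu⟩
    simp only [h7, h8, zero_smul, add_zero] at h9
    exact congrArg Subtype.val h9
  · have hβ0 : (β x : ℂ) ≠ 0 := by exact_mod_cast (hβpos x).ne'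
    have key : fderiv ℝ W x (J (x : StdTorus n) f.e₁) = Complex.I * fderiv ℝ W x f.e₁ := by
      rw [hdec, hW1, hW2]
      linear_combination (dz (f.e₁ : Euc n) f.e₂ W x) * (hb x).2.2
    have hJ1 : fderiv ℝ W x (J (x : StdTorus n) f.e₁) =
      α x * fderiv ℝ W x f.e₁ + β x * fderiv ℝ W x f.e₂ := hdec x _
    have hJJ : fderiv ℝ W x (J (x : StdTorus n) (J (x : StdTorus n) f.e₁)) =
        - fderiv ℝ W x f.e₁ := by
      rw [hJ.sq, Submodule.coe_neg, map_neg]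
    have hJ2 : fderiv ℝ W x (J (x : StdTorus n) (J (x : StdTorus n) f.e₁)) =
        α x * fderiv ℝ W x (J (x : StdTorus n) f.e₁) +
        β x * fderiv ℝ W x (J (x : StdTorus n) f.e₂) := by
      conv_lhs => rw [f.decomp (J (x : StdTorus n) f.e₁)]
      simp [hαd, hβd]
    have key2 : fderiv ℝ W x (J (x : StdTorus n) f.e₂) = Complex.I * fderiv ℝ W x f.e₂ := by
      apply mul_left_cancel₀ hβ0
      rw [hJJ, key] at hJ2
      rw [key] at hJ1
      linear_combination (-1 : ℂ) * hJ2 + Complex.I * hJ1 - fderiv ℝ W x f.e₁ * Complex.I_sq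
    rw [hdec x u, mul_add]
    conv_lhs => rw [f.decomp u]
    simp only [map_add, map_smul, Submodule.coe_add, Submodule.coe_smul, key, key2]
    simp only [Complex.real_smul]
    ring

/-- Existence of an adapted metric for Diophantine foliations. -/
theorem hasAdaptedEuclideanMetric_of_isDiophantine {k : WithTop ℕ∞} (hk : k = ∞ ∨ k = ω)
    (hP : Module.finrank ℝ P = 2) (hD : IsDiophantine P) {g : BilinField n}
    (hg : IsRiemannianMetric k g) (hJ : IsLeafComplexStructure P J)
    (hgJ : IsLeafConformal P J g) : HasAdaptedEuclideanMetric k P J := by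
  obtain ⟨i₁, i₂, a₁, a₂, hi, hPg, C, s, hC, -, hm⟩ := hD
  have hpair : ({i₂, i₁} : Finset (Fin n)) = {i₁, i₂} := Finset.pair_comm _ _
  have h1 : ∀ m : Fin n → ℤ, m ≠ 0 → C / (∑ j, |(m j : ℝ)|) ^ s <
      |freq m ((graphFrame hi hPg).e₁ : Euc n)| + |freq m ((graphFrame hi hPg).e₂ : Euc n)| := by
    intro m hm0
    have := hm m hm0
    rwa [← freq_graphVec hi, ← hpair, ← freq_graphVec hi.symm] at this
  rcases hJ.exists_positive_frame (graphFrame hi hPg) with h | h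
  · obtain ⟨h2, h3⟩ := diophantine_symbar hC h1
    exact hasAdaptedEuclideanMetric_of_frame hk hP hg hJ hgJ _ h h2 h3
  · obtain ⟨h2, h3⟩ := diophantine_symbar (e₁ := ((graphFrame hi hPg).swap.e₁ : Euc n))
      (e₂ := ((graphFrame hi hPg).swap.e₂ : Euc n)) hC
      (fun m hm0 => (h1 m hm0).trans_eq (add_comm _ _))
    exact hasAdaptedEuclideanMetric_of_frame hk hP hg hJ hgJ _ h h2 h3

end diophantine

section lattice

variable {n : ℕ}

/-- The basis `2πe_i` of the period lattice. -/
noncomputable def latticeBasis (n : ℕ) : Module.Basis (Fin n) ℝ (Euc n) :=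
  (EuclideanSpace.basisFun (Fin n) ℝ).toBasis.isUnitSMul
    (w := fun _ => 2 * Real.pi) fun _ => (by positivity : (2 * Real.pi) ≠ 0).isUnit

theorem latticeBasis_apply (i : Fin n) :
    latticeBasis n i = (2 * Real.pi) • EuclideanSpace.single i (1 : ℝ) := by
  simp [latticeBasis, Module.Basis.isUnitSMul_apply]

theorem mem_periodLattice_iff (x : Euc n) :
    x ∈ periodLattice n ↔ x ∈ Submodule.span ℤ (Set.range (latticeBasis n)) := by
  rw [Module.Basis.mem_span_iff_repr_mem]
  have h1 : ∀ i, x i = 2 * Real.pi * (latticeBasis n).repr x i := fun i => by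
    conv_lhs => rw [← (latticeBasis n).sum_repr x]
    simp [latticeBasis_apply, Pi.single_apply, mul_comm]
  have hpi : (2 * Real.pi) ≠ 0 := by positivity
  refine forall_congr' fun i => ?_
  rw [h1 i]
  constructor
  · rintro ⟨m, hm⟩
    exact ⟨m, (mul_left_cancel₀ hpi hm).symm⟩
  · rintro ⟨m, hm⟩
    exact ⟨m, by rw [← hm]; rfl⟩

theorem latticeBasis_mem (i : Fin n) : latticeBasis n i ∈ periodLattice n :=
  (mem_periodLattice_iff _).2 (Submodule.subset_span ⟨i, rfl⟩)

theorem discreteTopology_of_mem_iff_span {ι : Type*} [Finite ι] (b : Module.Basis ι ℝ (Euc n))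
    (G : AddSubgroup (Euc n)) (hG : ∀ x, x ∈ G ↔ x ∈ Submodule.span ℤ (Set.range b)) :
    DiscreteTopology G ∧ Module.finrank ℤ G = n := by
  have h : G = (Submodule.span ℤ (Set.range b)).toAddSubgroup := by
    ext x
    rw [hG]
    rfl
  subst h
  refine ⟨(inferInstance : DiscreteTopology (Submodule.span ℤ (Set.range b))), ?_⟩
  have h2 : Module.finrank ℤ (Submodule.span ℤ (Set.range b)) = Module.finrank ℝ (Euc n) :=
    ZLattice.rank ℝ _
  rw [finrank_euclideanSpace_fin] at h2
  exact h2

theorem eq_of_forall_mem_discrete (G : AddSubgroup (Euc n)) [DiscreteTopology G]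
    {f : Euc n → Euc n} (hf : Continuous f) (hG : ∀ x, f x ∈ G) (x y : Euc n) : f x = f y := by
  have h : Continuous fun x => (⟨f x, hG x⟩ : G) := hf.subtype_mk hG
  exact congrArg Subtype.val (PreconnectedSpace.constant inferInstance h (x := x) (y := y))

end lattice

section linearModel

variable {n : ℕ} {P : Submodule ℝ (Euc n)} {J : StdTorus n → P →ₗ[ℝ] P}

theorem hasAdaptedEuclideanMetric_of_hasLinearModel {k : WithTop ℕ∞} (hk : k = ∞ ∨ k = ω)
    (hP : Module.finrank ℝ P = 2) (h : HasLinearModel k P J) :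
    HasAdaptedEuclideanMetric k P J := by
  obtain ⟨G, φ, Q, J₀, hG, -, hQ, -, -, hJ₀, hJ⟩ := h
  have h0k : k ≠ 0 := by rcases hk with rfl | rfl <;> simp
  have hper : LatticePeriodic (fderiv ℝ φ.lift) := fun x γ hγ => by
    have h1 : ∀ y, φ.lift (y + γ) - φ.lift y ∈ G := fun y => by
      rw [← neg_add_eq_sub, ← QuotientAddGroup.eq, φ.coe_lift, φ.coe_lift]
      congr 1
      rw [stdTorus_eq_iff]
      simpa using hγ
    have h2 := eq_of_forall_mem_discrete G
      ((φ.contDiff_lift.continuous.comp (continuous_add_const γ)).sub φ.contDiff_lift.continuous)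
      h1
    have h3 : (fun y => φ.lift (y + γ)) = fun y => φ.lift y + (φ.lift (0 + γ) - φ.lift 0) := by
      funext y
      have h4 : φ.lift (y + γ) - φ.lift y = φ.lift (0 + γ) - φ.lift 0 := h2 y 0
      rw [← h4]
      abel
    have h4 := congrArg (fun f => fderiv ℝ f x) h3
    simpa only [fderiv_comp_add_right, fderiv_add_const] using h4
  have hinj : ∀ x, Function.Injective (fderiv ℝ φ.lift x) := fun x => by
    have h1 : ∀ y, φ.invLift (φ.lift y) - y ∈ periodLattice n := fun y => by
      rw [← stdTorus_eq_iff, φ.coe_invLift, φ.coe_lift, Equiv.symm_apply_apply]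
    have := (discreteTopology_of_mem_iff_span (latticeBasis n) (periodLattice n)
      mem_periodLattice_iff).1
    have h2 := eq_of_forall_mem_discrete (periodLattice n)
      ((φ.contDiff_invLift.continuous.comp φ.contDiff_lift.continuous).sub continuous_id) h1
    have h3 : (fun y => φ.invLift (φ.lift y)) = fun y => y + (φ.invLift (φ.lift 0) - 0) := by
      funext y
      have : φ.invLift (φ.lift y) - y = φ.invLift (φ.lift 0) - 0 := h2 y 0
      rw [← this]
      simp
    have h4 := ((φ.contDiff_invLift.differentiable h0k (φ.lift x)).hasFDerivAt).comp x
      (φ.contDiff_lift.differentiable h0k x).hasFDerivAt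
    have h5 : HasFDerivAt (φ.invLift ∘ φ.lift) (ContinuousLinearMap.id ℝ (Euc n)) x := by
      have : φ.invLift ∘ φ.lift = _ := h3
      rw [this]
      exact (hasFDerivAt_id x).add_const _
    have h6 := h4.unique h5
    exact Function.LeftInverse.injective (g := fderiv ℝ φ.invLift (φ.lift x)) fun u =>
      congrArg (fun L : Euc n →L[ℝ] Euc n => L u) h6
  refine hasAdaptedEuclideanMetric_of_map hk J φ.lift φ.contDiff_lift hper hinj (Q := Q)
    (fun x u hu => ?_) (hQ.trans hP.symm) (fun x u v => ?_)
  · obtain ⟨w, hw, -⟩ := hJ x ⟨u, hu⟩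
    rw [← hw]
    exact w.2
  · obtain ⟨w, hw, hw'⟩ := hJ x u
    obtain ⟨z, hz, hz'⟩ := hJ x v
    rw [← hw, ← hw', ← hz, ← hz']
    exact hJ₀ w z

end linearModel

section rigidity

variable {n : ℕ} {h : BilinField n}

/-- A map that develops the metric `h` on the open set `U` into the Euclidean metric. -/
structure IsDevelopment (h : BilinField n) (U : Set (Euc n)) (φ : Euc n → Euc n) : Prop where
  isOpen : IsOpen U
  contDiffOn : ContDiffOn ℝ 2 φ U
  metric : ∀ y ∈ U, ∀ u v, h (y : StdTorus n) u v = ⟪fderiv ℝ φ y u, fderiv ℝ φ y v⟫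

namespace IsDevelopment

variable {U V : Set (Euc n)} {φ ψ : Euc n → Euc n}

theorem mono (hφ : IsDevelopment h U φ) (hV : IsOpen V) (hVU : V ⊆ U) : IsDevelopment h V φ :=
  ⟨hV, hφ.contDiffOn.mono hVU, fun y hy => hφ.metric y (hVU hy)⟩

theorem contDiffAt (hφ : IsDevelopment h U φ) {x : Euc n} (hx : x ∈ U) : ContDiffAt ℝ 2 φ x :=
  hφ.contDiffOn.contDiffAt (hφ.isOpen.mem_nhds hx)

theorem contDiffAt_fderiv (hφ : IsDevelopment h U φ) {x : Euc n} (hx : x ∈ U) :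
    ContDiffAt ℝ 1 (fderiv ℝ φ) x := (hφ.contDiffAt hx).fderiv_right (by norm_num)

theorem differentiableAt (hφ : IsDevelopment h U φ) {x : Euc n} (hx : x ∈ U) :
    DifferentiableAt ℝ φ x := (hφ.contDiffAt hx).differentiableAt (by simp)

theorem exists_equiv (hh : IsRiemannianMetric 2 h) (hφ : IsDevelopment h U φ) {x : Euc n}
    (hx : x ∈ U) : ∃ e : Euc n ≃L[ℝ] Euc n, fderiv ℝ φ x = e := by
  have hinj : Function.Injective (fderiv ℝ φ x) := by
    rw [injective_iff_map_eq_zero]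
    intro u hu
    by_contra h0
    have := hh.pos (x : StdTorus n) u h0
    rw [hφ.metric x hx, hu, inner_zero_left] at this
    exact lt_irrefl _ this
  refine ⟨(LinearEquiv.ofInjectiveEndo (fderiv ℝ φ x : Euc n →ₗ[ℝ] Euc n) hinj).toContinuousLinearEquiv,
    ?_⟩
  ext u
  rfl

theorem surjective (hh : IsRiemannianMetric 2 h) (hφ : IsDevelopment h U φ) {x : Euc n}
    (hx : x ∈ U) : Function.Surjective (fderiv ℝ φ x) := by
  obtain ⟨e, he⟩ := hφ.exists_equiv hh hx
  rw [he]
  exact e.surjective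

theorem congr (hφ : IsDevelopment h U φ) (hψ : ∀ x ∈ U, φ =ᶠ[𝓝 x] ψ) : IsDevelopment h U ψ :=
  ⟨hφ.isOpen, fun x hx => ((hφ.contDiffAt hx).congr_of_eventuallyEq
    (hψ x hx).symm).contDiffWithinAt, fun x hx u v => by
    rw [hφ.metric x hx, (hψ x hx).fderiv_eq]⟩

/-- Two developments differ by a Euclidean motion. -/
theorem rigid (hh : IsRiemannianMetric 2 h) (hU : IsPreconnected U) (hφ : IsDevelopment h U φ)
    (hψ : IsDevelopment h U ψ) {x₀ : Euc n} (hx₀ : x₀ ∈ U) :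
    ∃ (R : Euc n ≃ₗᵢ[ℝ] Euc n) (t : Euc n),
      (∀ u, fderiv ℝ ψ x₀ u = R (fderiv ℝ φ x₀ u)) ∧ ∀ y ∈ U, ψ y = R (φ y) + t := by
  set M : Euc n → Euc n →L[ℝ] Euc n := fun x => (fderiv ℝ ψ x).comp (fderiv ℝ φ x).inverse with hM
  have hMφ : ∀ x ∈ U, ∀ v, M x (fderiv ℝ φ x v) = fderiv ℝ ψ x v := fun x hx v => by
    obtain ⟨e, he⟩ := hφ.exists_equiv hh hx
    simp only [hM, he, ContinuousLinearMap.inverse_equiv, ContinuousLinearMap.comp_apply]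
    simp
  have hMinner : ∀ x ∈ U, ∀ a b, ⟪M x a, M x b⟫ = ⟪a, b⟫ := fun x hx a b => by
    obtain ⟨u, rfl⟩ := hφ.surjective hh hx a
    obtain ⟨v, rfl⟩ := hφ.surjective hh hx b
    rw [hMφ x hx, hMφ x hx, ← hφ.metric x hx, ← hψ.metric x hx]
  have hMd : ∀ x ∈ U, DifferentiableAt ℝ M x := fun x hx => by
    obtain ⟨e, he⟩ := hφ.exists_equiv hh hx
    have h1 : DifferentiableAt ℝ (fun y => (fderiv ℝ φ y).inverse) x := by
      have h2 := contDiffAt_map_inverse (𝕜 := ℝ) (n := 1) e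
      rw [← he] at h2
      exact (h2.comp x (hφ.contDiffAt_fderiv hx)).differentiableAt (by simp)
    exact ((hψ.contDiffAt_fderiv hx).differentiableAt (by simp)).clm_comp h1
  have hM0 : ∀ x ∈ U, fderiv ℝ M x = 0 := fun x hx => by
    ext1 u
    refine ContinuousLinearMap.ext fun a => ?_
    obtain ⟨v, rfl⟩ := hφ.surjective hh hx a
    have hd1 : DifferentiableAt ℝ (fderiv ℝ φ) x :=
      (hφ.contDiffAt_fderiv hx).differentiableAt (by simp)
    have hd2 : DifferentiableAt ℝ (fderiv ℝ ψ) x :=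
      (hψ.contDiffAt_fderiv hx).differentiableAt (by simp)
    have h1 := (hMd x hx).hasFDerivAt.clm_apply
      (hd1.hasFDerivAt.clm_apply (hasFDerivAt_const v x))
    have h2 := hd2.hasFDerivAt.clm_apply (hasFDerivAt_const v x)
    have h3 : (fun y => M y (fderiv ℝ φ y v)) =ᶠ[𝓝 x] fun y => fderiv ℝ ψ y v := by
      filter_upwards [hφ.isOpen.mem_nhds hx] with y hy
      exact hMφ y hy v
    have h4 := congrArg (fun L => L u) (h1.unique (h2.congr_of_eventuallyEq h3))
    simp at h4
    have h5 : ∀ b, ⟪fderiv ℝ M x u (fderiv ℝ φ x v), b⟫ = 0 := fun b => by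
      obtain ⟨w, rfl⟩ := hψ.surjective hh hx b
      rw [eq_sub_of_add_eq' h4, inner_sub_left, ← koszul_eq_inner hψ.isOpen hψ.contDiffOn hψ.metric
        hx, ← hMφ x hx, hMinner x hx, ← koszul_eq_inner hφ.isOpen hφ.contDiffOn hφ.metric hx,
        sub_self]
    have h6 := h5 (fderiv ℝ M x u (fderiv ℝ φ x v))
    rw [inner_self_eq_zero] at h6
    simpa using h6
  have hMc : ∀ x ∈ U, M x = M x₀ := fun x hx =>
    hφ.isOpen.is_const_of_fderiv_eq_zero (𝕜 := ℝ) hU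
      (fun y hy => (hMd y hy).differentiableWithinAt) hM0 hx hx₀
  let R₀ : Euc n →ₗᵢ[ℝ] Euc n := (M x₀ : Euc n →ₗ[ℝ] Euc n).isometryOfInner (hMinner x₀ hx₀)
  let R : Euc n ≃ₗᵢ[ℝ] Euc n := R₀.toLinearIsometryEquiv rfl
  have hR : ∀ a, R a = M x₀ a := fun a => rfl
  have hder : ∀ x ∈ U, ∀ u, fderiv ℝ ψ x u = R (fderiv ℝ φ x u) := fun x hx u => by
    rw [hR, ← hMc x hx, hMφ x hx]
  have hd : ∀ x ∈ U, HasFDerivAt (fun y => ψ y - R (φ y)) (0 : Euc n →L[ℝ] Euc n) x :=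
    fun x hx => by
    have h1 := (hψ.differentiableAt hx).hasFDerivAt.sub
      ((R.toContinuousLinearEquiv : Euc n →L[ℝ] Euc n).hasFDerivAt.comp x
        (hφ.differentiableAt hx).hasFDerivAt)
    have h2 : fderiv ℝ ψ x - (R.toContinuousLinearEquiv : Euc n →L[ℝ] Euc n).comp
        (fderiv ℝ φ x) = 0 := by
      ext1 u
      simp [hder x hx u]
    rw [h2] at h1
    exact h1
  refine ⟨R, ψ x₀ - R (φ x₀), hder x₀ hx₀, fun y hy => ?_⟩
  have h1 := hφ.isOpen.is_const_of_fderiv_eq_zero (𝕜 := ℝ) hU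
    (fun y hy => (hd y hy).differentiableAt.differentiableWithinAt)
    (fun y hy => (hd y hy).fderiv) hy hx₀
  rw [← h1]
  abel

/-- Composition with a Euclidean motion. -/
theorem motion (hφ : IsDevelopment h U φ) (R : Euc n ≃ₗᵢ[ℝ] Euc n) (t : Euc n) :
    IsDevelopment h U fun y => R (φ y) + t := by
  have hd : ∀ x ∈ U, fderiv ℝ (fun y => R (φ y) + t) x =
      (R.toContinuousLinearEquiv : Euc n →L[ℝ] Euc n).comp (fderiv ℝ φ x) := fun x hx =>
    (((R.toContinuousLinearEquiv : Euc n →L[ℝ] Euc n).hasFDerivAt.comp x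
      (hφ.differentiableAt hx).hasFDerivAt).add_const t).fderiv
  refine ⟨hφ.isOpen, ?_, fun y hy u v => ?_⟩
  · exact ((R.toContinuousLinearEquiv : Euc n →L[ℝ] Euc n).contDiff.comp_contDiffOn
      hφ.contDiffOn).add contDiffOn_const
  · rw [hφ.metric y hy, hd y hy]
    exact (R.inner_map_map _ _).symm

theorem eqOn_of_eqOn (hh : IsRiemannianMetric 2 h) (hU : IsPreconnected U)
    (hφ : IsDevelopment h U φ) (hψ : IsDevelopment h U ψ) (hV : IsOpen V) (hVU : V ⊆ U)
    (hne : V.Nonempty) (he : Set.EqOn φ ψ V) : Set.EqOn φ ψ U := by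
  obtain ⟨x₀, hx₀⟩ := hne
  obtain ⟨R, t, hR, hRt⟩ := hφ.rigid hh hU hψ (hVU hx₀)
  have hev : φ =ᶠ[𝓝 x₀] ψ := Filter.eventuallyEq_of_mem (hV.mem_nhds hx₀) he
  have hR1 : ∀ a, R a = a := fun a => by
    obtain ⟨u, rfl⟩ := hφ.surjective hh (hVU hx₀) a
    rw [← hR, hev.fderiv_eq]
  have ht : t = 0 := by
    have := hRt x₀ (hVU hx₀)
    rw [hR1, he hx₀] at this
    simpa using this
  intro y hy
  rw [hRt y hy, hR1, ht, add_zero]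

theorem glue {ι : Type*} (S : ι → Set (Euc n)) (ψ : ι → Euc n → Euc n)
    (hψ : ∀ i, IsDevelopment h (S i) (ψ i))
    (hc : ∀ i j, Set.EqOn (ψ i) (ψ j) (S i ∩ S j)) :
    ∃ Ψ, IsDevelopment h (⋃ i, S i) Ψ ∧ ∀ i, Set.EqOn Ψ (ψ i) (S i) := by
  classical
  let Ψ : Euc n → Euc n := fun y => if hy : ∃ i, y ∈ S i then ψ hy.choose y else 0
  have hΨ : ∀ i, Set.EqOn Ψ (ψ i) (S i) := fun i y hy => by
    have hy' : ∃ i, y ∈ S i := ⟨i, hy⟩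
    simp only [Ψ, dif_pos hy']
    exact hc _ _ ⟨hy'.choose_spec, hy⟩
  have hev : ∀ i, ∀ x ∈ S i, ψ i =ᶠ[𝓝 x] Ψ := fun i x hx =>
    Filter.eventuallyEq_of_mem ((hψ i).isOpen.mem_nhds hx) (hΨ i).symm
  refine ⟨Ψ, ⟨isOpen_iUnion fun i => (hψ i).isOpen, fun x hx => ?_, fun x hx => ?_⟩, hΨ⟩
  · obtain ⟨i, hi⟩ := Set.mem_iUnion.1 hx
    exact (((hψ i).congr (hev i)).contDiffAt hi).contDiffWithinAt
  · obtain ⟨i, hi⟩ := Set.mem_iUnion.1 hx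
    exact ((hψ i).congr (hev i)).metric x hi

end IsDevelopment

end rigidity

section development

variable {n : ℕ} {h : BilinField n}

theorem exists_bounded_representative (n : ℕ) :
    ∃ R : ℝ, ∀ x : Euc n, ∃ γ ∈ periodLattice n, ‖x + γ‖ ≤ R := by
  refine ⟨∑ i, ‖latticeBasis n i‖, fun x => ⟨-(ZSpan.floor (latticeBasis n) x : Euc n), ?_, ?_⟩⟩
  · exact neg_mem ((mem_periodLattice_iff _).2 (ZSpan.floor (latticeBasis n) x).2)
  · rw [← sub_eq_add_neg]
    exact ZSpan.norm_fract_le (K := ℝ) (latticeBasis n) x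

theorem LatticePeriodic.exists_forall_le {f : Euc n → ℝ} (hf : Continuous f)
    (hp : LatticePeriodic f) : ∃ x₀, ∀ x, f x ≤ f x₀ := by
  obtain ⟨R, hR⟩ := exists_bounded_representative n
  have hne : (Metric.closedBall (0 : Euc n) R).Nonempty := by
    obtain ⟨γ, -, h⟩ := hR 0
    exact ⟨0 + γ, by simpa using h⟩
  obtain ⟨x₀, -, hx₀⟩ := (isCompact_closedBall (0 : Euc n) R).exists_isMaxOn hne hf.continuousOn
  refine ⟨x₀, fun x => ?_⟩
  obtain ⟨γ, hγ, h⟩ := hR x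
  rw [← hp x γ hγ]
  exact hx₀ (by simpa using h)

theorem LatticePeriodic.exists_norm_le {F : Type*} [NormedAddCommGroup F] {f : Euc n → F}
    (hf : Continuous f) (hp : LatticePeriodic f) : ∃ C, ∀ x, ‖f x‖ ≤ C := by
  obtain ⟨x₀, h⟩ := LatticePeriodic.exists_forall_le hf.norm
    (fun x γ hγ => congrArg norm (hp x γ hγ))
  exact ⟨_, h⟩

theorem IsDevelopment.translate {U : Set (Euc n)} {φ : Euc n → Euc n} (hφ : IsDevelopment h U φ)
    {γ : Euc n} (hγ : γ ∈ periodLattice n) :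
    IsDevelopment h ((· + γ) ⁻¹' U) fun x => φ (x + γ) := by
  refine ⟨hφ.isOpen.preimage (continuous_add_const γ), ?_, fun y hy u v => ?_⟩
  · exact hφ.contDiffOn.comp (contDiff_id.add contDiff_const).contDiffOn fun x hx => hx
  · rw [fderiv_comp_add_right, ← hφ.metric _ hy]
    exact congrArg (fun L : Euc n →L[ℝ] Euc n →L[ℝ] ℝ => L u v)
      (latticePeriodic_comp_coe h y γ hγ).symm

theorem exists_uniform_development (hE : IsEuclideanMetric h) :
    ∃ δ > 0, ∀ x : Euc n, ∃ φ, IsDevelopment h (Metric.ball x δ) φ := by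
  choose U φ hU hxU hφ hφm using hE
  have hdev : ∀ x, IsDevelopment h (U x) (φ x) := fun x => ⟨hU x, hφ x, hφm x⟩
  obtain ⟨R, hR⟩ := exists_bounded_representative n
  obtain ⟨δ, hδ, hb⟩ := lebesgue_number_lemma_of_metric (isCompact_closedBall (0 : Euc n) R) hU
    fun x _ => Set.mem_iUnion.2 ⟨x, hxU x⟩
  refine ⟨δ, hδ, fun x => ?_⟩
  obtain ⟨γ, hγ, h1⟩ := hR x
  obtain ⟨i, hi⟩ := hb (x + γ) (by simpa using h1)
  refine ⟨_, ((hdev i).translate hγ).mono Metric.isOpen_ball fun y hy => hi ?_⟩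
  simpa [dist_add_right] using hy

theorem exists_extension_ball (hh : IsRiemannianMetric 2 h) {δ r : ℝ} (hδ : 0 < δ) (hr : 0 < r)
    (hloc : ∀ x : Euc n, ∃ φ, IsDevelopment h (Metric.ball x δ) φ) {φ : Euc n → Euc n}
    (hφ : IsDevelopment h (Metric.ball 0 r) φ) :
    ∃ ψ, IsDevelopment h (Metric.ball 0 (r + δ)) ψ ∧ Set.EqOn φ ψ (Metric.ball 0 r) := by
  have key : ∀ c : Metric.ball (0 : Euc n) r, ∃ ψ, IsDevelopment h (Metric.ball (c : Euc n) δ) ψ ∧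
      Set.EqOn ψ φ (Metric.ball (c : Euc n) δ ∩ Metric.ball 0 r) := fun c => by
    obtain ⟨ψ, hψ⟩ := hloc c
    have hc : (c : Euc n) ∈ Metric.ball (c : Euc n) δ ∩ Metric.ball 0 r :=
      ⟨Metric.mem_ball_self hδ, c.2⟩
    have hconv : Convex ℝ (Metric.ball (c : Euc n) δ ∩ Metric.ball 0 r) :=
      (convex_ball _ _).inter (convex_ball _ _)
    have ho : IsOpen (Metric.ball (c : Euc n) δ ∩ Metric.ball 0 r) :=
      Metric.isOpen_ball.inter Metric.isOpen_ball
    obtain ⟨R, t, -, h2⟩ := (hψ.mono ho Set.inter_subset_left).rigid hh hconv.isPreconnected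
      (hφ.mono ho Set.inter_subset_right) hc
    exact ⟨_, hψ.motion R t, fun y hy => (h2 y hy).symm⟩
  choose ψ hψ hψφ using key
  obtain ⟨Ψ, hΨ, hΨe⟩ := IsDevelopment.glue (fun c : Metric.ball (0 : Euc n) r =>
    Metric.ball (c : Euc n) δ) ψ hψ fun c c' => by
    rcases Set.eq_empty_or_nonempty (Metric.ball (c : Euc n) δ ∩ Metric.ball (c' : Euc n) δ)
      with he | ⟨y, hy, hy'⟩
    · rw [he]; exact Set.eqOn_empty _ _
    have ho : IsOpen (Metric.ball (c : Euc n) δ ∩ Metric.ball (c' : Euc n) δ) :=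
      Metric.isOpen_ball.inter Metric.isOpen_ball
    refine IsDevelopment.eqOn_of_eqOn hh ((convex_ball _ _).inter (convex_ball _ _)).isPreconnected
      ((hψ c).mono ho Set.inter_subset_left) ((hψ c').mono ho Set.inter_subset_right)
      (V := (Metric.ball (c : Euc n) δ ∩ Metric.ball (c' : Euc n) δ) ∩ Metric.ball 0 r)
      (ho.inter Metric.isOpen_ball) Set.inter_subset_left ?_ fun z hz => ?_
    · have hd : dist (c : Euc n) c' < 2 * δ := by
        have := dist_triangle_left (c : Euc n) c' y
        rw [Metric.mem_ball] at hy hy'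
        linarith
      refine ⟨midpoint ℝ (c : Euc n) c', ⟨?_, ?_⟩, (convex_ball _ _).midpoint_mem c.2 c'.2⟩
      · rw [Metric.mem_ball, dist_midpoint_left, Real.norm_ofNat]
        linarith
      · rw [Metric.mem_ball, dist_midpoint_right, Real.norm_ofNat]
        linarith
    · rw [hψφ c ⟨hz.1.1, hz.2⟩, hψφ c' ⟨hz.1.2, hz.2⟩]
  refine ⟨Ψ, hΨ.mono Metric.isOpen_ball fun y hy => ?_, fun y hy => ?_⟩
  · have hrδ : 0 < r + δ := by linarith
    rw [mem_ball_zero_iff] at hy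
    have hc : (r / (r + δ)) • y ∈ Metric.ball (0 : Euc n) r := by
      rw [mem_ball_zero_iff, norm_smul, Real.norm_of_nonneg (by positivity), div_mul_eq_mul_div,
        div_lt_iff₀ hrδ]
      gcongr
    refine Set.mem_iUnion.2 ⟨⟨_, hc⟩, ?_⟩
    have h1 : y - (r / (r + δ)) • y = (δ / (r + δ)) • y := by
      rw [← one_smul ℝ y, smul_smul, ← sub_smul, one_smul]
      congr 1
      field_simp
      ring
    rw [Metric.mem_ball, dist_eq_norm, h1, norm_smul, Real.norm_of_nonneg (by positivity),
      div_mul_eq_mul_div, div_lt_iff₀ hrδ]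
    gcongr
  · have h1 := hΨe ⟨y, hy⟩ (Metric.mem_ball_self hδ)
    have h2 := hψφ ⟨y, hy⟩ ⟨Metric.mem_ball_self hδ, hy⟩
    exact (h1.trans h2).symm

/-- A Euclidean metric on the torus has a global developing map. -/
theorem exists_development (hh : IsRiemannianMetric 2 h) (hE : IsEuclideanMetric h) :
    ∃ Φ, IsDevelopment h Set.univ Φ := by
  obtain ⟨δ, hδ, hloc⟩ := exists_uniform_development hE
  obtain ⟨φ₀, hφ₀⟩ := hloc 0
  have key : ∀ N : ℕ, ∃ φ, IsDevelopment h (Metric.ball 0 ((N + 1) * δ)) φ ∧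
      Set.EqOn φ₀ φ (Metric.ball 0 δ) := by
    intro N
    induction N with
    | zero => exact ⟨φ₀, by simpa using hφ₀, fun _ _ => rfl⟩
    | succ N ih =>
      obtain ⟨φ, hφ, he⟩ := ih
      have hN : δ ≤ (N + 1) * δ := by nlinarith [(Nat.cast_nonneg N : (0 : ℝ) ≤ N)]
      obtain ⟨ψ, hψ, he'⟩ := exists_extension_ball hh hδ (hδ.trans_le hN) hloc hφ
      refine ⟨ψ, ?_, he.trans (he'.mono (Metric.ball_subset_ball hN))⟩
      have : ((N + 1 : ℕ) + 1 : ℝ) * δ = (N + 1) * δ + δ := by push_cast; ring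
      rwa [this]
  choose φ hφ he using key
  obtain ⟨Φ, hΦ, -⟩ := IsDevelopment.glue _ φ hφ fun i j => by
    have ho : IsOpen (Metric.ball (0 : Euc n) ((i + 1) * δ) ∩ Metric.ball 0 ((j + 1) * δ)) :=
      Metric.isOpen_ball.inter Metric.isOpen_ball
    have hN : ∀ N : ℕ, δ ≤ (N + 1) * δ := fun N => by
      nlinarith [(Nat.cast_nonneg N : (0 : ℝ) ≤ N)]
    exact IsDevelopment.eqOn_of_eqOn hh
      ((convex_ball _ _).inter (convex_ball _ _)).isPreconnected
      ((hφ i).mono ho Set.inter_subset_left) ((hφ j).mono ho Set.inter_subset_right)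
      Metric.isOpen_ball (Set.subset_inter (Metric.ball_subset_ball (hN i))
        (Metric.ball_subset_ball (hN j))) ⟨0, Metric.mem_ball_self hδ⟩ ((he i).symm.trans (he j))
  refine ⟨Φ, hΦ.mono isOpen_univ fun y _ => ?_⟩
  obtain ⟨N, hN⟩ := exists_nat_gt (‖y‖ / δ)
  refine Set.mem_iUnion.2 ⟨N, ?_⟩
  rw [div_lt_iff₀ hδ] at hN
  rw [mem_ball_zero_iff]
  linarith

/-- At a maximum point of the squared norm of a differentiable map, the derivative is orthogonal
to the value. -/
theorem inner_fderiv_eq_zero_of_max {F : Type*} [NormedAddCommGroup F] [InnerProductSpace ℝ F]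
    {v : Euc n → F} {x₀ : Euc n} (hv : DifferentiableAt ℝ v x₀)
    (hmax : ∀ x, ‖v x‖ ^ 2 ≤ ‖v x₀‖ ^ 2) (u : Euc n) : ⟪v x₀, fderiv ℝ v x₀ u⟫ = 0 := by
  have h1 := hv.hasFDerivAt.norm_sq
  have h2 : IsLocalMax (fun x => ‖v x‖ ^ 2) x₀ := Filter.Eventually.of_forall hmax
  have h3 := congrArg (fun L => L u) (h2.hasFDerivAt_eq_zero h1)
  simpa using h3

/-- The developing map is equivariant with respect to translations. -/
theorem IsDevelopment.exists_translation (hh : IsRiemannianMetric 2 h) {Φ : Euc n → Euc n}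
    (hΦ : IsDevelopment h Set.univ Φ) {γ : Euc n} (hγ : γ ∈ periodLattice n) :
    ∃ t, ∀ x, Φ (x + γ) = Φ x + t := by
  have hd : Differentiable ℝ Φ := fun x => hΦ.differentiableAt (Set.mem_univ x)
  have hmot : ∀ γ ∈ periodLattice n, ∃ (R : Euc n ≃ₗᵢ[ℝ] Euc n) (t : Euc n),
      ∀ x, Φ (x + γ) = R (Φ x) + t := fun γ hγ => by
    obtain ⟨R, t, -, h⟩ := hΦ.rigid hh isPreconnected_univ (hΦ.translate hγ) (Set.mem_univ 0)
    exact ⟨R, t, fun x => h x (Set.mem_univ x)⟩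
  obtain ⟨R, t, hR⟩ := hmot γ hγ
  set v : Euc n → Euc n := fun x => Φ (x + γ) - Φ x with hv
  have hvR : v = fun x => R (Φ x) - Φ x + t := funext fun x => by
    simp only [hv, hR x]
    abel
  set S : Euc n →L[ℝ] Euc n :=
    (R.toContinuousLinearEquiv : Euc n →L[ℝ] Euc n) - ContinuousLinearMap.id ℝ (Euc n) with hS
  have hvS : v = fun x => S (Φ x) + t := by rw [hvR]; rfl
  have hvd : ∀ x, HasFDerivAt v (S.comp (fderiv ℝ Φ x)) x := fun x => by
    rw [hvS]
    exact (S.hasFDerivAt.comp x (hd x).hasFDerivAt).add_const t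
  have hvp : LatticePeriodic fun x => ‖v x‖ ^ 2 := fun x γ' hγ' => by
    obtain ⟨R', t', hR'⟩ := hmot γ' hγ'
    have : v (x + γ') = R' (v x) := by
      rw [hv]
      simp only
      rw [add_right_comm, hR', hR', map_sub]
      abel
    simp only [this, R'.norm_map]
  obtain ⟨x₀, hx₀⟩ := LatticePeriodic.exists_forall_le
    (f := fun x => ‖v x‖ ^ 2) ((continuous_iff_continuousAt.2 fun x =>
      (hvd x).continuousAt).norm.pow 2) hvp
  have h0 : ∀ q, ⟪v x₀, S q⟫ = 0 := fun q => by
    obtain ⟨u, rfl⟩ := hΦ.surjective hh (Set.mem_univ x₀) q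
    have := inner_fderiv_eq_zero_of_max (hvd x₀).differentiableAt hx₀ u
    rwa [(hvd x₀).fderiv] at this
  have hS0 : ∀ x, S (Φ x - Φ x₀) = 0 := fun x => by
    have h1 : v x = v x₀ + S (Φ x - Φ x₀) := by rw [hvS, map_sub]; simp only; abel
    have h2 := hx₀ x
    rw [h1, norm_add_sq_real, h0] at h2
    have h3 : ‖S (Φ x - Φ x₀)‖ ^ 2 = 0 := le_antisymm (by linarith) (sq_nonneg _)
    simpa using h3
  have hvc : v = fun _ => v x₀ := funext fun x => by
    have h1 : v x = v x₀ + S (Φ x - Φ x₀) := by rw [hvS, map_sub]; simp only; abel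
    rw [h1, hS0, add_zero]
  refine ⟨v x₀, fun x => ?_⟩
  rw [← congrFun hvc x, hv]
  simp

theorem IsDevelopment.latticePeriodic_fderiv (hh : IsRiemannianMetric 2 h) {Φ : Euc n → Euc n}
    (hΦ : IsDevelopment h Set.univ Φ) : LatticePeriodic (fderiv ℝ Φ) := fun x γ hγ => by
  obtain ⟨t, ht⟩ := hΦ.exists_translation hh hγ
  have h1 : (fun x => Φ (x + γ)) = fun x => Φ x + t := funext ht
  have h2 := congrArg (fun f => fderiv ℝ f x) h1
  simpa only [fderiv_comp_add_right, fderiv_add_const] using h2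

/-- The developing map is a linear isomorphism up to a periodic summand. -/
theorem IsDevelopment.exists_linear_part (hh : IsRiemannianMetric 2 h) {Φ : Euc n → Euc n}
    (hΦ : IsDevelopment h Set.univ Φ) :
    ∃ A : Euc n ≃L[ℝ] Euc n, LatticePeriodic fun x => Φ x - A x := by
  have hd : Differentiable ℝ Φ := fun x => hΦ.differentiableAt (Set.mem_univ x)
  let A : Euc n →ₗ[ℝ] Euc n :=
    (latticeBasis n).constr ℝ fun i => Φ (0 + latticeBasis n i) - Φ 0
  have hA : ∀ i, A (latticeBasis n i) = Φ (0 + latticeBasis n i) - Φ 0 := fun i =>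
    (latticeBasis n).constr_basis ℝ _ i
  have hper : LatticePeriodic fun x => Φ x - A x := fun x γ hγ => by
    revert x
    rw [mem_periodLattice_iff] at hγ
    induction hγ using Submodule.span_induction with
    | mem γ hγ =>
      obtain ⟨i, rfl⟩ := hγ
      intro x
      obtain ⟨t, ht⟩ := hΦ.exists_translation hh (latticeBasis_mem i)
      simp only [map_add, hA, ht]
      abel
    | zero => intro x; rw [add_zero]
    | add a b _ _ ha hb => intro x; rw [← add_assoc]; exact (hb (x + a)).trans (ha x)
    | smul m a _ ha =>
      intro x
      have hnat : ∀ (k : ℕ) (x : Euc n), Φ (x + k • a) - A (x + k • a) = Φ x - A x := by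
        intro k
        induction k with
        | zero => intro x; simp
        | succ k ih => intro x; rw [succ_nsmul, ← add_assoc]; exact (ha _).trans (ih x)
      obtain ⟨k, rfl | rfl⟩ := m.eq_nat_or_neg
      · simpa using hnat k x
      · have := hnat k (x + -(k • a))
        rw [neg_add_cancel_right] at this
        simp only [neg_smul, natCast_zsmul]
        exact this.symm
  have hinj : Function.Injective A := by
    rw [LinearMap.injective_iff_surjective, ← LinearMap.range_eq_top]
    by_contra hne
    have h1 : (LinearMap.range A)ᗮ ≠ ⊥ := fun h => hne ((Submodule.orthogonal_eq_bot_iff).1 h)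
    obtain ⟨w, hw, hw0⟩ := Submodule.exists_mem_ne_zero_of_ne_bot h1
    have hwA : ∀ x, ⟪w, A x⟫ = 0 := fun x => by
      rw [real_inner_comm]
      exact hw _ ⟨x, rfl⟩
    have hf : LatticePeriodic fun x => ⟪w, Φ x⟫ := fun x γ hγ => by
      have := congrArg (fun q => ⟪w, q⟫) (hper x γ hγ)
      simpa only [inner_sub_right, hwA, sub_zero] using this
    obtain ⟨x₀, hx₀⟩ := LatticePeriodic.exists_forall_le (continuous_const.inner hd.continuous) hf
    have h2 : HasFDerivAt (fun x => ⟪w, Φ x⟫) ((innerSL ℝ w).comp (fderiv ℝ Φ x₀)) x₀ :=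
      (innerSL ℝ w).hasFDerivAt.comp x₀ (hd x₀).hasFDerivAt
    have h3 : IsLocalMax (fun x => ⟪w, Φ x⟫) x₀ := Filter.Eventually.of_forall hx₀
    obtain ⟨u, hu⟩ := hΦ.surjective hh (Set.mem_univ x₀) w
    have h4 := congrArg (fun L => L u) (h3.hasFDerivAt_eq_zero h2)
    simp [hu] at h4
    exact hw0 h4
  exact ⟨(LinearEquiv.ofInjectiveEndo A hinj).toContinuousLinearEquiv, hper⟩

end development

section planes

variable {n : ℕ}

theorem exists_graph_coordinates {P : Submodule ℝ (Euc n)} (hP : Module.finrank ℝ P = 2) :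
    ∃ (i₁ i₂ : Fin n) (a₁ a₂ : Fin n → ℝ), i₁ ≠ i₂ ∧
      ∀ x : Euc n, x ∈ P ↔ ∀ j, j ≠ i₁ → j ≠ i₂ → a₁ j * x i₁ + a₂ j * x i₂ - x j = 0 := by
  have hex : ∀ v : Euc n, v ≠ 0 → ∃ i, v i ≠ 0 := fun v hv => by
    by_contra h
    push Not at h
    exact hv (PiLp.ext h)
  obtain ⟨v, hvP, hv⟩ := Submodule.exists_mem_ne_zero_of_ne_bot (p := P) fun h => by
    rw [h, finrank_bot] at hP
    exact absurd hP (by norm_num)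
  obtain ⟨i₁, hi₁⟩ := hex v hv
  have h1 : ∃ w ∈ P, w ≠ 0 ∧ w i₁ = 0 := by
    by_contra hcon
    push Not at hcon
    let L : P →ₗ[ℝ] ℝ := (EuclideanSpace.proj (𝕜 := ℝ) i₁ : Euc n →ₗ[ℝ] ℝ).comp P.subtype
    have hL : Function.Injective L := by
      rw [injective_iff_map_eq_zero]
      intro u hu
      by_contra h0
      exact hcon u u.2 (fun h => h0 (Subtype.ext h)) hu
    have := LinearMap.finrank_le_finrank_of_injective hL
    rw [hP, Module.finrank_self] at this
    exact absurd this (by norm_num)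
  obtain ⟨w, hwP, hw, hwi⟩ := h1
  obtain ⟨i₂, hi₂⟩ := hex w hw
  have hi : i₁ ≠ i₂ := fun h => hi₂ (h ▸ hwi)
  let L : P →ₗ[ℝ] ℝ × ℝ := ((EuclideanSpace.proj (𝕜 := ℝ) i₁ : Euc n →ₗ[ℝ] ℝ).comp P.subtype).prod
    ((EuclideanSpace.proj (𝕜 := ℝ) i₂ : Euc n →ₗ[ℝ] ℝ).comp P.subtype)
  have hLa : ∀ u : P, L u = ((u : Euc n) i₁, (u : Euc n) i₂) := fun u => rfl
  have hLs : Function.Surjective L := fun ⟨a, b⟩ => by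
    refine ⟨(a / v i₁) • ⟨v, hvP⟩ + ((b - a / v i₁ * v i₂) / w i₂) • ⟨w, hwP⟩, ?_⟩
    rw [hLa]
    ext
    · simp [hwi, hi₁]
    · simp [hi₂]
  have hLi : Function.Injective L :=
    (LinearMap.injective_iff_surjective_of_finrank_eq_finrank (by simp [hP])).2 hLs
  obtain ⟨e₁, he₁⟩ := hLs (1, 0)
  obtain ⟨e₂, he₂⟩ := hLs (0, 1)
  have hx : ∀ x : P, x = (x : Euc n) i₁ • e₁ + (x : Euc n) i₂ • e₂ := fun x => hLi (by
    rw [map_add, map_smul, map_smul, he₁, he₂, hLa]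
    simp)
  refine ⟨i₁, i₂, fun j => (e₁ : Euc n) j, fun j => (e₂ : Euc n) j, hi, fun x =>
    ⟨fun hxP j _ _ => ?_, fun h => ?_⟩⟩
  · have := congrArg (fun y : P => (y : Euc n) j) (hx ⟨x, hxP⟩)
    simp at this
    linarith
  · have h2 : x = x i₁ • (e₁ : Euc n) + x i₂ • (e₂ : Euc n) := by
      rw [hLa] at he₁ he₂
      simp only [Prod.mk.injEq] at he₁ he₂
      ext j
      by_cases hj1 : j = i₁
      · subst hj1; simp [he₁.1, he₂.1]
      by_cases hj2 : j = i₂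
      · subst hj2; simp [he₁.2, he₂.2]
      have := h j hj1 hj2
      simp
      linarith
    rw [h2]
    exact P.add_mem (P.smul_mem _ e₁.2) (P.smul_mem _ e₂.2)

theorem exists_planeFrame {P : Submodule ℝ (Euc n)} (hP : Module.finrank ℝ P = 2) :
    Nonempty (PlaneFrame P) := by
  obtain ⟨i₁, i₂, a₁, a₂, hi, h⟩ := exists_graph_coordinates hP
  exact ⟨graphFrame hi h⟩

end planes

section leaves

variable {n : ℕ} {h : BilinField n} {Φ : Euc n → Euc n} {P : Submodule ℝ (Euc n)}

theorem IsDevelopment.continuous_fderiv (hΦ : IsDevelopment h Set.univ Φ) :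
    Continuous (fderiv ℝ Φ) :=
  continuous_iff_continuousAt.2 fun x => (hΦ.contDiffAt_fderiv (Set.mem_univ x)).continuousAt

theorem IsDevelopment.continuous_inverse (hh : IsRiemannianMetric 2 h)
    (hΦ : IsDevelopment h Set.univ Φ) : Continuous fun x => (fderiv ℝ Φ x).inverse :=
  continuous_iff_continuousAt.2 fun x => by
    obtain ⟨e, he⟩ := hΦ.exists_equiv hh (Set.mem_univ x)
    have h2 := contDiffAt_map_inverse (𝕜 := ℝ) (n := 0) e
    rw [← he] at h2
    exact h2.continuousAt.comp (hΦ.continuous_fderiv.continuousAt)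

theorem IsDevelopment.inverse_apply (hh : IsRiemannianMetric 2 h)
    (hΦ : IsDevelopment h Set.univ Φ) (x u : Euc n) :
    (fderiv ℝ Φ x).inverse (fderiv ℝ Φ x u) = u := by
  obtain ⟨e, he⟩ := hΦ.exists_equiv hh (Set.mem_univ x)
  rw [he, ContinuousLinearMap.inverse_equiv]
  simp

theorem IsDevelopment.injective (hh : IsRiemannianMetric 2 h)
    (hΦ : IsDevelopment h Set.univ Φ) (x : Euc n) : Function.Injective (fderiv ℝ Φ x) :=
  Function.LeftInverse.injective (hΦ.inverse_apply hh x)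

theorem IsDevelopment.exists_antilipschitz (hh : IsRiemannianMetric 2 h)
    (hΦ : IsDevelopment h Set.univ Φ) :
    ∃ C, 0 ≤ C ∧ ∀ x u, ‖u‖ ≤ C * ‖fderiv ℝ Φ x u‖ := by
  obtain ⟨C, hC⟩ := LatticePeriodic.exists_norm_le (hΦ.continuous_inverse hh) fun x γ hγ => by
    simp only [hΦ.latticePeriodic_fderiv hh x γ hγ]
  refine ⟨C, (norm_nonneg _).trans (hC 0), fun x u => ?_⟩
  conv_lhs => rw [← hΦ.inverse_apply hh x u]
  exact ((fderiv ℝ Φ x).inverse.le_opNorm _).trans (by gcongr; exact hC x)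

theorem IsDevelopment.exists_bound_second_derivative (hh : IsRiemannianMetric 2 h)
    (hΦ : IsDevelopment h Set.univ Φ) : ∃ C, ∀ x, ‖fderiv ℝ (fderiv ℝ Φ) x‖ ≤ C := by
  have h1 : ContDiff ℝ 1 (fderiv ℝ Φ) :=
    contDiff_iff_contDiffAt.2 fun x => hΦ.contDiffAt_fderiv (Set.mem_univ x)
  exact LatticePeriodic.exists_norm_le (h1.continuous_fderiv (by simp))
    (hΦ.latticePeriodic_fderiv hh).fderiv

/-- The second derivative of the developing map in directions tangent to a totally geodesic
leaf. -/
theorem IsDevelopment.exists_second_derivative_eq (hh : IsRiemannianMetric 2 h)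
    (hΦ : IsDevelopment h Set.univ Φ) (hTG : LeavesTotallyGeodesic P h) (x : Euc n) {u v : Euc n}
    (hu : u ∈ P) (hv : v ∈ P) :
    ∃ z ∈ P, fderiv ℝ (fderiv ℝ Φ) x u v = fderiv ℝ Φ x z := by
  obtain ⟨z, hz, hw⟩ := hTG x u hu v hv
  refine ⟨z, hz, ?_⟩
  rw [← sub_eq_zero, ← inner_self_eq_zero (𝕜 := ℝ)]
  obtain ⟨w, hw'⟩ := hΦ.surjective hh (Set.mem_univ x)
    (fderiv ℝ (fderiv ℝ Φ) x u v - fderiv ℝ Φ x z)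
  have h1 := hw w
  rw [koszul_eq_inner hΦ.isOpen hΦ.contDiffOn hΦ.metric (Set.mem_univ x),
    hΦ.metric x (Set.mem_univ x)] at h1
  conv_lhs => arg 3; rw [← hw']
  rw [inner_sub_left, h1, sub_self]

/-- The developing map sends leaves to pieces of parallel planes: the plane does not change along
a leaf. -/
theorem IsDevelopment.map_eq_along_leaf (hh : IsRiemannianMetric 2 h)
    (hΦ : IsDevelopment h Set.univ Φ) (hTG : LeavesTotallyGeodesic P h) (x : Euc n) {p v : Euc n}
    (hp : p ∈ P) (hv : v ∈ P) :
    fderiv ℝ Φ (x + p) v ∈ P.map (fderiv ℝ Φ x : Euc n →ₗ[ℝ] Euc n) := by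
  set V := P.map (fderiv ℝ Φ x : Euc n →ₗ[ℝ] Euc n) with hV
  set N := Vᗮ.starProjection with hN
  have hNV : ∀ q, N q = 0 ↔ q ∈ V := fun q => by
    rw [hN, Submodule.starProjection_apply_eq_zero_iff, Submodule.orthogonal_orthogonal]
  obtain ⟨C, hC0, hC⟩ := hΦ.exists_antilipschitz hh
  obtain ⟨D, hD⟩ := hΦ.exists_bound_second_derivative hh
  set f : ℝ → P →L[ℝ] Euc n := fun s => (N.comp (fderiv ℝ Φ (x + s • p))).comp P.subtypeL with hf
  set f' : ℝ → P →L[ℝ] Euc n := fun s =>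
    (N.comp (fderiv ℝ (fderiv ℝ Φ) (x + s • p) p)).comp P.subtypeL with hf'
  have hfd : ∀ s, HasDerivAt f (f' s) s := fun s => by
    have h1 : HasDerivAt (fun s : ℝ => x + s • p) p s := by
      simpa using ((hasDerivAt_id s).smul_const p).const_add x
    have h2 : HasDerivAt (fun s : ℝ => fderiv ℝ Φ (x + s • p))
        (fderiv ℝ (fderiv ℝ Φ) (x + s • p) p) s :=
      ((hΦ.contDiffAt_fderiv (Set.mem_univ _)).differentiableAt
        (by simp)).hasFDerivAt.comp_hasDerivAt s h1
    have h3 := ((hasDerivAt_const s N).clm_comp h2).clm_comp (hasDerivAt_const s P.subtypeL)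
    simpa using h3
  have hbound : ∀ s, ‖f' s‖ ≤ (C * (D * ‖p‖)) * ‖f s‖ := fun s => by
    have hD0 : 0 ≤ D := le_trans (by positivity) (hD 0)
    refine ContinuousLinearMap.opNorm_le_bound _ (by positivity) fun w => ?_
    obtain ⟨z, hz, hzw⟩ := hΦ.exists_second_derivative_eq hh hTG (x + s • p) hp w.2
    have h1 : f' s w = f s ⟨z, hz⟩ := by
      simp only [hf, hf', ContinuousLinearMap.comp_apply, Submodule.subtypeL_apply, hzw]
    rw [h1]
    refine ((f s).le_opNorm _).trans ?_
    have h2 : ‖z‖ ≤ C * (D * ‖p‖ * ‖w‖) := by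
      refine (hC (x + s • p) z).trans ?_
      rw [← hzw]
      gcongr
      refine ((fderiv ℝ (fderiv ℝ Φ) (x + s • p)).le_opNorm₂ p w).trans ?_
      have := hD (x + s • p)
      gcongr
      rfl
    calc ‖f s‖ * ‖(⟨z, hz⟩ : P)‖ ≤ ‖f s‖ * (C * (D * ‖p‖ * ‖w‖)) := by gcongr; exact h2
      _ = _ := by ring
  have h0 : f 0 = 0 := by
    ext1 w
    simp only [hf, zero_smul, add_zero, ContinuousLinearMap.comp_apply, Submodule.subtypeL_apply,
      zero_apply]
    rw [hNV]
    exact ⟨w, w.2, rfl⟩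
  have h1 := eq_zero_of_abs_deriv_le_mul_abs_self_of_eq_zero_right (f := f) (f' := f') (a := 0)
    (b := 1) (fun s _ => (hfd s).continuousAt.continuousWithinAt)
    (fun s _ => (hfd s).hasDerivWithinAt) h0 (fun s _ => hbound s) 1 (by simp)
  have h2 := congrArg (fun L : P →L[ℝ] Euc n => L ⟨v, hv⟩) h1
  simp only [hf, one_smul, ContinuousLinearMap.comp_apply, Submodule.subtypeL_apply,
    zero_apply] at h2
  exact (hNV _).1 h2

/-- The developing map sends leaves into parallel planes. -/
theorem IsDevelopment.map_eq (hh : IsRiemannianMetric 2 h)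
    (hΦ : IsDevelopment h Set.univ Φ) (hTG : LeavesTotallyGeodesic P h) (A : Euc n ≃L[ℝ] Euc n)
    (hA : LatticePeriodic fun x => Φ x - A x) (x : Euc n) :
    P.map (fderiv ℝ Φ x : Euc n →ₗ[ℝ] Euc n) =
      P.map ((A : Euc n →L[ℝ] Euc n) : Euc n →ₗ[ℝ] Euc n) := by
  set V := P.map (fderiv ℝ Φ x : Euc n →ₗ[ℝ] Euc n) with hV
  set N := Vᗮ.starProjection with hN
  have hNV : ∀ q, N q = 0 ↔ q ∈ V := fun q => by
    rw [hN, Submodule.starProjection_apply_eq_zero_iff, Submodule.orthogonal_orthogonal]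
  have hd : Differentiable ℝ Φ := fun x => hΦ.differentiableAt (Set.mem_univ x)
  obtain ⟨C, hC⟩ := LatticePeriodic.exists_norm_le (hd.continuous.sub A.continuous) hA
  have hAV : ∀ p ∈ P, A p ∈ V := fun p hp => by
    have h1 : ∀ s : ℝ, HasDerivAt (fun s : ℝ => N (Φ (x + s • p))) 0 s := fun s => by
      have h1 : HasDerivAt (fun s : ℝ => x + s • p) p s := by
        simpa using ((hasDerivAt_id s).smul_const p).const_add x
      have h2 := N.hasFDerivAt.comp_hasDerivAt s ((hd (x + s • p)).hasFDerivAt.comp_hasDerivAt s h1)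
      have h3 : N (fderiv ℝ Φ (x + s • p) p) = 0 :=
        (hNV _).2 (hΦ.map_eq_along_leaf hh hTG x (P.smul_mem s hp) hp)
      rwa [h3] at h2
    have h2 : ∀ s : ℝ, N (Φ (x + s • p)) = N (Φ x) := fun s => by
      have := is_const_of_deriv_eq_zero (fun s => (h1 s).differentiableAt) (fun s => (h1 s).deriv)
        s 0
      simpa using this
    have h3 : ∀ s : ℝ, |s| * ‖N (A p)‖ ≤ ‖N‖ * (C + C) := fun s => by
      have h4 : s • N (A p) = N ((Φ x - A x) - (Φ (x + s • p) - A (x + s • p))) := by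
        simp only [map_sub, map_add, map_smul, h2]
        abel
      rw [← Real.norm_eq_abs, ← norm_smul, h4]
      refine (N.le_opNorm _).trans ?_
      gcongr
      exact (norm_sub_le _ _).trans (add_le_add (hC _) (hC _))
    rw [← hNV]
    by_contra hne
    have hpos : 0 < ‖N (A p)‖ := norm_pos_iff.2 hne
    have h5 := h3 (‖N‖ * (C + C) / ‖N (A p)‖ + 1)
    have h6 : 0 ≤ ‖N‖ * (C + C) := (by positivity : (0:ℝ) ≤ |0| * ‖N (A p)‖).trans (h3 0)
    rw [abs_of_nonneg (by positivity), add_mul, div_mul_cancel₀ _ hpos.ne'] at h5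
    linarith
  have hfin : ∀ L : Euc n →ₗ[ℝ] Euc n, Function.Injective L →
      Module.finrank ℝ (P.map L) = Module.finrank ℝ P := fun L hL =>
    (Submodule.equivMapOfInjective L hL P).finrank_eq.symm
  symm
  refine Submodule.eq_of_le_of_finrank_eq ?_ ?_
  · rintro _ ⟨p, hp, rfl⟩
    exact hAV p hp
  · exact (hfin ((A : Euc n →L[ℝ] Euc n) : Euc n →ₗ[ℝ] Euc n) A.injective).trans
      (hfin _ (hΦ.injective hh x)).symm

/-- A rotation by a right angle in an orthonormal basis. -/
theorem rotation_basis {F : Type*} [NormedAddCommGroup F] [InnerProductSpace ℝ F]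
    (b : OrthonormalBasis (Fin 2) ℝ F) (K : F →ₗ[ℝ] F) (hKK : ∀ q, K (K q) = -q)
    (hKi : ∀ q q', ⟪K q, K q'⟫ = ⟪q, q'⟫) :
    K (b 0) = ⟪b 1, K (b 0)⟫ • b 1 ∧ ⟪b 1, K (b 0)⟫ * ⟪b 1, K (b 0)⟫ = 1 ∧
      K (b 1) = ⟪b 1, K (b 0)⟫ • -b 0 := by
  have hb : ∀ i j, ⟪b i, b j⟫ = if i = j then (1 : ℝ) else 0 := fun i j => b.inner_eq_ite i j
  have hKb : K (b 0) = ⟪b 1, K (b 0)⟫ • b 1 := by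
    have h1 := hKi (K (b 0)) (b 0)
    rw [hKK, inner_neg_left, real_inner_comm] at h1
    have h2 : ⟪b 0, K (b 0)⟫ = 0 := by
      have h3 := real_inner_comm (K (b 0)) (b 0)
      linarith
    have h3 := b.sum_repr' (K (b 0))
    rw [Fin.sum_univ_two, h2, zero_smul, zero_add] at h3
    exact h3.symm
  have hsq : ⟪b 1, K (b 0)⟫ * ⟪b 1, K (b 0)⟫ = 1 := by
    have h1 := hKi (b 0) (b 0)
    rw [hb, hKb, real_inner_smul_left, real_inner_smul_right, hb] at h1
    simpa using h1
  refine ⟨hKb, hsq, ?_⟩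
  have h2 : b 1 = ⟪b 1, K (b 0)⟫ • K (b 0) := by
    conv_rhs => rw [hKb, real_inner_smul_right, hb, smul_smul]
    simp [hsq]
  conv_lhs => rw [h2, map_smul, hKK]

/-- The complex structures on the leaves become the standard one under the developing map. -/
theorem IsDevelopment.exists_rotation (hP : Module.finrank ℝ P = 2) (hh : IsRiemannianMetric 2 h)
    (hΦ : IsDevelopment h Set.univ Φ) {Q : Submodule ℝ (Euc n)}
    (hQ : ∀ x, P.map (fderiv ℝ Φ x : Euc n →ₗ[ℝ] Euc n) = Q)
    {J : StdTorus n → P →ₗ[ℝ] P} (hJ : IsLeafComplexStructure P J) (hhJ : IsLeafConformal P J h) :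
    ∃ J₀ : Q →ₗ[ℝ] Q, (∀ w, J₀ (J₀ w) = -w) ∧ (∀ w w' : Q, ⟪J₀ w, J₀ w'⟫ = ⟪w, w'⟫) ∧
      ∀ (x : Euc n) (u : P), ∃ w : Q, (w : Euc n) = fderiv ℝ Φ x u ∧
        (J₀ w : Euc n) = fderiv ℝ Φ x (J (x : StdTorus n) u) := by
  obtain ⟨f⟩ := exists_planeFrame hP
  let e : ∀ x, P ≃ₗ[ℝ] Q := fun x =>
    (Submodule.equivMapOfInjective (fderiv ℝ Φ x : Euc n →ₗ[ℝ] Euc n) (hΦ.injective hh x) P).trans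
      (LinearEquiv.ofEq _ _ (hQ x))
  have he : ∀ x (u : P), (e x u : Euc n) = fderiv ℝ Φ x u := fun x u => rfl
  let K : Euc n → Q →ₗ[ℝ] Q := fun x => (e x).toLinearMap ∘ₗ J (x : StdTorus n) ∘ₗ
    (e x).symm.toLinearMap
  have hK : ∀ x q, K x q = e x (J (x : StdTorus n) ((e x).symm q)) := fun x q => rfl
  have hKK : ∀ x q, K x (K x q) = -q := fun x q => by
    rw [hK, hK, LinearEquiv.symm_apply_apply, hJ.sq, map_neg, LinearEquiv.apply_symm_apply]
  have hei : ∀ x (u v : P), ⟪e x u, e x v⟫ = h (x : StdTorus n) u v := fun x u v => by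
    rw [hΦ.metric x (Set.mem_univ x)]
    rfl
  have hKi : ∀ x q q', ⟪K x q, K x q'⟫ = ⟪q, q'⟫ := fun x q q' => by
    rw [hK, hK, hei, hhJ, ← hei, LinearEquiv.apply_symm_apply, LinearEquiv.apply_symm_apply]
  have hdim : Module.finrank ℝ Q = 2 := by rw [← (e 0).finrank_eq, hP]
  let b : OrthonormalBasis (Fin 2) ℝ Q := (stdOrthonormalBasis ℝ Q).reindex (finCongr hdim)
  have hrot := fun x => rotation_basis b (K x) (hKK x) (hKi x)
  have hsq := fun x => (hrot x).2.1
  have hcont : Continuous fun x => ⟪b 1, K x (b 0)⟫ := by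
    have h1 : ∀ x, ((e x).symm (b 0) : Euc n) = (fderiv ℝ Φ x).inverse (b 0) := fun x => by
      have h2 := hΦ.inverse_apply hh x ((e x).symm (b 0))
      rwa [← he, LinearEquiv.apply_symm_apply, eq_comm] at h2
    have h2 : Continuous fun x => ((e x).symm (b 0) : Euc n) := by
      simp only [h1]
      exact (hΦ.continuous_inverse hh).clm_apply continuous_const
    have h3 : ∀ x : Euc n, ((J (x : StdTorus n) ((e x).symm (b 0)) : P) : Euc n) =
        f.c₁ ((e x).symm (b 0)) • ((J (x : StdTorus n) f.e₁ : P) : Euc n) +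
        f.c₂ ((e x).symm (b 0)) • ((J (x : StdTorus n) f.e₂ : P) : Euc n) := fun x => by
      conv_lhs => rw [f.decomp ((e x).symm (b 0))]
      simp
    have h4 : Continuous fun x : Euc n => ((J (x : StdTorus n) ((e x).symm (b 0)) : P) : Euc n) := by
      simp only [h3]
      exact ((f.c₁.continuous.comp h2).smul ((hJ.continuous f.e₁).comp continuous_coe_quotient)).add
        ((f.c₂.continuous.comp h2).smul ((hJ.continuous f.e₂).comp continuous_coe_quotient))
    change Continuous fun x : Euc n => ⟪((b 1 : Q) : Euc n),
      fderiv ℝ Φ x (J (x : StdTorus n) ((e x).symm (b 0)))⟫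
    exact continuous_const.inner (hΦ.continuous_fderiv.clm_apply h4)
  have hconst : ∀ x, ⟪b 1, K x (b 0)⟫ = ⟪b 1, K 0 (b 0)⟫ := fun x => by
    rcases mul_self_eq_mul_self_iff.1 ((hsq x).trans (hsq 0).symm) with h1 | h1
    · exact h1
    · rcases pos_or_neg_of_ne_zero hcont (fun x h0 => by simpa [h0] using hsq x) with h2 | h2
      · linarith [h2 x, h2 0]
      · linarith [h2 x, h2 0]
  have hK0 : ∀ x, K x = K 0 := fun x => by
    have h0 : K x (b 0) = K 0 (b 0) := by rw [(hrot x).1, (hrot 0).1, hconst]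
    have h1 : K x (b 1) = K 0 (b 1) := by rw [(hrot x).2.2, (hrot 0).2.2, hconst]
    refine b.toBasis.ext fun i => ?_
    rw [b.coe_toBasis]
    fin_cases i
    · exact h0
    · exact h1
  refine ⟨K 0, hKK 0, hKi 0, fun x u => ⟨e x u, he x u, ?_⟩⟩
  rw [← hK0 x, hK, LinearEquiv.symm_apply_apply, he]

end leaves

section rays

open scoped unitInterval

variable {E F : Type*} [NormedAddCommGroup E] [NormedSpace ℝ E] [NormedAddCommGroup F]
  [NormedSpace ℝ F]

/-- The restriction of a function to the segment from `0` to `x`. -/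
def ray (f : E → F) (hf : Continuous f) (x : E) : C(I, F) :=
  ⟨fun s => f ((s : ℝ) • x), hf.comp (continuous_subtype_val.smul continuous_const)⟩

/-- Multiplication of the constant functions by the `j`-th power of the parameter. -/
noncomputable def powConst (F : Type*) [NormedAddCommGroup F] [NormedSpace ℝ F] (j : ℕ) :
    F →L[ℝ] C(I, F) :=
  LinearMap.mkContinuous
    { toFun := fun c => ⟨fun s => (s : ℝ) ^ j • c, by fun_prop⟩
      map_add' := fun a b => by ext s; simp
      map_smul' := fun a b => by
        ext s
        exact smul_comm ((s : ℝ) ^ j) a b } 1 (fun c => by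
    rw [one_mul, ContinuousMap.norm_le _ (norm_nonneg c)]
    intro s
    change ‖(s : ℝ) ^ j • c‖ ≤ ‖c‖
    rw [norm_smul, norm_pow, Real.norm_of_nonneg s.2.1]
    exact mul_le_of_le_one_left (norm_nonneg c) (pow_le_one₀ s.2.1 s.2.2))

theorem powConst_apply (j : ℕ) (c : F) (s : I) : powConst F j c s = (s : ℝ) ^ j • c := rfl

theorem norm_powConst_le (j : ℕ) : ‖powConst F j‖ ≤ 1 :=
  LinearMap.mkContinuous_norm_le _ zero_le_one _

theorem analyticAt_ray [CompleteSpace F] {f : E → F} (hf : Continuous f) (ha : AnalyticAt ℝ f 0) :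
    AnalyticAt ℝ (ray f hf) 0 := by
  obtain ⟨p, r, hp⟩ := ha
  let q : FormalMultilinearSeries ℝ E C(I, F) := fun j =>
    (powConst F j).compContinuousMultilinearMap (p j)
  have hq : ∀ j, ‖q j‖ ≤ ‖p j‖ := fun j =>
    ((powConst F j).norm_compContinuousMultilinearMap_le (p j)).trans
      (mul_le_of_le_one_left (norm_nonneg _) (norm_powConst_le j))
  have hrad := FormalMultilinearSeries.radius_le_of_le hq
  refine ⟨q, r, hp.r_le.trans hrad, hp.r_pos, fun {y} hy => ?_⟩
  have hs : Summable fun j => q j fun _ => y :=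
    q.summable (by
      rw [Metric.mem_eball] at hy ⊢
      exact hy.trans_le (hp.r_le.trans hrad))
  have he : ∑' j, (q j fun _ => y) = ray f hf (0 + y) := by
    ext s
    have h1 := (ContinuousMap.evalCLM ℝ s).hasSum hs.hasSum
    have hsy : (s : ℝ) • y ∈ Metric.eball (0 : E) r := by
      rw [mem_eball_zero_iff] at hy ⊢
      refine lt_of_le_of_lt ?_ hy
      rw [enorm_le_iff_norm_le, norm_smul, Real.norm_of_nonneg s.2.1]
      exact mul_le_of_le_one_left (norm_nonneg y) s.2.2
    have h2 := hp.hasSum hsy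
    rw [zero_add] at h2
    have h3 : ∀ j, ContinuousMap.evalCLM ℝ s (q j fun _ => y) = p j fun _ => (s : ℝ) • y :=
      fun j => by
        rw [ContinuousMultilinearMap.map_smul_univ]
        simp [q, powConst_apply]
    simp only [h3] at h1
    rw [zero_add]
    exact h1.unique h2
  rw [← he]
  exact hs.hasSum

/-- The integral over `[0, s]` as an operator on continuous functions on the unit interval. -/
noncomputable def volterra (F : Type*) [NormedAddCommGroup F] [NormedSpace ℝ F] :
    C(I, F) →L[ℝ] C(I, F) :=
  have hc : ∀ u : C(I, F), Continuous fun t : ℝ => u (Set.projIcc 0 1 zero_le_one t) := fun u =>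
    u.continuous.comp continuous_projIcc
  have hi : ∀ (u : C(I, F)) (a b : ℝ), IntervalIntegrable
      (fun t : ℝ => u (Set.projIcc 0 1 zero_le_one t)) MeasureTheory.volume a b :=
    fun u a b => (hc u).intervalIntegrable a b
  LinearMap.mkContinuous
    { toFun := fun u => ⟨fun s => ∫ t in (0 : ℝ)..s, u (Set.projIcc 0 1 zero_le_one t),
        (intervalIntegral.continuous_primitive (hi u) 0).comp continuous_subtype_val⟩
      map_add' := fun u v => by
        ext s
        exact intervalIntegral.integral_add (hi u 0 s) (hi v 0 s)
      map_smul' := fun c u => by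
        ext s
        exact intervalIntegral.integral_smul c _ } 1 (fun u => by
    rw [one_mul, ContinuousMap.norm_le _ (norm_nonneg u)]
    intro s
    change ‖∫ t in (0 : ℝ)..s, u (Set.projIcc 0 1 zero_le_one t)‖ ≤ ‖u‖
    refine (intervalIntegral.norm_integral_le_of_norm_le_const fun t _ =>
      u.norm_coe_le_norm _).trans ?_
    rw [sub_zero, abs_of_nonneg s.2.1]
    exact mul_le_of_le_one_right (norm_nonneg u) s.2.2)

theorem volterra_apply (u : C(I, F)) (s : I) :
    volterra F u s = ∫ t in (0 : ℝ)..s, u (Set.projIcc 0 1 zero_le_one t) := rfl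

theorem volterra_of_hasDerivAt [CompleteSpace F] {g g' : ℝ → F} (u : C(I, F))
    (hg : ∀ t, HasDerivAt g (g' t) t) (hu : ∀ t : I, u t = g' t) (s : I) :
    volterra F u s = g s - g 0 := by
  have hc : Continuous fun t : ℝ => u (Set.projIcc 0 1 zero_le_one t) :=
    u.continuous.comp continuous_projIcc
  have heq : ∀ t ∈ Set.uIcc (0 : ℝ) s, u (Set.projIcc 0 1 zero_le_one t) = g' t := fun t ht => by
    rw [Set.uIcc_of_le s.2.1] at ht
    have ht' : t ∈ Set.Icc (0 : ℝ) 1 := ⟨ht.1, ht.2.trans s.2.2⟩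
    rw [Set.projIcc_of_mem _ ht']
    exact hu ⟨t, ht'⟩
  rw [volterra_apply]
  exact intervalIntegral.integral_eq_sub_of_hasDerivAt (fun t ht => by
    rw [heq t ht]; exact hg t) (hc.intervalIntegrable _ _)

end rays

section regularity

open scoped unitInterval

/-- Solutions of `w - V (w g) = c` for an analytic function `g` are analytic near the zeros
of `g`. -/
theorem contDiffAt_of_sub_mul_eq {E H : Type*} [NormedAddCommGroup E] [NormedSpace ℝ E]
    [NormedRing H] [NormedAlgebra ℝ H] [CompleteSpace H] {k : WithTop ℕ∞} (V : H →L[ℝ] H)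
    {g : E → H} {x₀ : E} (hg : ContDiffAt ℝ k g x₀) (hg0 : g x₀ = 0) {w : E → H} {c : H}
    (hw : ∀ x, w x - V (w x * g x) = c) : ContDiffAt ℝ k w x₀ := by
  let R : H →L[ℝ] H →L[ℝ] H := (ContinuousLinearMap.mul ℝ H).flip
  let T : E → H →L[ℝ] H := fun x => V.comp (R (g x))
  have hT : ContDiffAt ℝ k T x₀ := contDiffAt_const.clm_comp (R.contDiff.contDiffAt.comp x₀ hg)
  have hT0 : T x₀ = 0 := by simp only [T, hg0, map_zero, ContinuousLinearMap.comp_zero]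
  have h2 : ContDiffAt ℝ k (fun x => (1 : H →L[ℝ] H) - T x) x₀ := contDiffAt_const.sub hT
  have hinv : ContDiffAt ℝ k (fun x => Ring.inverse (1 - T x)) x₀ := by
    have h1 := contDiffAt_ringInverse ℝ (n := k) (1 : (H →L[ℝ] H)ˣ)
    have h3 : ContDiffAt ℝ k (Ring.inverse : (H →L[ℝ] H) → H →L[ℝ] H) (1 - T x₀) := by
      simpa [hT0] using h1
    exact h3.comp x₀ h2
  have hunit : ∀ᶠ x in 𝓝 x₀, IsUnit (1 - T x) := by
    have h3 : ContinuousAt (fun x => (1 : H →L[ℝ] H) - T x) x₀ := h2.continuousAt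
    refine h3.eventually_mem (Units.isOpen.mem_nhds ?_)
    simp [hT0]
  have h1 : ContDiffAt ℝ k (fun x => Ring.inverse (1 - T x) c) x₀ :=
    hinv.clm_apply contDiffAt_const
  refine h1.congr_of_eventuallyEq ?_
  filter_upwards [hunit] with x hx
  rw [← hw x]
  exact (congrArg (fun L : H →L[ℝ] H => L (w x)) (Ring.inverse_mul_cancel _ hx)).symm

/-- Solutions of the total differential equation `dM = M Γ` with analytic `Γ` in a Banach algebra
are analytic, and so are the functions with the derivative `M`. -/
theorem analyticAt_of_total_equation {E F B ι : Type*} [NormedAddCommGroup E] [NormedSpace ℝ E]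
    [NormedAddCommGroup F] [NormedSpace ℝ F] [CompleteSpace F] [NormedRing B] [NormedAlgebra ℝ B]
    [CompleteSpace B] [Fintype ι] (c : ι → E →L[ℝ] ℝ) (b : ι → E)
    (hcb : ∀ x, ∑ i, c i x • b i = x) {Γ : E → E →L[ℝ] B} (hΓ : ContDiff ℝ ω Γ)
    {M : E → B} {M' : E → E →L[ℝ] B} (hM : ∀ x, HasFDerivAt M (M' x) x)
    (hM' : ∀ x u, M' x u = M x * Γ x u) (ev : B →L[ℝ] E →L[ℝ] F) {f : E → F}
    (hf : ∀ x, HasFDerivAt f (ev (M x)) x) :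
    AnalyticAt ℝ f 0 := by
  have hMc : Continuous M := continuous_iff_continuousAt.2 fun x => (hM x).continuousAt
  have hΓi : ∀ i, ContDiff ℝ ω fun x => Γ x (b i) := fun i => hΓ.clm_apply contDiff_const
  let G : E → C(I, B) := fun x =>
    ∑ i, c i x • ray (fun y => Γ y (b i)) (hΓi i).continuous x
  have hG : ∀ x (s : I), G x s = Γ ((s : ℝ) • x) x := fun x s => by
    conv_rhs => rw [← hcb x]
    rw [map_sum]
    simp only [G, ContinuousMap.coe_sum, Finset.sum_apply, ContinuousMap.coe_smul, Pi.smul_apply,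
      map_smul, hcb]
    rfl
  have hGa : ContDiffAt ℝ ω G 0 := by
    refine ContDiffAt.sum fun i _ => ?_
    exact (c i).contDiff.contDiffAt.smul (analyticAt_ray (hΓi i).continuous
      ((contDiff_iff_contDiffAt.1 (hΓi i) 0).analyticAt)).contDiffAt
  have hG0 : G 0 = 0 := by ext1 s; rw [hG, map_zero]; rfl
  let w : E → C(I, B) := fun x => ray M hMc x
  have hline : ∀ (x : E) (t : ℝ), HasDerivAt (fun t : ℝ => t • x) x t := fun x t => by
    simpa using (hasDerivAt_id t).smul_const x
  have hw : ∀ x, w x - volterra B (w x * G x) = ContinuousMap.const I (M 0) := fun x => by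
    ext1 s
    have h1 : ∀ t : ℝ, HasDerivAt (fun t : ℝ => M (t • x)) (M (t • x) * Γ (t • x) x) t :=
      fun t => by
        have := (hM (t • x)).comp_hasDerivAt t (hline x t)
        rwa [hM'] at this
    have h2 := volterra_of_hasDerivAt (w x * G x) h1 (fun t => by
      rw [ContinuousMap.mul_apply, hG]; rfl) s
    rw [zero_smul] at h2
    change M ((s : ℝ) • x) - volterra B (w x * G x) s = M 0
    rw [h2]
    abel
  have hwa : ContDiffAt ℝ ω w 0 := contDiffAt_of_sub_mul_eq (volterra B) hGa hG0 hw
  have hfw : ∀ x, f x = f 0 + ev (volterra B (w x) 1) x := fun x => by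
    have h1 : ∀ t : ℝ, HasDerivAt (fun t : ℝ => f (t • x)) (ev (M (t • x)) x) t := fun t =>
      (hf (t • x)).comp_hasDerivAt t (hline x t)
    let evx : B →L[ℝ] F := (ContinuousLinearMap.apply ℝ F x).comp ev
    let u : C(I, F) := ⟨fun s => evx (w x s), evx.continuous.comp (w x).continuous⟩
    have h2 := volterra_of_hasDerivAt u h1 (fun t => rfl) 1
    have h3 : volterra F u 1 = evx (volterra B (w x) 1) := by
      rw [volterra_apply, volterra_apply, ← ContinuousLinearMap.intervalIntegral_comp_comm]
      · rfl
      · exact ((w x).continuous.comp continuous_projIcc).intervalIntegrable _ _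
    change f x = f 0 + evx (volterra B (w x) 1)
    rw [← h3, h2]
    simp
  have hfc : ContDiffAt ℝ ω (fun x => f 0 + ev (volterra B (w x) 1) x) 0 := by
    refine contDiffAt_const.add (ContDiffAt.clm_apply ?_ contDiffAt_id)
    exact ((ev.comp ((ContinuousMap.evalCLM ℝ (1 : I)).comp
      (volterra B))).contDiff).contDiffAt.comp 0 hwa
  rw [← funext hfw] at hfc
  exact hfc.analyticAt

theorem contDiff_infty_of_total_equation {E : Type*} [NormedAddCommGroup E] [NormedSpace ℝ E]
    [FiniteDimensional ℝ E] {Γ : E → E →L[ℝ] E →L[ℝ] E}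
    (hΓ : ContDiff ℝ ∞ Γ) {f : E → E} (hf : Differentiable ℝ f)
    (hM : ∀ x u, HasFDerivAt (fderiv ℝ f) (fderiv ℝ (fderiv ℝ f) x) x ∧
      fderiv ℝ (fderiv ℝ f) x u = (fderiv ℝ f x).comp (Γ x u)) :
    ContDiff ℝ ∞ f := by
  have hM' : ∀ j : ℕ, ContDiff ℝ j (fderiv ℝ f) := by
    intro j
    induction j with
    | zero => exact contDiff_zero.2 (continuous_iff_continuousAt.2 fun x => (hM x 0).1.continuousAt)
    | succ j ih =>
      rw [Nat.cast_add, Nat.cast_one, contDiff_succ_iff_fderiv]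
      refine ⟨fun x => (hM x 0).1.differentiableAt, fun h => ?_, ?_⟩
      · exact absurd h (by simp)
      · refine contDiff_clm_apply_iff.2 fun u => ?_
        simp only [(hM _ u).2]
        exact ih.clm_comp ((hΓ.of_le (by exact_mod_cast le_top)).clm_apply contDiff_const)
  rw [contDiff_infty]
  intro j
  have h1 : ContDiff ℝ ((j : WithTop ℕ∞) + 1) f := by
    rw [contDiff_succ_iff_fderiv]
    exact ⟨hf, fun h => absurd h (by simp), hM' j⟩
  exact h1.of_le le_self_add

end regularity

section smoothness

variable {n : ℕ} {h : BilinField n} {Φ : Euc n → Euc n}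

theorem IsRiemannianMetric.of_le {k l : WithTop ℕ∞} (hh : IsRiemannianMetric k h) (hl : l ≤ k) :
    IsRiemannianMetric l h := ⟨hh.contDiff.of_le hl, hh.symm, hh.pos⟩

theorem two_le_of_eq {k : WithTop ℕ∞} (hk : k = ∞ ∨ k = ω) : (2 : WithTop ℕ∞) ≤ k := by
  rcases hk with rfl | rfl
  · exact WithTop.coe_le_coe.2 le_top
  · exact le_top

theorem IsRiemannianMetric.exists_equiv {k : WithTop ℕ∞} (hh : IsRiemannianMetric k h)
    (p : StdTorus n) : ∃ e : Euc n ≃L[ℝ] (Euc n →L[ℝ] ℝ), h p = e := by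
  have hinj : Function.Injective (h p : Euc n →ₗ[ℝ] Euc n →L[ℝ] ℝ) := by
    rw [injective_iff_map_eq_zero]
    intro u hu
    by_contra h0
    have h1 := hh.pos p u h0
    have h2 : h p u = 0 := hu
    rw [h2] at h1
    exact lt_irrefl _ h1
  have hdim : Module.finrank ℝ (Euc n) = Module.finrank ℝ (Euc n →L[ℝ] ℝ) := by
    rw [← Subspace.dual_finrank_eq (K := ℝ) (V := Euc n)]
    exact (LinearMap.toContinuousLinearMap : (Euc n →ₗ[ℝ] ℝ) ≃ₗ[ℝ] Euc n →L[ℝ] ℝ).finrank_eq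
  exact ⟨(LinearMap.linearEquivOfInjective _ hinj hdim).toContinuousLinearEquiv, rfl⟩

/-- The Christoffel symbols in terms of a development. -/
noncomputable def christoffel (Φ : Euc n → Euc n) (x : Euc n) : Euc n →L[ℝ] Euc n →L[ℝ] Euc n :=
  ((ContinuousLinearMap.compL ℝ (Euc n) (Euc n) (Euc n)) (fderiv ℝ Φ x).inverse).comp
    (fderiv ℝ (fderiv ℝ Φ) x)

theorem christoffel_apply (x u v : Euc n) :
    christoffel Φ x u v = (fderiv ℝ Φ x).inverse (fderiv ℝ (fderiv ℝ Φ) x u v) := rfl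

theorem IsDevelopment.fderiv_christoffel (hh : IsRiemannianMetric 2 h)
    (hΦ : IsDevelopment h Set.univ Φ) (x u v : Euc n) :
    fderiv ℝ Φ x (christoffel Φ x u v) = fderiv ℝ (fderiv ℝ Φ) x u v := by
  obtain ⟨w, hw⟩ := hΦ.surjective hh (Set.mem_univ x) (fderiv ℝ (fderiv ℝ Φ) x u v)
  rw [christoffel_apply, ← hw, hΦ.inverse_apply hh]

theorem IsDevelopment.contDiff_christoffel {k : WithTop ℕ∞} (hk : k = ∞ ∨ k = ω)
    (hh : IsRiemannianMetric k h) (hΦ : IsDevelopment h Set.univ Φ) :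
    ContDiff ℝ k (christoffel Φ) := by
  have hh2 := hh.of_le (two_le_of_eq hk)
  have hk1 := add_one_le_of_eq hk
  refine contDiff_clm_apply_iff.2 fun u => contDiff_clm_apply_iff.2 fun v => ?_
  have h1 : ContDiff ℝ k fun x : Euc n => h (x : StdTorus n) (christoffel Φ x u v) := by
    refine contDiff_clm_apply_iff.2 fun w => ?_
    have h2 : ∀ x : Euc n, h (x : StdTorus n) (christoffel Φ x u v) w = koszul h x u v w :=
      fun x => by
        rw [hΦ.metric x (Set.mem_univ x), hΦ.fderiv_christoffel hh2,
          koszul_eq_inner hΦ.isOpen hΦ.contDiffOn hΦ.metric (Set.mem_univ x)]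
    simp only [h2]
    have h3 : ∀ a b c : Euc n, ContDiff ℝ k fun x : Euc n =>
        fderiv ℝ (fun y : Euc n => h (y : StdTorus n) a b) x c := fun a b c =>
      (((hh.contDiff.clm_apply contDiff_const).clm_apply contDiff_const).fderiv_right
        hk1).clm_apply contDiff_const
    exact (((h3 v w u).add (h3 u w v)).sub (h3 u v w)).div_const 2
  have h4 : ∀ x : Euc n, christoffel Φ x u v =
      (h (x : StdTorus n)).inverse (h (x : StdTorus n) (christoffel Φ x u v)) := fun x => by
    obtain ⟨e, he⟩ := hh.exists_equiv (x : StdTorus n)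
    rw [he, ContinuousLinearMap.inverse_equiv]
    simp
  rw [funext h4]
  refine ContDiff.clm_apply (contDiff_iff_contDiffAt.2 fun x => ?_) h1
  obtain ⟨e, he⟩ := hh.exists_equiv (x : StdTorus n)
  have h5 := contDiffAt_map_inverse (𝕜 := ℝ) (n := k) e
  rw [← he] at h5
  exact h5.comp x hh.contDiff.contDiffAt

/-- Developing maps are as smooth as the metric. -/
theorem IsDevelopment.contDiff {k : WithTop ℕ∞} (hk : k = ∞ ∨ k = ω)
    (hh : IsRiemannianMetric k h) (hΦ : IsDevelopment h Set.univ Φ) : ContDiff ℝ k Φ := by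
  have hh2 := hh.of_le (two_le_of_eq hk)
  have hd : Differentiable ℝ Φ := fun x => hΦ.differentiableAt (Set.mem_univ x)
  have hΓ := hΦ.contDiff_christoffel hk hh
  have hM : ∀ x, HasFDerivAt (fderiv ℝ Φ) (fderiv ℝ (fderiv ℝ Φ) x) x := fun x =>
    ((hΦ.contDiffAt_fderiv (Set.mem_univ x)).differentiableAt (by simp)).hasFDerivAt
  have hM' : ∀ x u, fderiv ℝ (fderiv ℝ Φ) x u = (fderiv ℝ Φ x).comp (christoffel Φ x u) :=
    fun x u => by
      ext1 v
      exact (hΦ.fderiv_christoffel hh2 x u v).symm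
  rcases hk with rfl | rfl
  · exact contDiff_infty_of_total_equation hΓ hd fun x u => ⟨hM x, hM' x u⟩
  · have ha : ∀ x, AnalyticAt ℝ Φ x := fun x => by
      have hx : ∀ y, HasFDerivAt (fun y : Euc n => x + y) (ContinuousLinearMap.id ℝ (Euc n)) y :=
        fun y => (hasFDerivAt_id y).const_add x
      have h1 : AnalyticAt ℝ (fun y => Φ (x + y)) 0 := by
        refine analyticAt_of_total_equation (B := Euc n →L[ℝ] Euc n)
          (fun i => EuclideanSpace.proj (𝕜 := ℝ) i) (fun i => EuclideanSpace.single i 1)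
          (fun y => ?_) (Γ := fun y => christoffel Φ (x + y))
          (hΓ.comp (contDiff_const.add contDiff_id))
          (M := fun y => fderiv ℝ Φ (x + y)) (M' := fun y => fderiv ℝ (fderiv ℝ Φ) (x + y))
          (fun y => ?_) (fun y u => hM' _ u) (ContinuousLinearMap.id ℝ _) (fun y => ?_)
        · ext j
          simp [Pi.single_apply]
        · have h2 := (hM (x + y)).comp y (hx y)
          rw [ContinuousLinearMap.comp_id] at h2
          exact h2
        · have h2 := (hd (x + y)).hasFDerivAt.comp y (hx y)
          rw [ContinuousLinearMap.comp_id] at h2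
          exact h2
      have h2 : AnalyticAt ℝ (fun y : Euc n => y - x) x := by fun_prop
      have h3 : AnalyticAt ℝ ((fun y => Φ (x + y)) ∘ fun y : Euc n => y - x) x := by
        refine AnalyticAt.comp ?_ h2
        simpa using h1
      simpa [Function.comp_def] using h3
    exact contDiff_iff_contDiffAt.2 fun x => (ha x).contDiffAt

end smoothness

section globalInverse

variable {n : ℕ}

theorem contDiff_globalInverse {k : WithTop ℕ∞} (hk0 : k ≠ 0) {Φ : Euc n → Euc n}
    (hΦ : ContDiff ℝ k Φ) (hinv : ∀ x, ∃ e : Euc n ≃L[ℝ] Euc n, fderiv ℝ Φ x = e)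
    (A : Euc n ≃L[ℝ] Euc n) (hA : LatticePeriodic fun x => Φ x - A x) :
    ∃ F : Euc n → Euc n, ContDiff ℝ k F ∧ (∀ x, F (Φ x) = x) ∧ ∀ y, Φ (F y) = y := by
  have hd : Differentiable ℝ Φ := hΦ.differentiable hk0
  obtain ⟨C, hC⟩ := LatticePeriodic.exists_norm_le (hd.continuous.sub A.continuous) hA
  have hprop : IsProperMap Φ := by
    rw [isProperMap_iff_tendsto_cocompact]
    refine ⟨hd.continuous, ?_⟩
    rw [← Metric.cobounded_eq_cocompact, ← tendsto_norm_atTop_iff_cobounded]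
    have h1 : Filter.Tendsto (fun x => ‖A x‖) (Bornology.cobounded (Euc n)) Filter.atTop :=
      tendsto_norm_atTop_iff_cobounded.2 A.antilipschitz.tendsto_cobounded
    refine Filter.tendsto_atTop_mono (fun x => ?_)
      (Filter.tendsto_atTop_add_const_right _ (-C) h1)
    have h2 := norm_sub_norm_le (A x) (Φ x)
    have h3 := hC x
    rw [Pi.sub_apply, norm_sub_rev] at h3
    linarith
  have hloc : ∀ x, ∃ e : OpenPartialHomeomorph (Euc n) (Euc n), x ∈ e.source ∧ e = Φ := fun x => by
    obtain ⟨e, he⟩ := hinv x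
    have h1 : HasFDerivAt Φ (e : Euc n →L[ℝ] Euc n) x := he ▸ (hd x).hasFDerivAt
    exact ⟨hΦ.contDiffAt.toOpenPartialHomeomorph Φ h1 hk0,
      hΦ.contDiffAt.mem_toOpenPartialHomeomorph_source h1 hk0,
      hΦ.contDiffAt.toOpenPartialHomeomorph_coe h1 hk0⟩
  have hcov : IsCoveringMap Φ := by
    rw [isCoveringMap_iff_isCoveringMapOn_univ]
    refine hprop.isClosedMap.isCoveringMapOn_of_isLocalHomeomorphOn (fun y _ => ?_) fun x _ => ?_
    · exact (hprop.isCompact_preimage isCompact_singleton).finite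
        (.of_openPartialHomeomorph Φ subset_rfl fun x _ => hloc x)
    · obtain ⟨e, he, h⟩ := hloc x
      exact ⟨e, he, h.symm⟩
  obtain ⟨F, ⟨hF0, hF⟩, -⟩ := hcov.existsUnique_continuousMap_lifts (ContinuousMap.id (Euc n))
    (Φ 0) 0 rfl
  have hΦF : ∀ y, Φ (F y) = y := fun y => congrFun hF y
  have hFΦ : ∀ x, F (Φ x) = x := fun x => by
    have h1 := hcov.eq_of_comp_eq (g₁ := F ∘ Φ) (g₂ := id) (F.continuous.comp hd.continuous)
      continuous_id (funext fun x => hΦF (Φ x)) 0 hF0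
    exact congrFun h1 x
  let H : Euc n ≃ₜ Euc n :=
    { toFun := Φ
      invFun := F
      left_inv := hFΦ
      right_inv := hΦF
      continuous_toFun := hd.continuous
      continuous_invFun := F.continuous }
  refine ⟨F, contDiff_iff_contDiffAt.2 fun y => ?_, hFΦ, hΦF⟩
  obtain ⟨e, he⟩ := hinv (F y)
  exact H.toOpenPartialHomeomorph.contDiffAt_symm (f₀' := e) (a := y) (Set.mem_univ y)
    (he ▸ (hd (F y)).hasFDerivAt) hΦ.contDiffAt

theorem sub_mem_of_fderiv_mem {R S : Submodule ℝ (Euc n)} {g : Euc n → Euc n}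
    (hg : Differentiable ℝ g) (hRS : ∀ y, ∀ u ∈ R, fderiv ℝ g y u ∈ S) (y : Euc n) {u : Euc n}
    (hu : u ∈ R) : g (y + u) - g y ∈ S := by
  set N := Sᗮ.starProjection with hN
  have hNS : ∀ q, N q = 0 ↔ q ∈ S := fun q => by
    rw [hN, Submodule.starProjection_apply_eq_zero_iff, Submodule.orthogonal_orthogonal]
  have h1 : ∀ s : ℝ, HasDerivAt (fun s : ℝ => N (g (y + s • u))) 0 s := fun s => by
    have h1 : HasDerivAt (fun s : ℝ => y + s • u) u s := by
      simpa using ((hasDerivAt_id s).smul_const u).const_add y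
    have h2 := N.hasFDerivAt.comp_hasDerivAt s ((hg (y + s • u)).hasFDerivAt.comp_hasDerivAt s h1)
    have h3 : N (fderiv ℝ g (y + s • u) u) = 0 := (hNS _).2 (hRS _ u hu)
    rwa [h3] at h2
  have h2 := is_const_of_deriv_eq_zero (fun s => (h1 s).differentiableAt) (fun s => (h1 s).deriv) 1 0
  rw [← hNS, map_sub, sub_eq_zero]
  simpa using h2

end globalInverse

section linearModelOfMetric

variable {n : ℕ} {P : Submodule ℝ (Euc n)} {J : StdTorus n → P →ₗ[ℝ] P}

/-- The diffeomorphism of tori induced by an equivariant diffeomorphism of the coverings. -/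
def torusDiffeoOfLift {k : WithTop ℕ∞} {G H : AddSubgroup (Euc n)} (Φ F : Euc n → Euc n)
    (hΦ : ContDiff ℝ k Φ) (hF : ContDiff ℝ k F) (hFΦ : ∀ x, F (Φ x) = x) (hΦF : ∀ y, Φ (F y) = y)
    (h₁ : ∀ x y, -x + y ∈ G → -Φ x + Φ y ∈ H) (h₂ : ∀ x y, -x + y ∈ H → -F x + F y ∈ G) :
    TorusDiffeo k G H where
  toEquiv :=
    { toFun := Quotient.map' Φ fun x y hxy => by
        rw [QuotientAddGroup.leftRel_apply] at hxy ⊢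
        exact h₁ x y hxy
      invFun := Quotient.map' F fun x y hxy => by
        rw [QuotientAddGroup.leftRel_apply] at hxy ⊢
        exact h₂ x y hxy
      left_inv := by
        rintro ⟨x⟩
        exact congrArg (QuotientAddGroup.mk (s := G)) (hFΦ x)
      right_inv := by
        rintro ⟨y⟩
        exact congrArg (QuotientAddGroup.mk (s := H)) (hΦF y) }
  lift := Φ
  invLift := F
  contDiff_lift := hΦ
  contDiff_invLift := hF
  coe_lift _ := rfl
  coe_invLift _ := rfl

theorem hasLinearModel_of_hasAdaptedEuclideanMetric {k : WithTop ℕ∞} (hk : k = ∞ ∨ k = ω)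
    (hP : Module.finrank ℝ P = 2) (hJ : IsLeafComplexStructure P J)
    (h : HasAdaptedEuclideanMetric k P J) : HasLinearModel k P J := by
  obtain ⟨h, hh, hE, hTG, hhJ⟩ := h
  have hh2 := hh.of_le (two_le_of_eq hk)
  have hk0 : k ≠ 0 := by rcases hk with rfl | rfl <;> simp
  obtain ⟨Φ, hdev⟩ := exists_development hh2 hE
  have hΦ := hdev.contDiff hk hh
  obtain ⟨A, hA⟩ := hdev.exists_linear_part hh2
  set Q := P.map ((A : Euc n →L[ℝ] Euc n) : Euc n →ₗ[ℝ] Euc n) with hQ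
  have hmap := hdev.map_eq hh2 hTG A hA
  obtain ⟨J₀, hJ₀, hJ₀i, hJ₀Φ⟩ := hdev.exists_rotation hP hh2 hmap hJ hhJ
  obtain ⟨F, hF, hFΦ, hΦF⟩ := contDiff_globalInverse hk0 hΦ
    (fun x => hdev.exists_equiv hh2 (Set.mem_univ x)) A hA
  have hΦγ : ∀ x, ∀ γ ∈ periodLattice n, Φ (x + γ) = Φ x + A γ := fun x γ hγ => by
    have h1 : Φ (x + γ) - A (x + γ) = Φ x - A x := hA x γ hγ
    rw [map_add] at h1
    rw [eq_add_of_sub_eq h1]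
    abel
  let G : AddSubgroup (Euc n) :=
    (periodLattice n).map ((A : Euc n →L[ℝ] Euc n) : Euc n →ₗ[ℝ] Euc n).toAddMonoidHom
  have hG : ∀ y, y ∈ G ↔ ∃ γ ∈ periodLattice n, A γ = y := fun y => Iff.rfl
  let φ : TorusDiffeo k (periodLattice n) G := torusDiffeoOfLift Φ F hΦ hF hFΦ hΦF
    (fun x y hxy => (hG _).2 ⟨_, hxy, by
      have := hΦγ x _ hxy
      rw [add_neg_cancel_left] at this
      rw [this, neg_add_cancel_left]⟩)
    (fun x y hxy => by
      obtain ⟨γ, hγ, h1⟩ := (hG _).1 hxy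
      have h2 := hΦγ (F x) γ hγ
      rw [hΦF, h1, add_neg_cancel_left] at h2
      rw [← h2, hFΦ]
      simpa using hγ)
  obtain ⟨hdisc, hrank⟩ := discreteTopology_of_mem_iff_span
    ((latticeBasis n).map A.toLinearEquiv) G fun y => by
    have h1 : Set.range ((latticeBasis n).map A.toLinearEquiv) =
        (A.toLinearEquiv.toLinearMap.restrictScalars ℤ) '' Set.range (latticeBasis n) := by
      rw [← Set.range_comp]
      congr 1
    rw [h1, Submodule.span_image, hG, Submodule.mem_map]
    simp only [mem_periodLattice_iff]
    rfl
  refine ⟨G, φ, Q, J₀, hdisc, hrank, ?_, fun p => ?_, hJ₀, hJ₀i, hJ₀Φ⟩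
  · rw [← hP]
    exact (Submodule.equivMapOfInjective _ A.injective P).finrank_eq.symm
  · obtain ⟨x, rfl⟩ := QuotientAddGroup.mk_surjective p
    have hΦm : ∀ v ∈ P, Φ (x + v) - Φ x ∈ Q := fun v hv =>
      sub_mem_of_fderiv_mem (hΦ.differentiable hk0)
        (fun y u hu => by rw [hQ, ← hmap y]; exact ⟨u, hu, rfl⟩) x hv
    have hFm : ∀ w ∈ Q, F (Φ x + w) - F (Φ x) ∈ P := fun w hw =>
      sub_mem_of_fderiv_mem (hF.differentiable hk0) (fun y u hu => by
        rw [hQ, ← hmap (F y)] at hu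
        obtain ⟨v, hv, rfl⟩ := hu
        have h1 := ((hF.differentiable hk0 (Φ (F y))).hasFDerivAt).comp (F y)
          (hΦ.differentiable hk0 (F y)).hasFDerivAt
        have h2 : F ∘ Φ = id := funext hFΦ
        rw [h2] at h1
        have h3 := congrArg (fun L : Euc n →L[ℝ] Euc n => L v) (h1.unique (hasFDerivAt_id _))
        rw [hΦF] at h3
        have h4 : fderiv ℝ F y (fderiv ℝ Φ (F y) v) = v := h3
        change fderiv ℝ F y (fderiv ℝ Φ (F y) v) ∈ P
        rw [h4]
        exact hv) (Φ x) hw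
    ext q
    constructor
    · rintro ⟨_, ⟨v, hv, rfl⟩, rfl⟩
      refine ⟨_, hΦm v hv, ?_⟩
      change ((Φ (x + v) : Euc n) : QuotientTorus G) =
        ((Φ x + (Φ (x + v) - Φ x) : Euc n) : QuotientTorus G)
      rw [add_sub_cancel]
    · rintro ⟨w, hw, rfl⟩
      refine ⟨((x + (F (Φ x + w) - F (Φ x)) : Euc n) : StdTorus n), ⟨_, hFm w hw, rfl⟩, ?_⟩
      change ((Φ (x + (F (Φ x + w) - F (Φ x))) : Euc n) : QuotientTorus G) =
        ((Φ x + w : Euc n) : QuotientTorus G)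
      rw [hFΦ, add_sub_cancel, hΦF]

end linearModelOfMetric

section decay

variable {n : ℕ}

/-- Fourier coefficients that decay faster than every power of the weight. -/
def RapidDecay (a : (Fin n → ℤ) → ℂ) : Prop := ∀ N : ℕ, Summable fun m => ‖a m‖ * weight m ^ N

theorem RapidDecay.summable {a : (Fin n → ℤ) → ℂ} (ha : RapidDecay a) : Summable a :=
  Summable.of_norm (by simpa using ha 0)

theorem RapidDecay.add {a b : (Fin n → ℤ) → ℂ} (ha : RapidDecay a) (hb : RapidDecay b) :
    RapidDecay fun m => a m + b m := fun N => by
  refine Summable.of_nonneg_of_le (fun m => ?_) (fun m => ?_) ((ha N).add (hb N))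
  · have := (weight_pos m).le
    positivity
  · rw [← add_mul]
    have := (weight_pos m).le
    gcongr
    exact norm_add_le _ _

theorem rapidDecay_single (m₀ : Fin n → ℤ) (c : ℂ) :
    RapidDecay fun m => if m = m₀ then c else 0 := fun N => by
  refine summable_of_hasFiniteSupport ((Set.finite_singleton m₀).subset fun m hm => ?_)
  by_contra h
  simp [Set.mem_singleton_iff.not.1 h] at hm

theorem abs_freq_le (m : Fin n → ℤ) (e : Euc n) : |freq m e| ≤ n * ‖e‖ * weight m := by
  rw [freq_apply]
  refine (Finset.abs_sum_le_sum_abs _ _).trans ?_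
  have h : ∀ i ∈ Finset.univ, |(m i : ℝ) * e i| ≤ ‖e‖ * weight m := fun i _ => by
    rw [abs_mul, mul_comm]
    have := PiLp.norm_apply_le e i
    have := abs_le_weight m i
    rw [← Real.norm_eq_abs (e i)]
    gcongr
  refine (Finset.sum_le_sum h).trans_eq ?_
  simp [mul_assoc]

theorem RapidDecay.mul_freq {a : (Fin n → ℤ) → ℂ} (ha : RapidDecay a) (e : Euc n) :
    RapidDecay fun m => Complex.I * freq m e * a m := fun N => by
  refine Summable.of_nonneg_of_le (fun m => ?_) (fun m => ?_) ((ha (N + 1)).mul_left (n * ‖e‖))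
  · have := (weight_pos m).le
    positivity
  · have := (weight_pos m).le
    rw [norm_mul, norm_mul, Complex.norm_I, one_mul, Complex.norm_real, Real.norm_eq_abs]
    calc |freq m e| * ‖a m‖ * weight m ^ N ≤ (n * ‖e‖ * weight m) * ‖a m‖ * weight m ^ N := by
          gcongr
          exact abs_freq_le m e
      _ = _ := by ring

theorem RapidDecay.hasFDerivAt_synth {a : (Fin n → ℤ) → ℂ} (ha : RapidDecay a) (x : Euc n) :
    ∃ L : Euc n →L[ℝ] ℂ, HasFDerivAt (synth a) L x ∧
      ∀ e, L e = synth (fun m => Complex.I * freq m e * a m) x := by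
  have hs : Summable fun m => n * (‖a m‖ * weight m ^ 1) := (ha 1).mul_left _
  have hd : ∀ m (x : Euc n), HasFDerivAt (fun x => a m * chr m x) (a m • fderiv ℝ (chr m) x) x :=
    fun m x => (differentiable_chr m x).hasFDerivAt.const_mul (a m)
  have he : ∀ m (x e : Euc n), fderiv ℝ (chr m) x e = Complex.I * freq m e * chr m x :=
    fun m x e => by
      rw [(hasFDerivAt_chr m x).fderiv]
      simp
      ring
  have hb : ∀ m (x : Euc n), ‖a m • fderiv ℝ (chr m) x‖ ≤ n * (‖a m‖ * weight m ^ 1) := fun m x => by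
    have hw := (weight_pos m).le
    rw [norm_smul, pow_one, mul_left_comm]
    gcongr
    refine ContinuousLinearMap.opNorm_le_bound _ (by positivity) fun e => ?_
    rw [he, norm_mul, norm_mul, norm_chr, Complex.norm_I, one_mul, mul_one, Complex.norm_real,
      Real.norm_eq_abs]
    exact (abs_freq_le m e).trans_eq (by ring)
  refine ⟨_, hasFDerivAt_tsum hs hd hb (hasSum_synth ha.summable 0).summable x, fun e => ?_⟩
  have h1 : Summable fun m => a m • fderiv ℝ (chr m) x :=
    Summable.of_norm_bounded hs fun m => hb m x
  have h2 := ((ContinuousLinearMap.apply ℝ ℂ e).hasSum h1.hasSum).tsum_eq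
  refine h2.symm.trans (tsum_congr fun m => ?_)
  change a m * fderiv ℝ (chr m) x e = _
  rw [he]
  ring

theorem RapidDecay.fderiv_synth {a : (Fin n → ℤ) → ℂ} (ha : RapidDecay a) (x e : Euc n) :
    fderiv ℝ (synth a) x e = synth (fun m => Complex.I * freq m e * a m) x := by
  obtain ⟨L, hL, h⟩ := ha.hasFDerivAt_synth x
  rw [hL.fderiv, h]

theorem RapidDecay.contDiff_synth {a : (Fin n → ℤ) → ℂ} (ha : RapidDecay a) :
    ContDiff ℝ ∞ (synth a) := by
  rw [contDiff_infty]
  intro N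
  induction N generalizing a with
  | zero =>
    exact contDiff_zero.2 (continuous_iff_continuousAt.2 fun x => by
      obtain ⟨L, hL, -⟩ := ha.hasFDerivAt_synth x
      exact hL.continuousAt)
  | succ N ih =>
    rw [Nat.cast_add, Nat.cast_one, contDiff_succ_iff_fderiv]
    refine ⟨fun x => ?_, fun h => absurd h (by simp), contDiff_clm_apply_iff.2 fun e => ?_⟩
    · obtain ⟨L, hL, -⟩ := ha.hasFDerivAt_synth x
      exact hL.differentiableAt
    · simp only [ha.fderiv_synth]
      exact ih (ha.mul_freq e)

end decay

section leafMetric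

variable {n : ℕ} {P : Submodule ℝ (Euc n)}

/-- The complex coordinate `c₁ + τ c₂` on a plane with a frame. -/
noncomputable def PlaneFrame.coord (f : PlaneFrame P) (τ : ℂ) : Euc n →L[ℝ] ℂ :=
  Complex.ofRealCLM.comp f.c₁ + τ • Complex.ofRealCLM.comp f.c₂

theorem PlaneFrame.coord_apply (f : PlaneFrame P) (τ : ℂ) (u : Euc n) :
    f.coord τ u = f.c₁ u + τ * f.c₂ u := rfl

theorem PlaneFrame.coord_eq_zero (f : PlaneFrame P) {τ : ℂ} (hτ : 0 < τ.im) {u : Euc n}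
    (h : f.coord τ u = 0) : f.c₁ u = 0 ∧ f.c₂ u = 0 := by
  rw [coord_apply] at h
  have h1 := congrArg Complex.im h
  have h2 := congrArg Complex.re h
  simp at h1 h2
  have h3 : f.c₂ u = 0 := h1.resolve_left hτ.ne'
  simp [h3] at h2
  exact ⟨h2, h3⟩

/-- The complex structure on a plane for which `c₁ + τ c₂` is a complex coordinate. -/
noncomputable def PlaneFrame.rotation (f : PlaneFrame P) (τ : ℂ) : P →ₗ[ℝ] P :=
  ((-τ.re / τ.im) • ((f.c₁ : Euc n →ₗ[ℝ] ℝ) ∘ₗ P.subtype) +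
    (-(τ.re * τ.re + τ.im * τ.im) / τ.im) • ((f.c₂ : Euc n →ₗ[ℝ] ℝ) ∘ₗ P.subtype)).smulRight f.e₁ +
  ((1 / τ.im) • ((f.c₁ : Euc n →ₗ[ℝ] ℝ) ∘ₗ P.subtype) +
    (τ.re / τ.im) • ((f.c₂ : Euc n →ₗ[ℝ] ℝ) ∘ₗ P.subtype)).smulRight f.e₂

theorem PlaneFrame.rotation_apply (f : PlaneFrame P) (τ : ℂ) (u : P) :
    f.rotation τ u = (-τ.re / τ.im * f.c₁ u + -(τ.re * τ.re + τ.im * τ.im) / τ.im * f.c₂ u) • f.e₁ +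
      (1 / τ.im * f.c₁ u + τ.re / τ.im * f.c₂ u) • f.e₂ := rfl

theorem PlaneFrame.coord_rotation (f : PlaneFrame P) {τ : ℂ} (hτ : 0 < τ.im) (u : P) :
    f.coord τ (f.rotation τ u) = Complex.I * f.coord τ u := by
  rw [rotation_apply, coord_apply, coord_apply]
  have h := hτ.ne'
  simp only [Submodule.coe_add, Submodule.coe_smul, map_add, map_smul, f.c₁_e₁, f.c₁_e₂, f.c₂_e₁,
    f.c₂_e₂]
  apply Complex.ext
  · simp
    field_simp
    ring
  · simp
    field_simp

theorem PlaneFrame.rotation_sq (f : PlaneFrame P) {τ : ℂ} (hτ : 0 < τ.im) (u : P) :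
    f.rotation τ (f.rotation τ u) = -u := by
  have h1 : f.coord τ ((f.rotation τ (f.rotation τ u) + u : P) : Euc n) = 0 := by
    rw [Submodule.coe_add, map_add, f.coord_rotation hτ, f.coord_rotation hτ]
    linear_combination f.coord τ u * Complex.I_sq
  obtain ⟨h2, h3⟩ := f.coord_eq_zero hτ h1
  have h4 := f.decomp (f.rotation τ (f.rotation τ u) + u)
  rw [h2, h3, zero_smul, zero_smul, add_zero] at h4
  exact eq_neg_of_add_eq_zero_left h4

/-- The projection along a plane. -/
noncomputable def PlaneFrame.remainder (f : PlaneFrame P) : Euc n →L[ℝ] Euc n :=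
  ContinuousLinearMap.id ℝ (Euc n) - f.c₁.smulRight (f.e₁ : Euc n) - f.c₂.smulRight (f.e₂ : Euc n)

theorem PlaneFrame.remainder_apply (f : PlaneFrame P) (u : Euc n) :
    f.remainder u = u - f.c₁ u • (f.e₁ : Euc n) - f.c₂ u • (f.e₂ : Euc n) := rfl

theorem PlaneFrame.remainder_mem (f : PlaneFrame P) (u : P) : f.remainder u = 0 := by
  have h := congrArg Subtype.val (f.decomp u)
  simp only [Submodule.coe_add, Submodule.coe_smul] at h
  rw [remainder_apply, sub_sub, sub_eq_zero]
  exact h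

/-- The real inner product of `ℂ` as a bilinear form. -/
noncomputable def complexInner : ℂ →L[ℝ] ℂ →L[ℝ] ℝ :=
  (isBoundedBilinearMap_inner (𝕜 := ℝ) (E := ℂ)).toContinuousLinearMap

/-- An inner product that is conformal on the plane for the complex coordinate `c₁ + τ c₂`. -/
noncomputable def PlaneFrame.metric (f : PlaneFrame P) (τ : ℂ) : Euc n →L[ℝ] Euc n →L[ℝ] ℝ :=
  complexInner.bilinearComp (f.coord τ) (f.coord τ) +
    (innerBilin n).bilinearComp f.remainder f.remainder

theorem PlaneFrame.metric_apply (f : PlaneFrame P) (τ : ℂ) (u v : Euc n) :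
    f.metric τ u v = ⟪f.coord τ u, f.coord τ v⟫ + ⟪f.remainder u, f.remainder v⟫ := rfl

theorem PlaneFrame.isRiemannianMetric (f : PlaneFrame P) {k : WithTop ℕ∞} {τ : StdTorus n → ℂ}
    (hτ : ContDiff ℝ k fun x : Euc n => τ (x : StdTorus n)) (him : ∀ p, 0 < (τ p).im) :
    IsRiemannianMetric k fun p => f.metric (τ p) := by
  refine ⟨?_, fun p u v => ?_, fun p u hu => ?_⟩
  · refine contDiff_clm_apply_iff.2 fun u => contDiff_clm_apply_iff.2 fun v => ?_
    simp only [metric_apply, coord_apply]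
    have h : ∀ u : Euc n, ContDiff ℝ k fun x : Euc n =>
        (f.c₁ u : ℂ) + τ (x : StdTorus n) * f.c₂ u := fun u =>
      contDiff_const.add (hτ.mul contDiff_const)
    exact ((h u).inner ℝ (h v)).add contDiff_const
  · rw [metric_apply, metric_apply, real_inner_comm, real_inner_comm (f.remainder u)]
  · rw [metric_apply]
    have h1 : 0 ≤ ⟪f.coord (τ p) u, f.coord (τ p) u⟫ := real_inner_self_nonneg
    have h2 : 0 ≤ ⟪f.remainder u, f.remainder u⟫ := real_inner_self_nonneg
    by_contra hcon
    have h3 : ⟪f.coord (τ p) u, f.coord (τ p) u⟫ = 0 := by linarith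
    have h4 : ⟪f.remainder u, f.remainder u⟫ = 0 := by linarith
    rw [inner_self_eq_zero] at h3 h4
    obtain ⟨h5, h6⟩ := f.coord_eq_zero (him p) h3
    rw [remainder_apply, h5, h6, zero_smul, zero_smul, sub_zero, sub_zero] at h4
    exact hu h4

theorem PlaneFrame.isLeafComplexStructure (f : PlaneFrame P) {τ : StdTorus n → ℂ}
    (hτ : Continuous fun x : Euc n => τ (x : StdTorus n)) (him : ∀ p, 0 < (τ p).im) :
    IsLeafComplexStructure P fun p => f.rotation (τ p) := by
  have hτ' : Continuous τ := (QuotientAddGroup.isQuotientMap_mk _).continuous_iff.2 hτ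
  have hre : Continuous fun p => (τ p).re := Complex.continuous_re.comp hτ'
  have him' : Continuous fun p => (τ p).im := Complex.continuous_im.comp hτ'
  refine ⟨fun p u => f.rotation_sq (him p) u, fun u => ?_⟩
  simp only [rotation_apply, Submodule.coe_add, Submodule.coe_smul]
  have h0 : ∀ p, (τ p).im ≠ 0 := fun p => (him p).ne'
  have h1 : Continuous fun p => -(τ p).re / (τ p).im * f.c₁ u +
      -((τ p).re * (τ p).re + (τ p).im * (τ p).im) / (τ p).im * f.c₂ u :=
    ((hre.neg.div him' h0).mul continuous_const).add
      ((((hre.mul hre).add (him'.mul him')).neg.div him' h0).mul continuous_const)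
  have h2 : Continuous fun p => 1 / (τ p).im * f.c₁ u + (τ p).re / (τ p).im * f.c₂ u :=
    ((continuous_const.div him' h0).mul continuous_const).add
      ((hre.div him' h0).mul continuous_const)
  exact (h1.smul continuous_const).add (h2.smul continuous_const)

theorem PlaneFrame.isLeafConformal (f : PlaneFrame P) {τ : StdTorus n → ℂ}
    (him : ∀ p, 0 < (τ p).im) :
    IsLeafConformal P (fun p => f.rotation (τ p)) fun p => f.metric (τ p) := fun p u v => by
  simp only [metric_apply, f.remainder_mem, f.coord_rotation (him p), Complex.inner, map_mul,
    Complex.conj_I]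
  congr 2
  linear_combination (-(starRingEnd ℂ) (f.coord (τ p) u) * f.coord (τ p) v) * Complex.I_sq

end leafMetric

section smallFrequencies

variable {n : ℕ}

theorem weight_le_sum_abs {m : Fin n → ℤ} (hm : m ≠ 0) :
    weight m ≤ (2 * (∑ j, |(m j : ℝ)|) ^ 2) ^ n := by
  have h1 := one_le_sum_abs hm
  have h2 : ∀ i ∈ Finset.univ, 1 + (m i : ℝ) ^ 2 ≤ 2 * (∑ j, |(m j : ℝ)|) ^ 2 := fun i _ => by
    have h3 : |(m i : ℝ)| ≤ ∑ j, |(m j : ℝ)| :=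
      Finset.single_le_sum (f := fun j => |(m j : ℝ)|) (fun _ _ => abs_nonneg _) (Finset.mem_univ i)
    rw [← sq_abs (m i : ℝ)]
    have h4 : |(m i : ℝ)| ^ 2 ≤ (∑ j, |(m j : ℝ)|) ^ 2 := by gcongr
    nlinarith
  refine (Finset.prod_le_prod (fun i _ => by positivity) h2).trans_eq ?_
  simp

theorem exists_small_freq {P : Submodule ℝ (Euc n)} (hP : Module.finrank ℝ P = 2)
    (hD : ¬ IsDiophantine P) : ∃ f : PlaneFrame P, ∀ ε : ℝ, 0 < ε → ∀ k : ℕ,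
      ∃ m : Fin n → ℤ, m ≠ 0 ∧
        (|freq m (f.e₁ : Euc n)| + |freq m (f.e₂ : Euc n)|) * weight m ^ k ≤ ε := by
  obtain ⟨i₁, i₂, a₁, a₂, hi, hPg⟩ := exists_graph_coordinates hP
  refine ⟨graphFrame hi hPg, fun ε hε k => ?_⟩
  by_contra! hcon
  refine hD ⟨i₁, i₂, a₁, a₂, hi, hPg, ε / 2 ^ (n * k), ((2 * (n * k) + 2 : ℕ) : ℝ), by positivity,
    by push_cast; nlinarith [(by positivity : (0:ℝ) ≤ n * k)], fun m hm => ?_⟩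
  have h1 := one_le_sum_abs hm
  have h2 := hcon m hm
  have hpair : ({i₂, i₁} : Finset (Fin n)) = {i₁, i₂} := Finset.pair_comm _ _
  rw [← freq_graphVec hi, ← hpair, ← freq_graphVec hi.symm, Real.rpow_natCast, div_div]
  change ε < (|freq m (graphVec i₁ i₂ a₁)| + |freq m (graphVec i₂ i₁ a₂)|) * weight m ^ k at h2
  have h3 : weight m ^ k ≤ 2 ^ (n * k) * (∑ j, |(m j : ℝ)|) ^ (2 * (n * k) + 2) := by
    calc weight m ^ k ≤ ((2 * (∑ j, |(m j : ℝ)|) ^ 2) ^ n) ^ k := by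
          have := (weight_pos m).le
          gcongr
          exact weight_le_sum_abs hm
      _ = 2 ^ (n * k) * (∑ j, |(m j : ℝ)|) ^ (2 * (n * k)) := by
          rw [← pow_mul, mul_pow, ← pow_mul]
      _ ≤ _ := by
          gcongr
          omega
  rw [div_lt_iff₀ (by positivity)]
  exact h2.trans_le (by gcongr)

theorem RapidDecay.indicator_range {a : (Fin n → ℤ) → ℂ} {μ : ℕ → Fin n → ℤ} {ε : ℝ}
    (h : ∀ k, ‖a (μ k)‖ * weight (μ k) ^ k ≤ ε * (1 / 2) ^ k) :
    RapidDecay ((Set.range μ).indicator a) ∧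
      ∑' m, ‖(Set.range μ).indicator a m‖ ≤ 2 * ε := by
  choose κ hκ using fun m : Set.range μ => m.2
  have hinj : Function.Injective κ := fun m m' hm =>
    Subtype.ext (by rw [← hκ m, ← hκ m', hm])
  have hgeo : Summable fun k : ℕ => ε * (1 / 2 : ℝ) ^ k := summable_geometric_two.mul_left ε
  have hle : ∀ N k, N ≤ k → ‖a (μ k)‖ * weight (μ k) ^ N ≤ ε * (1 / 2) ^ k := fun N k hk => by
    refine le_trans ?_ (h k)
    gcongr
    exact one_le_weight _
  have hpos : ∀ N m, 0 ≤ ‖a m‖ * weight m ^ N := fun N m => by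
    have := weight_pos m
    positivity
  have hsum : ∀ N, Summable fun k => ‖a (μ k)‖ * weight (μ k) ^ N := fun N => by
    rw [← summable_nat_add_iff N]
    refine Summable.of_nonneg_of_le (fun k => hpos _ _) (fun k => hle N _ (by omega))
      ((summable_nat_add_iff N).2 hgeo)
  have hind : ∀ N, (fun m => ‖(Set.range μ).indicator a m‖ * weight m ^ N) =
      (Set.range μ).indicator fun m => ‖a m‖ * weight m ^ N := fun N => by
    ext m
    by_cases hm : m ∈ Set.range μ <;> simp [hm]
  have hsub : ∀ N, (fun m : Set.range μ => ‖a m‖ * weight (m : Fin n → ℤ) ^ N) =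
      (fun k => ‖a (μ k)‖ * weight (μ k) ^ N) ∘ κ := fun N => by
    ext m
    simp only [Function.comp_apply, hκ]
  refine ⟨fun N => ?_, ?_⟩
  · rw [hind, ← summable_subtype_iff_indicator]
    change Summable fun m : Set.range μ => ‖a m‖ * weight (m : Fin n → ℤ) ^ N
    rw [hsub]
    exact (hsum N).comp_injective hinj
  · have h1 : (fun m => ‖(Set.range μ).indicator a m‖) =
        (Set.range μ).indicator fun m => ‖a m‖ * weight m ^ 0 := by
      rw [← hind]
      simp
    rw [h1, ← tsum_subtype, hsub]
    refine (tsum_comp_le_tsum_of_inj (hsum 0) (fun k => hpos _ _) hinj).trans ?_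
    refine ((hsum 0).tsum_le_tsum (fun k => hle 0 k (by omega)) hgeo).trans_eq ?_
    rw [tsum_mul_left, tsum_geometric_two, mul_comm]

theorem exists_small_spectrum {e₁ e₂ : Euc n} {ε : ℝ} (hε : 0 < ε)
    (h : ∀ ε : ℝ, 0 < ε → ∀ k : ℕ, ∃ m : Fin n → ℤ, m ≠ 0 ∧
      (|freq m e₁| + |freq m e₂|) * weight m ^ k ≤ ε)
    (hres : ∀ m : Fin n → ℤ, m ≠ 0 → freq m e₁ = 0 → freq m e₂ ≠ 0) :
    ∃ S : Set (Fin n → ℤ), S.Infinite ∧ 0 ∉ S ∧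
      (RapidDecay (S.indicator fun m => Complex.I * freq m e₁) ∧
        ∑' m, ‖S.indicator (fun m => Complex.I * (freq m e₁ : ℂ)) m‖ ≤ 2 * ε) ∧
      (RapidDecay (S.indicator fun m => Complex.I * freq m e₂) ∧
        ∑' m, ‖S.indicator (fun m => Complex.I * (freq m e₂ : ℂ)) m‖ ≤ 2 * ε) := by
  choose μ hμ0 hμ using fun k : ℕ => h (ε * (1 / 2) ^ k) (by positivity) k
  have hn : ∀ m (e : Euc n), ‖Complex.I * (freq m e : ℂ)‖ = |freq m e| := fun m e => by simp
  have hw : ∀ k, 0 < weight (μ k) ^ k := fun k => pow_pos (weight_pos _) k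
  refine ⟨Set.range μ, fun hfin => ?_, fun ⟨k, hk⟩ => hμ0 k hk,
    RapidDecay.indicator_range fun k => ?_, RapidDecay.indicator_range fun k => ?_⟩
  · have hne : (Set.range μ).Nonempty := Set.range_nonempty μ
    obtain ⟨_, ⟨k₀, rfl⟩, hmin⟩ := Set.exists_min_image (Set.range μ)
      (fun m => |freq m e₁| + |freq m e₂|) hfin hne
    have hpos : 0 < |freq (μ k₀) e₁| + |freq (μ k₀) e₂| := by
      by_cases h0 : freq (μ k₀) e₁ = 0
      · have := abs_pos.2 (hres _ (hμ0 k₀) h0)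
        positivity
      · have := abs_pos.2 h0
        positivity
    have hlim : Filter.Tendsto (fun k : ℕ => ε * (1 / 2 : ℝ) ^ k) Filter.atTop (𝓝 (ε * 0)) :=
      (tendsto_pow_atTop_nhds_zero_of_lt_one (by norm_num) (by norm_num)).const_mul ε
    rw [mul_zero] at hlim
    obtain ⟨k, hk⟩ := (hlim.eventually_lt_const hpos).exists
    have h1 := hmin (μ k) ⟨k, rfl⟩
    have h2 := hμ k
    have h3 : 1 ≤ weight (μ k) ^ k := one_le_pow₀ (one_le_weight _)
    nlinarith
  · rw [hn]
    exact (mul_le_mul_of_nonneg_right (le_add_of_nonneg_right (abs_nonneg _)) (hw k).le).trans (hμ k)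
  · rw [hn]
    exact (mul_le_mul_of_nonneg_right (le_add_of_nonneg_left (abs_nonneg _)) (hw k).le).trans (hμ k)

theorem norm_synth_le {a : (Fin n → ℤ) → ℂ} (ha : Summable fun m => ‖a m‖) (x : Euc n) :
    ‖synth a x‖ ≤ ∑' m, ‖a m‖ := by
  have h1 : ∀ m, ‖a m * chr m x‖ = ‖a m‖ := fun m => by rw [norm_mul, norm_chr, mul_one]
  have h2 : Summable fun m => ‖a m * chr m x‖ := by simpa only [h1] using ha
  refine (norm_tsum_le_tsum_norm h2).trans_eq ?_
  simp only [h1]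

theorem fc_const (c : ℂ) (m : Fin n → ℤ) :
    fc n (ContinuousMap.const _ c) m = if m = 0 then c else 0 := by
  obtain ⟨u, hu, hs⟩ := exists_torus_synth (summable_single (0 : Fin n → ℤ) c)
  have : ContinuousMap.const _ c = u := by
    ext t
    obtain ⟨x, rfl⟩ := toTorus_surjective t
    rw [hs, synth_single, chr_zero_left, mul_one]
    rfl
  rw [this, hu]

theorem eq_const_of_fc {F : C(Tor n, ℂ)} (h : ∀ m, m ≠ 0 → fc n F m = 0) :
    F = ContinuousMap.const _ (fc n F 0) := by
  refine fc_injective (lp.ext (funext fun m => ?_))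
  rw [fc_const]
  split_ifs with hm
  · rw [hm]
  · exact h m hm

theorem fc_const_mul (c : ℂ) (p : C(Tor n, ℂ)) (m : Fin n → ℤ) :
    fc n (ContinuousMap.const _ c * p) m = c * fc n p m := by
  have : ContinuousMap.const _ c * p = c • p := by ext; rfl
  rw [this, map_smul]
  rfl

end smallFrequencies

section obstruction

variable {n : ℕ} {P : Submodule ℝ (Euc n)}

theorem inner_rotation_left {Q : Submodule ℝ (Euc n)} {J₀ : Q →ₗ[ℝ] Q} (hsq : ∀ w, J₀ (J₀ w) = -w)
    (hiso : ∀ w w' : Q, ⟪J₀ w, J₀ w'⟫ = ⟪w, w'⟫) (v w : Q) : ⟪J₀ v, w⟫ = -⟪v, J₀ w⟫ := by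
  rw [← hiso (J₀ v) w, hsq, inner_neg_left]

/-- An adapted Euclidean metric provides a function with periodic derivative that is holomorphic
on the leaves and not critical at the origin. -/
theorem HasAdaptedEuclideanMetric.exists_leafwise_holomorphic (hP : Module.finrank ℝ P = 2)
    (f : PlaneFrame P) {τ : StdTorus n → ℂ} (hτ : Continuous fun x : Euc n => τ (x : StdTorus n))
    (him : ∀ p, 0 < (τ p).im) (h : HasAdaptedEuclideanMetric 2 P fun p => f.rotation (τ p)) :
    ∃ (W : Euc n → ℂ) (ℓ : Euc n →L[ℝ] ℂ), ContDiff ℝ 2 W ∧ LatticePeriodic (fun x => W x - ℓ x) ∧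
      (∀ x, fderiv ℝ W x f.e₂ = τ (x : StdTorus n) * fderiv ℝ W x f.e₁) ∧
      fderiv ℝ W 0 f.e₁ ≠ 0 := by
  obtain ⟨h, hh, hE, hTG, hhJ⟩ := h
  obtain ⟨Φ, hΦ⟩ := exists_development hh hE
  obtain ⟨A, hA⟩ := hΦ.exists_linear_part hh
  have hΦ2 : ContDiff ℝ 2 Φ := contDiffOn_univ.1 hΦ.contDiffOn
  obtain ⟨J₀, hsq, hiso, hJ₀⟩ := hΦ.exists_rotation hP hh (hΦ.map_eq hh hTG A hA)
    (f.isLeafComplexStructure hτ him) hhJ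
  obtain ⟨b, hb, -⟩ := hJ₀ 0 f.e₁
  let L : Euc n →L[ℝ] ℂ := Complex.ofRealCLM.comp (innerSL ℝ (b : Euc n)) +
    Complex.I • Complex.ofRealCLM.comp (innerSL ℝ (J₀ b : Euc n))
  have hL : ∀ v, L v = (⟪(b : Euc n), v⟫ : ℂ) + Complex.I * ⟪(J₀ b : Euc n), v⟫ := fun v => rfl
  have hW : ∀ x u, fderiv ℝ (fun x => L (Φ x)) x u = L (fderiv ℝ Φ x u) := fun x u => by
    have h1 : HasFDerivAt (fun x => L (Φ x)) (L.comp (fderiv ℝ Φ x)) x :=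
      L.hasFDerivAt.comp x (hΦ.differentiableAt (Set.mem_univ x)).hasFDerivAt
    rw [h1.fderiv]
    rfl
  refine ⟨fun x => L (Φ x), L.comp (A : Euc n →L[ℝ] Euc n), L.contDiff.comp hΦ2,
    fun x γ hγ => ?_, fun x => ?_, ?_⟩
  · change L (Φ (x + γ)) - L (A (x + γ)) = L (Φ x) - L (A x)
    rw [← map_sub, ← map_sub]
    exact congrArg L (hA x γ hγ)
  · rw [hW, hW]
    obtain ⟨w, hw, hJw⟩ := hJ₀ x f.e₁
    have h1 : L (J₀ w : Euc n) = Complex.I * L (w : Euc n) := by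
      have h2 : ⟪(b : Euc n), (J₀ w : Euc n)⟫ = -⟪(J₀ b : Euc n), (w : Euc n)⟫ := by
        rw [eq_neg_iff_add_eq_zero, add_comm, ← eq_neg_iff_add_eq_zero]
        exact inner_rotation_left hsq hiso b w
      have h3 : ⟪(J₀ b : Euc n), (J₀ w : Euc n)⟫ = ⟪(b : Euc n), (w : Euc n)⟫ := hiso b w
      rw [hL, hL, h2, h3, Complex.ofReal_neg]
      linear_combination -(⟪(J₀ b : Euc n), (w : Euc n)⟫ : ℂ) * Complex.I_sq
    have h2 : fderiv ℝ Φ x f.e₂ = (τ (x : StdTorus n)).im • (J₀ w : Euc n) +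
        (τ (x : StdTorus n)).re • (w : Euc n) := by
      have h0 := (him (x : StdTorus n)).ne'
      rw [hJw, hw, f.rotation_apply, f.c₁_e₁, f.c₂_e₁]
      simp only [Submodule.coe_add, Submodule.coe_smul, map_add, map_smul, mul_one, mul_zero,
        add_zero, smul_add, smul_smul]
      rw [mul_div_cancel₀ _ h0, mul_one_div_cancel h0, one_smul]
      module
    rw [h2, map_add, map_smul, map_smul, h1, ← hw, Complex.real_smul, Complex.real_smul]
    linear_combination L (w : Euc n) * Complex.re_add_im (τ (x : StdTorus n))
  · rw [hW, ← hb, hL]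
    intro h0
    have h1 := congrArg Complex.re h0
    simp only [Complex.add_re, Complex.ofReal_re, Complex.mul_re, Complex.I_re, Complex.I_im,
      Complex.ofReal_im, zero_mul, mul_zero, sub_zero, add_zero, Complex.zero_re] at h1
    have h2 : fderiv ℝ Φ 0 f.e₁ = 0 := by rw [← hb, inner_self_eq_zero.1 h1]
    have h3 := hΦ.injective hh 0 (h2.trans (map_zero _).symm)
    have h4 := f.c₁_e₁
    rw [h3, map_zero] at h4
    exact zero_ne_one h4

theorem ext_norm_sqSum {a b : SqSum n} (h : ∀ m, ‖a m‖ = ‖b m‖) : ‖a‖ = ‖b‖ := by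
  rw [lp.norm_eq_tsum_rpow (by norm_num), lp.norm_eq_tsum_rpow (by norm_num)]
  simp only [h]

/-- A periodic solution of a Beltrami equation is leafwise constant. -/
theorem sym_mul_fc_eq_zero (e₁ e₂ : Euc n) {F ρ : C(Tor n, ℂ)} (hρ : ‖ρ‖ < 1)
    (hF : ContDiff ℝ 1 fun x => F (toTorus n x))
    (h : ∀ x, dzbar e₁ e₂ (fun x => F (toTorus n x)) x =
      ρ (toTorus n x) * dz e₁ e₂ (fun x => F (toTorus n x)) x) (m : Fin n → ℤ) :
    sym e₁ e₂ m * fc n F m = 0 := by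
  have hper := latticePeriodic_comp_toTorus fun t => F t
  have hA := descend_apply (dz e₁ e₂ fun x => F (toTorus n x)) (continuous_dz hF e₁ e₂)
    (hper.dz e₁ e₂)
  have hB := descend_apply (dzbar e₁ e₂ fun x => F (toTorus n x)) (continuous_dzbar hF e₁ e₂)
    (hper.dzbar e₁ e₂)
  set A := descend (dz e₁ e₂ fun x => F (toTorus n x)) (continuous_dz hF e₁ e₂) (hper.dz e₁ e₂)
  set B := descend (dzbar e₁ e₂ fun x => F (toTorus n x)) (continuous_dzbar hF e₁ e₂)
    (hper.dzbar e₁ e₂)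
  have hBA : B = ρ * A := by
    ext t
    obtain ⟨x, rfl⟩ := toTorus_surjective t
    rw [hB, h, ContinuousMap.mul_apply, hA]
  have hn : ‖fc n B‖ = ‖fc n A‖ := ext_norm_sqSum fun m => by
    rw [fc_of_eq_dz F A hF e₁ e₂ hA, fc_of_eq_dzbar F B hF e₁ e₂ hB, norm_mul, norm_mul, norm_sym]
  have hle : ‖fc n A‖ ≤ ‖ρ‖ * ‖fc n A‖ := by
    conv_lhs => rw [← hn, hBA, ← mulOp_fc]
    exact norm_mulOp_le _ _
  have h0 : fc n A = 0 := by
    by_contra hne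
    have := norm_pos_iff.2 hne
    nlinarith
  rw [← fc_of_eq_dz F A hF e₁ e₂ hA, h0]
  rfl

theorem exists_leafwise_constant_multiplier {e₁ e₂ : Euc n} {p₁ p₂ : C(Tor n, ℂ)}
    (hp₁ : ContDiff ℝ 1 fun x => p₁ (toTorus n x)) (hp₂ : ContDiff ℝ 1 fun x => p₂ (toTorus n x))
    (hp : ∀ x, fderiv ℝ (fun x => p₁ (toTorus n x)) x e₂ =
      fderiv ℝ (fun x => p₂ (toTorus n x)) x e₁)
    (h₁ : ∀ t, ‖p₁ t - 1‖ ≤ 1 / 4) (h₂ : ∀ t, ‖p₂ t - Complex.I‖ ≤ 1 / 4)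
    {W : Euc n → ℂ} {ℓ : Euc n →L[ℝ] ℂ} (hW : ContDiff ℝ 2 W)
    (hWℓ : LatticePeriodic fun x => W x - ℓ x)
    (hW12 : ∀ x, p₁ (toTorus n x) * fderiv ℝ W x e₂ = p₂ (toTorus n x) * fderiv ℝ W x e₁)
    (hW0 : fderiv ℝ W 0 e₁ ≠ 0) :
    ∃ F Y : C(Tor n, ℂ), F ≠ 0 ∧ (∀ m, sym e₁ e₂ m * fc n F m = 0) ∧
      ∀ m, m ≠ 0 → fc n (F * p₁) m = Complex.I * freq m e₁ * fc n Y m ∧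
        fc n (F * p₂) m = Complex.I * freq m e₂ * fc n Y m := by
  have hI : ‖Complex.I‖ = 1 := Complex.norm_I
  have hq : ∀ t, 3 / 2 ≤ ‖p₁ t - Complex.I * p₂ t‖ := fun t => by
    have h3 : p₁ t - Complex.I * p₂ t =
        2 - (-(p₁ t - 1) + Complex.I * (p₂ t - Complex.I)) := by
      linear_combination -Complex.I_sq
    have h4 : ‖-(p₁ t - 1) + Complex.I * (p₂ t - Complex.I)‖ ≤ 1 / 2 := by
      refine (norm_add_le _ _).trans ?_
      rw [norm_neg, norm_mul, hI]
      linarith [h₁ t, h₂ t]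
    have h5 := norm_sub_norm_le (2 : ℂ) (-(p₁ t - 1) + Complex.I * (p₂ t - Complex.I))
    rw [h3]
    have h6 : ‖(2 : ℂ)‖ = 2 := by simp
    linarith
  have hr : ∀ t, ‖p₁ t + Complex.I * p₂ t‖ ≤ 1 / 2 := fun t => by
    have h3 : p₁ t + Complex.I * p₂ t = (p₁ t - 1) + Complex.I * (p₂ t - Complex.I) := by
      linear_combination Complex.I_sq
    rw [h3]
    refine (norm_add_le _ _).trans ?_
    rw [norm_mul, hI]
    linarith [h₁ t, h₂ t]
  have hq0 : ∀ t, p₁ t - Complex.I * p₂ t ≠ 0 := fun t h0 => by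
    have := hq t
    rw [h0, norm_zero] at this
    linarith
  have hp0 : ∀ t, p₁ t ≠ 0 := fun t h0 => by
    have := h₁ t
    rw [h0] at this
    norm_num at this
  let ρ : C(Tor n, ℂ) := ⟨fun t => (p₁ t + Complex.I * p₂ t) / (p₁ t - Complex.I * p₂ t),
    Continuous.div (by fun_prop) (by fun_prop) hq0⟩
  have hρ : ‖ρ‖ < 1 := by
    refine lt_of_le_of_lt ((ContinuousMap.norm_le ρ (by norm_num : (0:ℝ) ≤ 1 / 3)).2 fun t => ?_)
      (by norm_num)
    change ‖(p₁ t + Complex.I * p₂ t) / (p₁ t - Complex.I * p₂ t)‖ ≤ 1 / 3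
    rw [norm_div, div_le_iff₀ (by linarith [hq t])]
    linarith [hq t, hr t]
  have hG : ContDiff ℝ 2 fun x => W x - ℓ x := hW.sub ℓ.contDiff
  have hWd : ∀ x, DifferentiableAt ℝ W x := fun x => hW.differentiable (by norm_num) x
  have hdG : ∀ x e, fderiv ℝ (fun x => W x - ℓ x) x e = fderiv ℝ W x e - ℓ e := fun x e => by
    rw [fderiv_fun_sub (hWd x) ℓ.differentiableAt, ℓ.fderiv]
    rfl
  have hD1 : ContDiff ℝ 1 (fderiv ℝ W) := hW.fderiv_right (by norm_num)
  have hDe : ∀ e, ContDiff ℝ 1 fun x => fderiv ℝ W x e := fun e => hD1.clm_apply contDiff_const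
  have hDD : ∀ x u v, fderiv ℝ (fun x => fderiv ℝ W x u) x v = fderiv ℝ (fderiv ℝ W) x v u :=
    fun x u v => by
      rw [fderiv_clm_apply (hD1.differentiable (by norm_num) x) (differentiableAt_const _)]
      simp
  have hsymm : ∀ x, fderiv ℝ (fun x => fderiv ℝ W x e₁) x e₂ =
      fderiv ℝ (fun x => fderiv ℝ W x e₂) x e₁ := fun x => by
    rw [hDD, hDD]
    exact (hW.contDiffAt.isSymmSndFDerivAt (by simp)) e₂ e₁
  have hDper : ∀ e, LatticePeriodic fun x => fderiv ℝ W x e := fun e x γ hγ => by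
    have h3 := congrArg (fun L : Euc n →L[ℝ] ℂ => L e) (hWℓ.fderiv x γ hγ)
    simp only [hdG] at h3
    exact sub_left_injective h3
  let Y : C(Tor n, ℂ) := descend (fun x => W x - ℓ x) hG.continuous hWℓ
  have hY : ∀ x, Y (toTorus n x) = W x - ℓ x := descend_apply _ _ _
  let F₀ : Euc n → ℂ := fun x => fderiv ℝ W x e₁ / p₁ (toTorus n x)
  have hF₀ : ContDiff ℝ 1 F₀ := by
    simp only [F₀, div_eq_mul_inv]
    exact (hDe e₁).mul (hp₁.inv fun x => hp0 _)
  have hF₀per : LatticePeriodic F₀ := fun x γ hγ =>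
    congrArg₂ (· / ·) (hDper e₁ x γ hγ) (latticePeriodic_comp_toTorus (fun t => p₁ t) x γ hγ)
  let F : C(Tor n, ℂ) := descend F₀ hF₀.continuous hF₀per
  have hF : ∀ x, F (toTorus n x) = F₀ x := descend_apply _ _ _
  have hFc : ContDiff ℝ 1 fun x => F (toTorus n x) := by simpa only [hF] using hF₀
  have hF1 : ∀ x, F (toTorus n x) * p₁ (toTorus n x) = fderiv ℝ W x e₁ := fun x => by
    rw [hF]
    exact div_mul_cancel₀ _ (hp0 _)
  have hF2 : ∀ x, F (toTorus n x) * p₂ (toTorus n x) = fderiv ℝ W x e₂ := fun x => by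
    refine mul_left_cancel₀ (hp0 (toTorus n x)) ?_
    linear_combination p₂ (toTorus n x) * hF1 x - hW12 x
  have hcoef : ∀ (p : C(Tor n, ℂ)) (e : Euc n),
      (∀ x, F (toTorus n x) * p (toTorus n x) = fderiv ℝ W x e) →
      ∀ m, m ≠ 0 → fc n (F * p) m = Complex.I * freq m e * fc n Y m := fun p e hpe m hm => by
    have h3 := fc_of_eq_fderiv Y (F * p - ContinuousMap.const _ (ℓ e))
      (by simpa only [hY] using hG.of_le (by norm_num)) e (fun x => by
        simp only [hY, hdG]
        rw [ContinuousMap.sub_apply, ContinuousMap.mul_apply, hpe]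
        rfl) m
    rw [← h3, map_sub]
    change _ = fc n (F * p) m - fc n (ContinuousMap.const _ (ℓ e)) m
    rw [fc_const, if_neg hm, sub_zero]
  refine ⟨F, Y, fun h0 => hW0 ?_, sym_mul_fc_eq_zero e₁ e₂ hρ hFc fun x => ?_, fun m hm =>
    ⟨hcoef p₁ e₁ hF1 m hm, hcoef p₂ e₂ hF2 m hm⟩⟩
  · rw [← hF1, h0]
    exact zero_mul _
  · have hFd : DifferentiableAt ℝ (fun x => F (toTorus n x)) x :=
      hFc.differentiable (by norm_num) x
    have h3 := hsymm x
    simp only [← hF1, ← hF2] at h3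
    rw [fderiv_fun_mul hFd (hp₁.differentiable (by norm_num) x),
      fderiv_fun_mul hFd (hp₂.differentiable (by norm_num) x)] at h3
    simp only [add_apply, smul_apply, smul_eq_mul, hp] at h3
    change _ = (p₁ (toTorus n x) + Complex.I * p₂ (toTorus n x)) /
      (p₁ (toTorus n x) - Complex.I * p₂ (toTorus n x)) * _
    rw [div_mul_eq_mul_div, eq_div_iff (hq0 _), dz, dzbar]
    generalize fderiv ℝ (fun x => F (toTorus n x)) x e₁ = F1 at *
    generalize fderiv ℝ (fun x => F (toTorus n x)) x e₂ = F2 at *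
    linear_combination Complex.I * h3

end obstruction

section nonDiophantine

variable {n : ℕ} {P : Submodule ℝ (Euc n)}

theorem div_im_pos {z w : ℂ} (hz : ‖z - 1‖ ≤ 1 / 4) (hw : ‖w - Complex.I‖ ≤ 1 / 4) :
    0 < (w / z).im := by
  have h1 := (Complex.abs_re_le_norm _).trans hz
  have h2 := (Complex.abs_im_le_norm _).trans hz
  have h3 := (Complex.abs_re_le_norm _).trans hw
  have h4 := (Complex.abs_im_le_norm _).trans hw
  simp only [Complex.sub_re, Complex.sub_im, Complex.one_re, Complex.one_im, Complex.I_re,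
    Complex.I_im, sub_zero, abs_le] at h1 h2 h3 h4
  have hz0 : z ≠ 0 := fun h => by
    rw [h] at hz
    norm_num at hz
  rw [Complex.div_im, ← sub_div]
  refine div_pos ?_ (Complex.normSq_pos.2 hz0)
  nlinarith

/-- If `a₁`, `a₂` are the Fourier coefficients of the leafwise derivatives of a multivalued
function, then for the leafwise complex structures with `τ = p₂ / p₁` an adapted Euclidean metric
gives rise to a leafwise constant multiplier. -/
theorem exists_metric_without_adapted (hP : Module.finrank ℝ P = 2) (f : PlaneFrame P)
    {a₁ a₂ : (Fin n → ℤ) → ℂ} (ha₁ : RapidDecay a₁) (ha₂ : RapidDecay a₂)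
    (ha : ∀ m, freq m (f.e₂ : Euc n) * a₁ m = freq m (f.e₁ : Euc n) * a₂ m)
    (h₁ : ∀ x, ‖synth a₁ x - 1‖ ≤ 1 / 4) (h₂ : ∀ x, ‖synth a₂ x - Complex.I‖ ≤ 1 / 4)
    (hno : ∀ p₁ p₂ F Y : C(Tor n, ℂ), (∀ m, fc n p₁ m = a₁ m) → (∀ m, fc n p₂ m = a₂ m) →
      (∀ x, p₁ (toTorus n x) = synth a₁ x) → F ≠ 0 →
      (∀ m, sym (f.e₁ : Euc n) f.e₂ m * fc n F m = 0) →
      (∀ m, m ≠ 0 → fc n (F * p₁) m = Complex.I * freq m (f.e₁ : Euc n) * fc n Y m ∧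
        fc n (F * p₂) m = Complex.I * freq m (f.e₂ : Euc n) * fc n Y m) → False) :
    ∃ (g : BilinField n) (J : StdTorus n → P →ₗ[ℝ] P), IsRiemannianMetric ∞ g ∧
      IsLeafComplexStructure P J ∧ IsLeafConformal P J g ∧ ¬ HasAdaptedEuclideanMetric 2 P J := by
  obtain ⟨p₁, hf₁, hs₁⟩ := exists_torus_synth ha₁.summable
  obtain ⟨p₂, hf₂, hs₂⟩ := exists_torus_synth ha₂.summable
  have h0 : ∀ x, synth a₁ x ≠ 0 := fun x h => by
    have := h₁ x
    rw [h] at this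
    norm_num at this
  have hper : LatticePeriodic fun x => synth a₂ x / synth a₁ x := fun x γ hγ =>
    congrArg₂ (· / ·) (latticePeriodic_synth ha₂.summable x γ hγ)
      (latticePeriodic_synth ha₁.summable x γ hγ)
  let τ : StdTorus n → ℂ := onTorus fun x => synth a₂ x / synth a₁ x
  have hτ : ∀ x : Euc n, τ (x : StdTorus n) = synth a₂ x / synth a₁ x := onTorus_coe hper
  have hτc : ContDiff ℝ ∞ fun x : Euc n => τ (x : StdTorus n) := by
    simp only [hτ, div_eq_mul_inv]
    exact ha₂.contDiff_synth.mul (ha₁.contDiff_synth.inv h0)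
  have him : ∀ p, 0 < (τ p).im := fun p => div_im_pos (h₁ _) (h₂ _)
  refine ⟨fun p => f.metric (τ p), fun p => f.rotation (τ p), f.isRiemannianMetric hτc him,
    f.isLeafComplexStructure hτc.continuous him, f.isLeafConformal him, fun had => ?_⟩
  obtain ⟨W, ℓ, hW, hWℓ, hW12, hW0⟩ :=
    had.exists_leafwise_holomorphic hP f hτc.continuous him
  have h1t : ∀ t, ‖p₁ t - 1‖ ≤ 1 / 4 := fun t => by
    obtain ⟨x, rfl⟩ := toTorus_surjective t
    rw [hs₁]
    exact h₁ x
  have h2t : ∀ t, ‖p₂ t - Complex.I‖ ≤ 1 / 4 := fun t => by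
    obtain ⟨x, rfl⟩ := toTorus_surjective t
    rw [hs₂]
    exact h₂ x
  obtain ⟨F, Y, hF, hsym, hc⟩ := exists_leafwise_constant_multiplier (p₁ := p₁) (p₂ := p₂)
    (e₁ := (f.e₁ : Euc n)) (e₂ := (f.e₂ : Euc n))
    (by simpa only [hs₁] using ha₁.contDiff_synth.of_le (by exact_mod_cast le_top))
    (by simpa only [hs₂] using ha₂.contDiff_synth.of_le (by exact_mod_cast le_top))
    (fun x => by
      simp only [hs₁, hs₂]
      rw [ha₁.fderiv_synth, ha₂.fderiv_synth]
      congr 1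
      ext m
      rw [mul_assoc, mul_assoc, ha])
    h1t h2t hW hWℓ (fun x => by
      rw [hW12, hτ, hs₁, hs₂, ← mul_assoc, mul_div_cancel₀ _ (h0 x)]) hW0
  exact hno p₁ p₂ F Y hf₁ hf₂ hs₁ hF hsym hc

theorem sym_eq_zero_iff (e₁ e₂ : Euc n) (m : Fin n → ℤ) :
    sym e₁ e₂ m = 0 ↔ freq m e₁ = 0 ∧ freq m e₂ = 0 := by
  constructor
  · intro h
    rw [sym, div_eq_zero_iff, mul_eq_zero] at h
    have h1 := (h.resolve_right two_ne_zero).resolve_left Complex.I_ne_zero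
    have h2 := congrArg Complex.re h1
    have h3 := congrArg Complex.im h1
    simp at h2 h3
    exact ⟨h2, h3⟩
  · rintro ⟨h1, h2⟩
    rw [sym, h1, h2]
    simp

theorem exists_metric_without_adapted_of_resonance (hP : Module.finrank ℝ P = 2)
    (f : PlaneFrame P) {m₀ : Fin n → ℤ} (hm₀ : m₀ ≠ 0) (h1 : freq m₀ (f.e₁ : Euc n) = 0)
    (h2 : freq m₀ (f.e₂ : Euc n) = 0) :
    ∃ (g : BilinField n) (J : StdTorus n → P →ₗ[ℝ] P), IsRiemannianMetric ∞ g ∧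
      IsLeafComplexStructure P J ∧ IsLeafConformal P J g ∧ ¬ HasAdaptedEuclideanMetric 2 P J := by
  have hs : ∀ (c : ℂ) x, synth (fun m : Fin n → ℤ => if m = 0 then c else 0) x = c := fun c x => by
    rw [synth_single, chr_zero_left, mul_one]
  refine exists_metric_without_adapted hP f (rapidDecay_single 0 1)
    ((rapidDecay_single 0 Complex.I).add (rapidDecay_single m₀ (1 / 4))) (fun m => ?_)
    (fun x => ?_) (fun x => ?_) fun p₁ p₂ F Y hf₁ hf₂ hs₁ hF hsym hc => ?_
  · by_cases hm : m = 0
    · subst hm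
      simp [freq_apply]
    · by_cases hm' : m = m₀
      · subst hm'
        rw [h1, h2]
        simp
      · simp [hm, hm']
  · rw [hs]
    norm_num
  · rw [synth_add (summable_single _ _) (summable_single _ _), hs, synth_single, add_sub_cancel_left,
      norm_mul, norm_chr]
    norm_num
  · have hp₁ : F * p₁ = F := by
      ext t
      obtain ⟨x, rfl⟩ := toTorus_surjective t
      rw [ContinuousMap.mul_apply, hs₁, hs, mul_one]
    have hconst := eq_const_of_fc (F := F) fun m hm => by
      by_cases h0 : sym (f.e₁ : Euc n) f.e₂ m = 0
      · rw [← hp₁, (hc m hm).1, ((sym_eq_zero_iff _ _ _).1 h0).1]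
        simp
      · exact (mul_eq_zero.1 (hsym m)).resolve_left h0
    have h3 := (hc m₀ hm₀).2
    rw [hconst, fc_const_mul, hf₂, h2] at h3
    simp [hm₀] at h3
    refine hF ?_
    rw [hconst, h3]
    rfl

theorem exists_metric_without_adapted_of_small_freq (hP : Module.finrank ℝ P = 2)
    (f : PlaneFrame P) (hsmall : ∀ ε : ℝ, 0 < ε → ∀ k : ℕ, ∃ m : Fin n → ℤ, m ≠ 0 ∧
      (|freq m (f.e₁ : Euc n)| + |freq m (f.e₂ : Euc n)|) * weight m ^ k ≤ ε)
    (hres : ∀ m : Fin n → ℤ, m ≠ 0 → freq m (f.e₁ : Euc n) = 0 → freq m (f.e₂ : Euc n) ≠ 0) :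
    ∃ (g : BilinField n) (J : StdTorus n → P →ₗ[ℝ] P), IsRiemannianMetric ∞ g ∧
      IsLeafComplexStructure P J ∧ IsLeafConformal P J g ∧ ¬ HasAdaptedEuclideanMetric 2 P J := by
  obtain ⟨S, hS, hS0, ⟨hd₁, hn₁⟩, hd₂, hn₂⟩ :=
    exists_small_spectrum (by norm_num : (0 : ℝ) < 1 / 8) hsmall hres
  have hs : ∀ (c : ℂ) x, synth (fun m : Fin n → ℤ => if m = 0 then c else 0) x = c := fun c x => by
    rw [synth_single, chr_zero_left, mul_one]
  have hest : ∀ (c : ℂ) (e : Euc n), RapidDecay (S.indicator fun m => Complex.I * freq m e) →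
      ∑' m, ‖S.indicator (fun m => Complex.I * (freq m e : ℂ)) m‖ ≤ 2 * (1 / 8) →
      ∀ x, ‖synth (fun m => (if m = 0 then c else 0) +
        S.indicator (fun m => Complex.I * (freq m e : ℂ)) m) x - c‖ ≤ 1 / 4 := fun c e hd hn x => by
    rw [synth_add (summable_single _ _) hd.summable, hs, add_sub_cancel_left]
    refine (norm_synth_le (by simpa using hd 0) x).trans (hn.trans (by norm_num))
  refine exists_metric_without_adapted hP f ((rapidDecay_single 0 1).add hd₁)
    ((rapidDecay_single 0 Complex.I).add hd₂) (fun m => ?_) (hest _ _ hd₁ hn₁) (hest _ _ hd₂ hn₂)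
    fun p₁ p₂ F Y hf₁ hf₂ hs₁ hF hsym hc => ?_
  · by_cases hm : m = 0
    · subst hm
      simp [freq_apply]
    · by_cases hmS : m ∈ S
      · simp only [if_neg hm, Set.indicator_of_mem hmS]
        ring
      · simp [hm, hmS]
  · have hconst := eq_const_of_fc (F := F) fun m hm =>
      (mul_eq_zero.1 (hsym m)).resolve_left fun h0 =>
        hres m hm ((sym_eq_zero_iff _ _ _).1 h0).1 ((sym_eq_zero_iff _ _ _).1 h0).2
    set c := fc n F 0 with hcdef
    have hc0 : c ≠ 0 := fun h => hF (by rw [hconst, h]; rfl)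
    have hY : ∀ m ∈ S, fc n Y m = c := fun m hm => by
      have hm0 : m ≠ 0 := fun h => hS0 (h ▸ hm)
      obtain ⟨h3, h4⟩ := hc m hm0
      rw [hconst, fc_const_mul, hf₁, if_neg hm0, zero_add, Set.indicator_of_mem hm] at h3
      rw [hconst, fc_const_mul, hf₂, if_neg hm0, zero_add, Set.indicator_of_mem hm] at h4
      by_cases h5 : freq m (f.e₁ : Euc n) = 0
      · have h6 : Complex.I * (freq m (f.e₂ : Euc n) : ℂ) ≠ 0 :=
          mul_ne_zero Complex.I_ne_zero (Complex.ofReal_ne_zero.2 (hres m hm0 h5))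
        exact mul_left_cancel₀ h6 (h4.symm.trans (mul_comm _ _))
      · have h6 : Complex.I * (freq m (f.e₁ : Euc n) : ℂ) ≠ 0 :=
          mul_ne_zero Complex.I_ne_zero (Complex.ofReal_ne_zero.2 h5)
        exact mul_left_cancel₀ h6 (h3.symm.trans (mul_comm _ _))
    have hsum : Summable fun m => ‖fc n Y m‖ ^ (2 : ℝ) := by
      have h3 := (lp.memℓp (fc n Y)).summable (by norm_num)
      simpa using h3
    have h3 := hsum.tendsto_cofinite_zero
    have h4 : ∀ᶠ m in Filter.cofinite, ‖fc n Y m‖ ^ (2 : ℝ) < ‖c‖ ^ (2 : ℝ) :=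
      h3.eventually_lt_const (Real.rpow_pos_of_pos (norm_pos_iff.2 hc0) _)
    refine hS ((Filter.eventually_cofinite.1 h4).subset fun m hm => ?_)
    rw [Set.mem_ofPred_eq, hY m hm]
    exact lt_irrefl _

theorem exists_metric_without_adapted_of_not_isDiophantine (hP : Module.finrank ℝ P = 2)
    (hD : ¬ IsDiophantine P) :
    ∃ (g : BilinField n) (J : StdTorus n → P →ₗ[ℝ] P), IsRiemannianMetric ∞ g ∧
      IsLeafComplexStructure P J ∧ IsLeafConformal P J g ∧ ¬ HasAdaptedEuclideanMetric 2 P J := by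
  obtain ⟨f, hf⟩ := exists_small_freq hP hD
  by_cases h : ∃ m : Fin n → ℤ, m ≠ 0 ∧ freq m (f.e₁ : Euc n) = 0 ∧ freq m (f.e₂ : Euc n) = 0
  · obtain ⟨m, hm, h1, h2⟩ := h
    exact exists_metric_without_adapted_of_resonance hP f hm h1 h2
  · exact exists_metric_without_adapted_of_small_freq hP f hf fun m hm h1 h2 => h ⟨m, hm, h1, h2⟩

end nonDiophantine

theorem theorem2 (n : ℕ) (P : Submodule ℝ (EuclideanSpace ℝ (Fin n)))
    (hP : Module.finrank ℝ P = 2) :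
    -- a Diophantine foliation, with a metric of class `C^∞` or analytic
    (IsDiophantine P → ∀ k : WithTop ℕ∞, k = ∞ ∨ k = ω →
      ∀ g : BilinField n, IsRiemannianMetric k g →
      ∀ J : StdTorus n → P →ₗ[ℝ] P, IsLeafComplexStructure P J → IsLeafConformal P J g →
        HasAdaptedEuclideanMetric k P J ∧ HasLinearModel k P J) ∧
    -- the two properties are equivalent, for every linear foliation
    (∀ k : WithTop ℕ∞, k = ∞ ∨ k = ω →
      ∀ g : BilinField n, IsRiemannianMetric k g →
      ∀ J : StdTorus n → P →ₗ[ℝ] P, IsLeafComplexStructure P J → IsLeafConformal P J g →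
        (HasAdaptedEuclideanMetric k P J ↔ HasLinearModel k P J)) ∧
    -- a foliation that is not Diophantine
    (¬ IsDiophantine P →
      ∃ (g : BilinField n) (J : StdTorus n → P →ₗ[ℝ] P), IsRiemannianMetric ∞ g ∧
        IsLeafComplexStructure P J ∧ IsLeafConformal P J g ∧
        ¬ HasAdaptedEuclideanMetric 2 P J) := by
  refine ⟨fun hD k hk g hg J hJ hgJ => ?_, fun k hk g _ J hJ _ =>
    ⟨hasLinearModel_of_hasAdaptedEuclideanMetric hk hP hJ,
      hasAdaptedEuclideanMetric_of_hasLinearModel hk hP⟩,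
    exists_metric_without_adapted_of_not_isDiophantine hP⟩
  have h := hasAdaptedEuclideanMetric_of_isDiophantine hk hP hD hg hJ hgJ
  exact ⟨h, hasLinearModel_of_hasAdaptedEuclideanMetric hk hP hJ h⟩
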